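/- Let $\epsilon\in[0,1)$, $\Omega=\mathbb{T}_{2\pi}\times\mathbb{R}$ with coordinates $(x,y)$, $\tilde\Omega=\mathbb{T}_{2\pi}\times(-1,1)$ with coordinates $(\theta,\gamma)$, and let $$\psi_\epsilon=\ln\frac{\cosh y+\epsilon\cos x}{\sqrt{1-\epsilon^2}},\qquad g'(\psi_\epsilon)=2e^{-2\psi_\epsilon}=\frac{2(1-\epsilon^2)}{(\cosh y+\epsilon\cos x)^2},$$ $$\eta_\epsilon=\frac{\sqrt{1-\epsilon^2}\,\sin x}{\cosh y+\epsilon\cos x},\qquad \gamma_\epsilon=\frac{\sqrt{1-\epsilon^2}\,\sinh y}{\cosh y+\epsilon\cos x},\qquad \xi_\epsilon=\frac{\epsilon\cosh y+\cos x}{\cosh y+\epsilon\cos x}.$$ Where $\gamma_\epsilon^2<1$ let $\theta_\epsilon=\arccos\bigl(\xi_\epsilon/\sqrt{1-\gamma_\epsilon^2}\bigr)$ for $x\in[0,\pi]$ and $\theta_\epsilon=2\pi-\arccos\bigl(\xi_\epsilon/\sqrt{1-\gamma_\epsilon^2}\bigr)$ for $x\in(\pi,2\pi)$. Let $\tilde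 X_\epsilon$ be the space of real weakly differentiable functions $\psi$ on $\Omega$ with $\iint_\Omega|\nabla\psi|^2\,dx\,dy<\infty$ and $\int_0^{2\pi}\frac{\psi(x,0)}{1+\epsilon\cos x}\,dx=0$ (in the sense of traces), with inner product $(\psi,\phi)_{\tilde X_\epsilon}=\iint_\Omega\nabla\psi\cdot\nabla\phi\,dx\,dy$. Let $\tilde Y$ be the space of real weakly differentiable functions $\Psi$ on $\tilde\Omega$ with $\iint_{\tilde\Omega}\bigl(\frac{|\Psi_\theta|^2}{1-\gamma^2}+(1-\gamma^2)|\Psi_\gamma|^2\bigr)d\theta\,d\gamma<\infty$ and $\int_0^{2\pi}\Psi(\theta,0)\,d\theta=0$. Put $$P_\epsilon\psi=\frac{\iint_\Omega g'(\psi_\epsilon)\psi\,dx\,dy}{\iint_\Omega g'(\psi_\epsilon)\,dx\,dy},\qquad \tilde P\Psi=\frac1{4\pi}\iint_{\tilde\Omega}\Psi\,d\theta\,d\gamma .$$ Here $\iint_{\tilde\Omega}\Psi^2<\infty$ for $\Psi\in\tilde Y$, $\iint_\Omega g'(\psi_\epsilon)<\infty$, and $\iint_\Omega g'(\psi_\epsilon)\psi^2<\infty$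 for $\psi\in\tilde X_\epsilon$. Let $L_n$ be the Legendre polynomial of degree $n$, $L_{n,k}(s)=(1-s^2)^{k/2}L_n^{(k)}(s)$, and $\lambda_n=n(n+1)/2$. Equations are understood in the weak sense, tested against all functions of the same space. (a) The eigenvalues of $$-\frac{1}{1-\gamma^2}\Psi_{\theta\theta}-\bigl((1-\gamma^2)\Psi_\gamma\bigr)_\gamma=2\lambda(\Psi-\tilde P\Psi),\qquad \Psi\in\tilde Y,$$ are exactly $\lambda_n$, $n\ge1$, and the eigenspace of $\lambda_n$ is spanned by $L_n(\gamma)-L_n(0)$, $L_{n,k}(\gamma)\cos(k\theta)$ and $L_{n,k}(\gamma)\sin(k\theta)$, $1\le k\le n$. (b) The eigenvalues of $$-\Delta\psi=\lambda\, g'(\psi_\epsilon)(\psi-P_\epsilon\psi),\qquad \psi\in\tilde X_\epsilon,$$ are exactly $\lambda_n$, $n\ge1$, and the eigenspace of $\lambda_n$ is spanned by $L_n(\gamma_\epsilon)-L_n(0)$, $L_{n,k}(\gamma_\epsilon)\cos(k\theta_\epsilon)$ and $L_{n,k}(\gamma_\epsilon)\sin(k\theta_\epsilon)$, $1\le k\le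 n$. (c) Let $\tilde A_\epsilon=-\Delta-g'(\psi_\epsilon)(I-P_\epsilon):\tilde X_\epsilon\to\tilde X_\epsilon^*$. Then $\ker\tilde A_\epsilon=\mathrm{span}\{\eta_\epsilon,\gamma_\epsilon,\xi_\epsilon\}$, and $\langle\tilde A_\epsilon\psi,\psi\rangle\ge\frac23\|\psi\|_{\tilde X_\epsilon}^2$ for every $\psi\in\tilde X_\epsilon$ that is orthogonal to $\ker\tilde A_\epsilon$ in $\tilde X_\epsilon$. -/

import Mathlib

open Real Set Filter Topology MeasureTheory
open scoped ContDiff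

noncomputable section

namespace KelvinStuart

/-! ### Periodic functions, weak derivatives and traces

Functions on `𝕋_{2π} × I` (`I ⊆ ℝ` an open interval) are real functions on the plane, considered
almost everywhere on the strip `ℝ × I` and `2π`-periodic in the first variable; integrals over
`𝕋_{2π} × I` are integrals over the period cell `(0, 2π] × I`. -/

/-- The strip `ℝ × I`. -/
def strip (I : Set ℝ) : Set (ℝ × ℝ) := univ ×ˢ I

/-- One period cell `(0, 2π] × I` of the strip. -/
def cell (I : Set ℝ) : Set (ℝ × ℝ) := Ioc 0 (2 * π) ×ˢ I

/-- `f` is (almost everywhere) `2π`-periodic in the first variable on `ℝ × I`. -/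
def PeriodicOn (I : Set ℝ) (f : ℝ × ℝ → ℝ) : Prop :=
  ∀ᵐ p ∂(volume.restrict (strip I)), f (p.1 + 2 * π, p.2) = f p

/-- `g` is the weak derivative of `f` in the direction `v` on the open set `U`. -/
def HasWeakDeriv (U : Set (ℝ × ℝ)) (v : ℝ × ℝ) (f g : ℝ × ℝ → ℝ) : Prop :=
  LocallyIntegrableOn f U ∧ LocallyIntegrableOn g U ∧
    ∀ χ : ℝ × ℝ → ℝ, ContDiff ℝ ∞ χ → HasCompactSupport χ → tsupport χ ⊆ U →
      ∫ p in U, f p * fderiv ℝ χ p v = - ∫ p in U, g p * χ p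

open Classical in
/-- The weak derivative of `f` in the direction `v` on `U` (unique almost everywhere on `U`),
and `0` if there is none. -/
def weakDeriv (U : Set (ℝ × ℝ)) (v : ℝ × ℝ) (f : ℝ × ℝ → ℝ) : ℝ × ℝ → ℝ :=
  if h : ∃ g, HasWeakDeriv U v f g then h.choose else 0

/-- Weak partial derivative on `ℝ × I` in the first (periodic) variable. -/
def D₁ (I : Set ℝ) (f : ℝ × ℝ → ℝ) : ℝ × ℝ → ℝ := weakDeriv (strip I) (1, 0) f

/-- Weak partial derivative on `ℝ × I` in the second variable. -/
def D₂ (I : Set ℝ) (f : ℝ × ℝ → ℝ) : ℝ × ℝ → ℝ := weakDeriv (strip I) (0, 1) f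

/-- `f` has weak first-order partial derivatives on `ℝ × I`. -/
def WeaklyDifferentiable (I : Set ℝ) (f : ℝ × ℝ → ℝ) : Prop :=
  (∃ g, HasWeakDeriv (strip I) (1, 0) f g) ∧ (∃ g, HasWeakDeriv (strip I) (0, 1) f g)

/-- `t` is the trace of `f` on the circle `𝕋_{2π} × {0}` : the function `f(x,y)` tends to `t(x)`
in mean as `y → 0`. -/
def IsTrace (f : ℝ × ℝ → ℝ) (t : ℝ → ℝ) : Prop :=
  IntegrableOn t (Ioc 0 (2 * π)) ∧
    Tendsto (fun h : ℝ => (2 * h)⁻¹ * ∫ p in cell (Ioo (-h) h), |f p - t p.1|)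
      (𝓝[>] 0) (𝓝 0)

/-! ### Legendre functions -/

/-- The Legendre polynomial `L_n` (Rodrigues' formula). -/
def legendre (n : ℕ) : Polynomial ℝ :=
  Polynomial.C (1 / (2 ^ n * (n.factorial : ℝ))) *
    Polynomial.derivative^[n] ((Polynomial.X ^ 2 - 1) ^ n)

/-- `L_{n,k}(s) = (1 - s²)^{k/2} (d/ds)^k L_n(s)`. -/
def assocLegendre (n k : ℕ) (s : ℝ) : ℝ :=
  √(1 - s ^ 2) ^ k * (Polynomial.derivative^[k] (legendre n)).eval s

/-! ### The problem in the variables `(θ, γ) ∈ 𝕋_{2π} × (-1, 1)` -/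

/-- The interval of `γ`. -/
def J : Set ℝ := Ioo (-1) 1

/-- The inner product `∬ (Ψ_θ Φ_θ / (1-γ²) + (1-γ²) Ψ_γ Φ_γ) dθ dγ`. -/
def dirichletY (Ψ Φ : ℝ × ℝ → ℝ) : ℝ :=
  ∫ p in cell J, (1 / (1 - p.2 ^ 2) * (D₁ J Ψ p * D₁ J Φ p)
    + (1 - p.2 ^ 2) * (D₂ J Ψ p * D₂ J Φ p))

/-- The space `Ỹ` : finite energy, and mean zero on `γ = 0`. -/
structure MemY (Ψ : ℝ × ℝ → ℝ) : Prop where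
  periodic : PeriodicOn J Ψ
  weaklyDifferentiable : WeaklyDifferentiable J Ψ
  energy₁ : IntegrableOn (fun p => 1 / (1 - p.2 ^ 2) * D₁ J Ψ p ^ 2) (cell J)
  energy₂ : IntegrableOn (fun p => (1 - p.2 ^ 2) * D₂ J Ψ p ^ 2) (cell J)
  trace : ∃ t : ℝ → ℝ, IsTrace Ψ t ∧ ∫ θ in (0)..(2 * π), t θ = 0

/-- The projection `P̃Ψ = (1/4π) ∬ Ψ dθ dγ`. -/
def projY (Ψ : ℝ × ℝ → ℝ) : ℝ := (∫ p in cell J, Ψ p) / (4 * π)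

/-- `Ψ ∈ Ỹ` is a weak solution of
`-Ψ_θθ/(1-γ²) - ((1-γ²)Ψ_γ)_γ = 2 lam (Ψ - P̃Ψ)`. -/
def SolvesY (lam : ℝ) (Ψ : ℝ × ℝ → ℝ) : Prop :=
  MemY Ψ ∧ ∀ Φ, MemY Φ →
    dirichletY Ψ Φ = 2 * lam * ∫ p in cell J, (Ψ p - projY Ψ) * Φ p

/-- `lam` is an eigenvalue: there is a nonzero solution. -/
def IsEigenvalueY (lam : ℝ) : Prop :=
  ∃ Ψ, SolvesY lam Ψ ∧ ¬ Ψ =ᵐ[volume.restrict (strip J)] 0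

/-- The functions `L_n(γ) - L_n(0)`, `L_{n,k}(γ) cos(kθ)`, `L_{n,k}(γ) sin(kθ)`, `1 ≤ k ≤ n`,
of `(θ, γ)`. -/
def eigenfunctionsY (n : ℕ) : Set (ℝ × ℝ → ℝ) :=
  {fun p => (legendre n).eval p.2 - (legendre n).eval 0} ∪
    {F | ∃ k : ℕ, 1 ≤ k ∧ k ≤ n ∧
      (F = (fun p => assocLegendre n k p.2 * cos (k * p.1)) ∨
        F = (fun p => assocLegendre n k p.2 * sin (k * p.1)))}

/-! ### The problem in the variables `(x, y) ∈ Ω = 𝕋_{2π} × ℝ` -/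

/-- The stream function `ψ_ε` of the Kelvin-Stuart vortex. -/
def streamFunction (ε : ℝ) (p : ℝ × ℝ) : ℝ :=
  log ((cosh p.2 + ε * cos p.1) / √(1 - ε ^ 2))

/-- `g'(ψ_ε)`, where `g(s) = -e^{-2s}`, so that `g'(s) = 2 e^{-2s}`. -/
def gPrime (ε : ℝ) (p : ℝ × ℝ) : ℝ := 2 * exp (-2 * streamFunction ε p)

/-- `η_ε`. -/
def etaFun (ε : ℝ) (p : ℝ × ℝ) : ℝ := √(1 - ε ^ 2) * sin p.1 / (cosh p.2 + ε * cos p.1)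

/-- `γ_ε`. -/
def gammaFun (ε : ℝ) (p : ℝ × ℝ) : ℝ := √(1 - ε ^ 2) * sinh p.2 / (cosh p.2 + ε * cos p.1)

/-- `ξ_ε`. -/
def xiFun (ε : ℝ) (p : ℝ × ℝ) : ℝ := (ε * cosh p.2 + cos p.1) / (cosh p.2 + ε * cos p.1)

/-- The angle `θ_ε`. Modulo `2π`, `0 ≤ sin x` means `x ∈ [0, π]`. -/
def thetaFun (ε : ℝ) (p : ℝ × ℝ) : ℝ :=
  if 0 ≤ sin p.1 then arccos (xiFun ε p / √(1 - gammaFun ε p ^ 2))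
  else 2 * π - arccos (xiFun ε p / √(1 - gammaFun ε p ^ 2))

/-- The inner product `∬_Ω ∇ψ·∇φ dx dy`. -/
def dirichletX (ψ φ : ℝ × ℝ → ℝ) : ℝ :=
  ∫ p in cell univ, (D₁ univ ψ p * D₁ univ φ p + D₂ univ ψ p * D₂ univ φ p)

/-- The space `X̃_ε` : `∬_Ω |∇ψ|² < ∞` and `∫ ψ(x,0)/(1 + ε cos x) dx = 0`. -/
structure MemX (ε : ℝ) (ψ : ℝ × ℝ → ℝ) : Prop where
  periodic : PeriodicOn univ ψ
  weaklyDifferentiable : WeaklyDifferentiable univ ψ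
  energy₁ : IntegrableOn (fun p => D₁ univ ψ p ^ 2) (cell univ)
  energy₂ : IntegrableOn (fun p => D₂ univ ψ p ^ 2) (cell univ)
  trace : ∃ t : ℝ → ℝ, IsTrace ψ t ∧ ∫ x in (0)..(2 * π), t x * (1 / (1 + ε * cos x)) = 0

/-- The projection `P_ε ψ = ∬ g'(ψ_ε) ψ / ∬ g'(ψ_ε)`. -/
def projX (ε : ℝ) (ψ : ℝ × ℝ → ℝ) : ℝ :=
  (∫ p in cell univ, gPrime ε p * ψ p) / ∫ p in cell univ, gPrime ε p

/-- `ψ ∈ X̃_ε` is a weak solution of `-Δψ = lam g'(ψ_ε) (ψ - P_ε ψ)`. -/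
def SolvesX (ε lam : ℝ) (ψ : ℝ × ℝ → ℝ) : Prop :=
  MemX ε ψ ∧ ∀ φ, MemX ε φ →
    dirichletX ψ φ = lam * ∫ p in cell univ, gPrime ε p * (ψ p - projX ε ψ) * φ p

/-- `lam` is an eigenvalue: there is a nonzero solution. -/
def IsEigenvalueX (ε lam : ℝ) : Prop :=
  ∃ ψ, SolvesX ε lam ψ ∧ ¬ ψ =ᵐ[volume] 0

/-- The functions of `(x, y)` obtained from `eigenfunctionsY n` by inserting
`θ = θ_ε(x,y)` and `γ = γ_ε(x,y)`. -/
def eigenfunctionsX (ε : ℝ) (n : ℕ) : Set (ℝ × ℝ → ℝ) :=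
  (fun F p => F (thetaFun ε p, gammaFun ε p)) '' eigenfunctionsY n

/-- The pairing `⟨Ã_ε ψ, φ⟩` for `Ã_ε = -Δ - g'(ψ_ε)(I - P_ε) : X̃_ε → X̃_ε^*`. -/
def formA (ε : ℝ) (ψ φ : ℝ × ℝ → ℝ) : ℝ :=
  dirichletX ψ φ - ∫ p in cell univ, gPrime ε p * (ψ p - projX ε ψ) * φ p

/-- `ψ ∈ ker Ã_ε`. -/
def InKerA (ε : ℝ) (ψ : ℝ × ℝ → ℝ) : Prop :=
  MemX ε ψ ∧ ∀ φ, MemX ε φ → formA ε ψ φ = 0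

end KelvinStuart

end

/-!
# Eigenvalues of the linearised Euler equation at a Kelvin-Stuart vortex

The map `p ↦ (ξ_ε, η_ε, γ_ε)(p)` sends a period cell of the cylinder injectively and conformally
into the unit sphere, and its conformal factor is `ρ = g'(ψ_ε) / 2`. Hence a spherical harmonic of
degree `n`, composed with this map, solves `-Δe = n(n+1) ρ e = (n(n+1)/2) g'(ψ_ε) e`. Points of the
sphere are written as pairs `(z, γ) ∈ ℂ × ℝ` with `z = ξ + iη`; the harmonics of degree `n` are the
functions `L_n^{(k)}(γ) Re(c zᵏ)`, `k ≤ n`. Since `z = √(1-γ²) e^{iθ}`, they are the functions of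
the theorem (`sphereCoords_theta_gamma`). The equation for them (`laplacian_legendre`) is a
computation: the first derivatives of the coordinates are polynomials in the coordinates, and what
remains is Legendre's differential equation (`legendre_ode`).

The rest of the argument does not use compactness of an embedding. For a function `φ` of finite
Dirichlet energy, the fundamental theorem of calculus on one horizontal and on the vertical
lines, which weak derivatives satisfy on almost every line, gives `∬ e^{-|y|} φ² < ∞`
(`FiniteEnergy.integrableOn_exp_mul_sq`). As `g'(ψ_ε)` decays like `e^{-2|y|}`, all integrals
converge, and Green's identity holds between a spherical harmonic, whose gradient decays like
`e^{-|y|}`, and `φ` (`FiniteEnergy.energyForm_eq_integral`). So the spherical harmonics are weak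
eigenfunctions; the constant `L_n(0)` is subtracted from the zonal one to meet the normalisation on
`y = 0`, and for `k ≥ 1` the normalisation holds because `L_n^{(k)}(0) Re(c zᵏ) / (1 + ε cos x)` is
the derivative of a periodic function.

The spherical harmonics are complete in `L²(g'(ψ_ε) dx dy)`: by Stone-Weierstrass polynomials are
dense in the continuous functions on the sphere, and an injective measurable map generates the
Borel σ-algebra (`ae_eq_zero_of_integral_legendre`). A symmetric form with a complete system of
eigenvectors has no other eigenvalues and eigenvectors, and on the complement of one eigenspace it
is bounded below by the remaining eigenvalues (`CompleteEigensystem`). The eigenvalue problem is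
considered modulo constants, and the normalisation on `y = 0` recovers the constant. For the
operator `Ã_ε` the first eigenvalue `1` gives the kernel, and the second eigenvalue `3` gives the
constant `2/3 = 1 - 1/3`.

The problem in the variables `(θ, γ)` is the case `ε = 0` after the change of variables
`γ = tanh y`, which preserves the Dirichlet integral (`energyForm_comp_mercator`).
-/

noncomputable section

namespace KelvinStuart

/-! ### Weak derivatives -/

theorem isOpen_strip {I : Set ℝ} (hI : IsOpen I) : IsOpen (strip I) := isOpen_univ.prod hI

theorem isOpen_J : IsOpen J := isOpen_Ioo

theorem strip_univ : strip univ = univ := univ_prod_univ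

theorem measurableSet_cell {I : Set ℝ} (hI : IsOpen I) : MeasurableSet (cell I) :=
  measurableSet_Ioc.prod hI.measurableSet

theorem cell_subset_strip (I : Set ℝ) : cell I ⊆ strip I := prod_mono (subset_univ _) subset_rfl

theorem integrable_mul_of_compactSupport {U : Set (ℝ × ℝ)} {g χ : ℝ × ℝ → ℝ}
    (hg : LocallyIntegrableOn g U) (hχ : Continuous χ) (hc : HasCompactSupport χ)
    (hs : tsupport χ ⊆ U) : Integrable (fun p => g p * χ p) := by
  have h1 : IntegrableOn g (tsupport χ) := hg.integrableOn_compact_subset hs hc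
  have h2 := h1.mul_continuousOn hχ.continuousOn hc
  refine (integrableOn_iff_integrable_of_support_subset ?_).1 h2
  refine (Function.support_mul_subset_right _ _).trans (subset_tsupport _)

theorem setIntegral_mul_eq_integral {U : Set (ℝ × ℝ)} {g χ : ℝ × ℝ → ℝ}
    (hs : tsupport χ ⊆ U) : ∫ p in U, g p * χ p = ∫ p, g p * χ p := by
  refine setIntegral_eq_integral_of_forall_compl_eq_zero fun p hp => ?_
  rw [image_eq_zero_of_notMem_tsupport (fun h => hp (hs h)), mul_zero]

theorem continuous_fderiv_apply {χ : ℝ × ℝ → ℝ} (hχ : ContDiff ℝ ∞ χ) (v : ℝ × ℝ) :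
    Continuous fun p => fderiv ℝ χ p v :=
  (hχ.continuous_fderiv (by simp)).clm_apply continuous_const

theorem contDiff_fderiv_apply {χ : ℝ × ℝ → ℝ} (hχ : ContDiff ℝ ∞ χ) (v : ℝ × ℝ) :
    ContDiff ℝ ∞ fun p => fderiv ℝ χ p v :=
  (hχ.fderiv_right (m := ∞) (by simp)).clm_apply contDiff_const

/-- The defining identity of a weak derivative, with the integrals extended to the whole plane. -/
theorem HasWeakDeriv.integral_eq {U : Set (ℝ × ℝ)} {v : ℝ × ℝ} {f g : ℝ × ℝ → ℝ}
    (h : HasWeakDeriv U v f g) {χ : ℝ × ℝ → ℝ} (hχ : ContDiff ℝ ∞ χ) (hc : HasCompactSupport χ)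
    (hs : tsupport χ ⊆ U) : ∫ p, f p * fderiv ℝ χ p v = - ∫ p, g p * χ p := by
  have := h.2.2 χ hχ hc hs
  rwa [setIntegral_mul_eq_integral hs,
    setIntegral_mul_eq_integral ((tsupport_fderiv_apply_subset ℝ v).trans hs)] at this

theorem hasWeakDeriv_of_integral_eq {U : Set (ℝ × ℝ)} {v : ℝ × ℝ} {f g : ℝ × ℝ → ℝ}
    (hf : LocallyIntegrableOn f U) (hg : LocallyIntegrableOn g U)
    (h : ∀ χ : ℝ × ℝ → ℝ, ContDiff ℝ ∞ χ → HasCompactSupport χ → tsupport χ ⊆ U →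
      ∫ p, f p * fderiv ℝ χ p v = - ∫ p, g p * χ p) : HasWeakDeriv U v f g := by
  refine ⟨hf, hg, fun χ hχ hc hs => ?_⟩
  rw [setIntegral_mul_eq_integral hs,
    setIntegral_mul_eq_integral ((tsupport_fderiv_apply_subset ℝ v).trans hs)]
  exact h χ hχ hc hs

theorem HasWeakDeriv.add {U : Set (ℝ × ℝ)} {v : ℝ × ℝ} {f g f' g' : ℝ × ℝ → ℝ}
    (h : HasWeakDeriv U v f g) (h' : HasWeakDeriv U v f' g') :
    HasWeakDeriv U v (f + f') (g + g') := by
  refine hasWeakDeriv_of_integral_eq (h.1.add h'.1) (h.2.1.add h'.2.1) fun χ hχ hc hs => ?_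
  have hs' := (tsupport_fderiv_apply_subset (f := χ) ℝ v).trans hs
  simp only [Pi.add_apply, add_mul]
  rw [integral_add, integral_add, h.integral_eq hχ hc hs, h'.integral_eq hχ hc hs]
  · ring
  · exact integrable_mul_of_compactSupport h.2.1 hχ.continuous hc hs
  · exact integrable_mul_of_compactSupport h'.2.1 hχ.continuous hc hs
  · exact integrable_mul_of_compactSupport h.1 (continuous_fderiv_apply hχ v)
      (hc.fderiv_apply ℝ v) hs'
  · exact integrable_mul_of_compactSupport h'.1 (continuous_fderiv_apply hχ v)
      (hc.fderiv_apply ℝ v) hs'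

theorem HasWeakDeriv.const_smul {U : Set (ℝ × ℝ)} {v : ℝ × ℝ} {f g : ℝ × ℝ → ℝ}
    (h : HasWeakDeriv U v f g) (c : ℝ) : HasWeakDeriv U v (c • f) (c • g) := by
  refine hasWeakDeriv_of_integral_eq (h.1.smul c) (h.2.1.smul c) fun χ hχ hc hs => ?_
  simp only [Pi.smul_apply, smul_eq_mul, mul_assoc, integral_const_mul]
  rw [h.integral_eq hχ hc hs]
  ring

theorem HasWeakDeriv.smul_direction {U : Set (ℝ × ℝ)} {v : ℝ × ℝ} {f g : ℝ × ℝ → ℝ}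
    (h : HasWeakDeriv U v f g) (c : ℝ) : HasWeakDeriv U (c • v) f (c • g) := by
  refine hasWeakDeriv_of_integral_eq h.1 (h.2.1.smul c) fun χ hχ hc hs => ?_
  simp only [Pi.smul_apply, smul_eq_mul, map_smul, mul_assoc, integral_const_mul]
  rw [← mul_neg, ← h.integral_eq hχ hc hs, ← integral_const_mul]
  exact integral_congr_ae (.of_forall fun p => by ring)

theorem LocallyIntegrableOn.congr_ae {U : Set (ℝ × ℝ)} {f f' : ℝ × ℝ → ℝ} (hU : IsOpen U)
    (h : LocallyIntegrableOn f U) (hf : f =ᵐ[volume.restrict U] f') :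
    LocallyIntegrableOn f' U := by
  rw [locallyIntegrableOn_iff hU.isLocallyClosed] at h ⊢
  exact fun K hK hc => (h K hK hc).congr_fun_ae (ae_restrict_of_ae_restrict_of_subset hK hf)

theorem HasWeakDeriv.congr_ae {U : Set (ℝ × ℝ)} {v : ℝ × ℝ} {f g f' g' : ℝ × ℝ → ℝ}
    (hU : IsOpen U) (h : HasWeakDeriv U v f g) (hf : f =ᵐ[volume.restrict U] f')
    (hg : g =ᵐ[volume.restrict U] g') : HasWeakDeriv U v f' g' := by
  refine ⟨LocallyIntegrableOn.congr_ae hU h.1 hf, LocallyIntegrableOn.congr_ae hU h.2.1 hg,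
    fun χ hχ hc hs => ?_⟩
  have h1 : ∫ p in U, f' p * fderiv ℝ χ p v = ∫ p in U, f p * fderiv ℝ χ p v :=
    integral_congr_ae (hf.mono fun p hp => by simp only [hp])
  have h2 : ∫ p in U, g' p * χ p = ∫ p in U, g p * χ p :=
    integral_congr_ae (hg.mono fun p hp => by simp only [hp])
  rw [h1, h2, h.2.2 χ hχ hc hs]

theorem HasWeakDeriv.unique {U : Set (ℝ × ℝ)} {v : ℝ × ℝ} {f g g' : ℝ × ℝ → ℝ}
    (hU : IsOpen U) (h : HasWeakDeriv U v f g) (h' : HasWeakDeriv U v f g') :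
    g =ᵐ[volume.restrict U] g' := by
  have key := hU.ae_eq_zero_of_integral_contDiff_smul_eq_zero (h.2.1.sub h'.2.1)
    (fun χ hχ hc hs => ?_)
  · rw [EventuallyEq, ae_restrict_iff' hU.measurableSet]
    exact key.mono fun p hp hpU => sub_eq_zero.1 (hp hpU)
  · have e1 := h.integral_eq hχ hc hs
    have e2 := h'.integral_eq hχ hc hs
    have i1 := integrable_mul_of_compactSupport h.2.1 hχ.continuous hc hs
    have i2 := integrable_mul_of_compactSupport h'.2.1 hχ.continuous hc hs
    calc ∫ p, χ p • (g - g') p = ∫ p, (g p * χ p - g' p * χ p) :=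
          integral_congr_ae (.of_forall fun p => by simp; ring)
      _ = 0 := by rw [integral_sub i1 i2]; linarith

/-- A classical derivative of a smooth function is a weak derivative. -/
theorem hasWeakDeriv_of_contDiffOn {U : Set (ℝ × ℝ)} (hU : IsOpen U) {f : ℝ × ℝ → ℝ}
    (hf : ContDiffOn ℝ ∞ f U) (v : ℝ × ℝ) : HasWeakDeriv U v f (fun p => fderiv ℝ f p v) := by
  have hf' : LocallyIntegrableOn f U := hf.continuousOn.locallyIntegrableOn hU.measurableSet
  have hg' : LocallyIntegrableOn (fun p => fderiv ℝ f p v) U :=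
    ((hf.continuousOn_fderiv_of_isOpen hU (by simp)).clm_apply
      continuousOn_const).locallyIntegrableOn hU.measurableSet
  refine hasWeakDeriv_of_integral_eq hf' hg' fun χ hχ hc hs => ?_
  have hs' := (tsupport_fderiv_apply_subset (f := χ) ℝ v).trans hs
  refine integral_mul_fderiv_eq_neg_fderiv_mul_of_integrable
    (integrable_mul_of_compactSupport hg' hχ.continuous hc hs)
    (integrable_mul_of_compactSupport hf' (continuous_fderiv_apply hχ v)
      (hc.fderiv_apply ℝ v) hs')
    (integrable_mul_of_compactSupport hf' hχ.continuous hc hs)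
    (fun p hp => (hf.contDiffAt (hU.mem_nhds (hs hp))).differentiableAt (by simp))
    (fun p _ => hχ.contDiffAt.differentiableAt (by simp))

theorem hasWeakDeriv_weakDeriv {U : Set (ℝ × ℝ)} {v : ℝ × ℝ} {f : ℝ × ℝ → ℝ}
    (h : ∃ g, HasWeakDeriv U v f g) : HasWeakDeriv U v f (weakDeriv U v f) := by
  rw [weakDeriv, dif_pos h]
  exact h.choose_spec

theorem WeaklyDifferentiable.hasD₁ {I : Set ℝ} {f : ℝ × ℝ → ℝ} (h : WeaklyDifferentiable I f) :
    HasWeakDeriv (strip I) (1, 0) f (D₁ I f) := hasWeakDeriv_weakDeriv h.1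

theorem WeaklyDifferentiable.hasD₂ {I : Set ℝ} {f : ℝ × ℝ → ℝ} (h : WeaklyDifferentiable I f) :
    HasWeakDeriv (strip I) (0, 1) f (D₂ I f) := hasWeakDeriv_weakDeriv h.2

theorem HasWeakDeriv.weakDeriv_ae_eq {U : Set (ℝ × ℝ)} (hU : IsOpen U) {v : ℝ × ℝ}
    {f g : ℝ × ℝ → ℝ} (h : HasWeakDeriv U v f g) : weakDeriv U v f =ᵐ[volume.restrict U] g :=
  (hasWeakDeriv_weakDeriv ⟨g, h⟩).unique hU h

theorem ae_restrict_cell {I : Set ℝ} {P : ℝ × ℝ → Prop}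
    (h : ∀ᵐ p ∂(volume.restrict (strip I)), P p) : ∀ᵐ p ∂(volume.restrict (cell I)), P p :=
  ae_restrict_of_ae_restrict_of_subset (cell_subset_strip I) h

theorem WeaklyDifferentiable.add {I : Set ℝ} {f g : ℝ × ℝ → ℝ} (hf : WeaklyDifferentiable I f)
    (hg : WeaklyDifferentiable I g) : WeaklyDifferentiable I (f + g) :=
  ⟨⟨_, hf.hasD₁.add hg.hasD₁⟩, ⟨_, hf.hasD₂.add hg.hasD₂⟩⟩

theorem WeaklyDifferentiable.const_smul {I : Set ℝ} {f : ℝ × ℝ → ℝ}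
    (hf : WeaklyDifferentiable I f) (c : ℝ) : WeaklyDifferentiable I (c • f) :=
  ⟨⟨_, hf.hasD₁.const_smul c⟩, ⟨_, hf.hasD₂.const_smul c⟩⟩

theorem weaklyDifferentiable_of_contDiffOn {I : Set ℝ} (hI : IsOpen I) {f : ℝ × ℝ → ℝ}
    (hf : ContDiffOn ℝ ∞ f (strip I)) : WeaklyDifferentiable I f :=
  ⟨⟨_, hasWeakDeriv_of_contDiffOn (isOpen_strip hI) hf _⟩,
    ⟨_, hasWeakDeriv_of_contDiffOn (isOpen_strip hI) hf _⟩⟩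

/-- Translation by `c` in the first variable preserves Lebesgue measure on the strip. -/
theorem measurePreserving_translate (I : Set ℝ) (c : ℝ) :
    MeasurePreserving (fun p : ℝ × ℝ => (p.1 + c, p.2)) (volume.restrict (strip I))
      (volume.restrict (strip I)) := by
  have h : MeasurePreserving (fun p : ℝ × ℝ => p + (c, 0)) volume volume :=
    measurePreserving_add_right volume (c, 0)
  have h2 := h.restrict_preimage_emb (MeasurableEquiv.addRight ((c, 0) : ℝ × ℝ)).measurableEmbedding
    (strip I)
  have e : (fun p : ℝ × ℝ => p + (c, 0)) ⁻¹' strip I = strip I := by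
    ext p; simp [strip]
  rw [e] at h2
  convert h2 using 2 with p
  ext <;> simp

theorem measurableEmbedding_translate (c : ℝ) :
    MeasurableEmbedding (fun p : ℝ × ℝ => (p.1 + c, p.2)) := by
  convert (MeasurableEquiv.addRight ((c, 0) : ℝ × ℝ)).measurableEmbedding using 2 with p
  ext <;> simp

/-- Weak derivatives commute with translations in the first variable. -/
theorem HasWeakDeriv.translate {I : Set ℝ} (hI : IsOpen I) {v : ℝ × ℝ} {f g : ℝ × ℝ → ℝ}
    (h : HasWeakDeriv (strip I) v f g) (c : ℝ) :
    HasWeakDeriv (strip I) v (fun p => f (p.1 + c, p.2)) (fun p => g (p.1 + c, p.2)) := by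
  have hl : ∀ {k : ℝ × ℝ → ℝ}, LocallyIntegrableOn k (strip I) →
      LocallyIntegrableOn (fun p => k (p.1 + c, p.2)) (strip I) := by
    intro k hk
    rw [locallyIntegrableOn_iff (isOpen_strip hI).isLocallyClosed] at hk ⊢
    intro K hK hc
    have hmp : MeasurePreserving (fun p : ℝ × ℝ => (p.1 + c, p.2)) volume volume := by
      simpa [strip_univ] using measurePreserving_translate univ c
    have := hmp.restrict_image_emb (measurableEmbedding_translate c) K
    refine (this.integrable_comp_emb (measurableEmbedding_translate c)).2 (hk _ ?_ ?_)
    · rintro _ ⟨p, hp, rfl⟩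
      exact ⟨trivial, (hK hp).2⟩
    · exact hc.image (by fun_prop)
  refine ⟨hl h.1, hl h.2.1, fun χ hχ hc hs => ?_⟩
  have hsm : ContDiff ℝ ∞ (fun p : ℝ × ℝ => χ (p + (-c, 0))) := hχ.comp (by fun_prop)
  have hcs : HasCompactSupport (fun p : ℝ × ℝ => χ (p + (-c, 0))) :=
    hc.comp_homeomorph (Homeomorph.addRight ((-c, 0) : ℝ × ℝ))
  have hss : tsupport (fun p : ℝ × ℝ => χ (p + (-c, 0))) ⊆ strip I := by
    have : tsupport (fun p : ℝ × ℝ => χ (p + (-c, 0))) =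
        (Homeomorph.addRight ((-c, 0) : ℝ × ℝ)) ⁻¹' tsupport χ :=
      tsupport_comp_eq_preimage χ (Homeomorph.addRight ((-c, 0) : ℝ × ℝ))
    rw [this]
    intro p hp
    have := (hs hp).2
    exact ⟨trivial, by simpa using this⟩
  have key := h.2.2 _ hsm hcs hss
  have e1 := (measurePreserving_translate I c).integral_comp (measurableEmbedding_translate c)
    (fun p => f p * fderiv ℝ (fun p : ℝ × ℝ => χ (p + (-c, 0))) p v)
  have e2 := (measurePreserving_translate I c).integral_comp (measurableEmbedding_translate c)
    (fun p => g p * χ (p + (-c, 0)))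
  rw [← e1, ← e2] at key
  convert key using 5 with p p
  · rw [fderiv_comp_add_right]
    congr 2
    ext <;> simp
  · simp

/-- Weak derivatives of periodic functions are periodic. -/
theorem HasWeakDeriv.periodic {I : Set ℝ} (hI : IsOpen I) {v : ℝ × ℝ} {f g : ℝ × ℝ → ℝ}
    (h : HasWeakDeriv (strip I) v f g) (hf : PeriodicOn I f) : PeriodicOn I g :=
  ((h.translate hI (2 * π)).congr_ae (isOpen_strip hI) hf
    (EventuallyEq.refl _ _)).unique (isOpen_strip hI) h

theorem PeriodicOn.add {I : Set ℝ} {f g : ℝ × ℝ → ℝ} (hf : PeriodicOn I f)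
    (hg : PeriodicOn I g) : PeriodicOn I (f + g) := by
  filter_upwards [hf, hg] with p h1 h2
  simp [h1, h2]

theorem PeriodicOn.const_smul {I : Set ℝ} {f : ℝ × ℝ → ℝ} (hf : PeriodicOn I f) (c : ℝ) :
    PeriodicOn I (c • f) := by
  filter_upwards [hf] with p h1
  simp [h1]

theorem PeriodicOn.congr_ae {I : Set ℝ} {f g : ℝ × ℝ → ℝ} (hf : PeriodicOn I f)
    (h : f =ᵐ[volume.restrict (strip I)] g) : PeriodicOn I g := by
  have h' := (measurePreserving_translate I (2 * π)).quasiMeasurePreserving.ae h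
  filter_upwards [hf, h, h'] with p h1 h2 h3
  rw [← h2, ← h3, h1]

/-- An almost everywhere periodic function that vanishes almost everywhere on one period cell
vanishes almost everywhere on the strip. -/
theorem PeriodicOn.ae_eq_zero {I : Set ℝ} (hI : IsOpen I) {f : ℝ × ℝ → ℝ} (hf : PeriodicOn I f)
    (h : f =ᵐ[volume.restrict (cell I)] 0) : f =ᵐ[volume.restrict (strip I)] 0 := by
  have hT : ∀ k : ℤ, ∀ᵐ p ∂(volume.restrict (strip I)), f (p.1 + k * (2 * π), p.2) = f p := by
    intro k
    induction k using Int.induction_on with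
    | zero => exact .of_forall fun p => by simp
    | succ n ih =>
      have := (measurePreserving_translate I (n * (2 * π))).quasiMeasurePreserving.ae hf
      filter_upwards [ih, this] with p h1 h2
      push_cast at h1 ⊢
      rw [← h1, ← h2]
      congr 2
      ring
    | pred n ih =>
      have := (measurePreserving_translate I ((-n - 1) * (2 * π))).quasiMeasurePreserving.ae hf
      filter_upwards [ih, this] with p h1 h2
      push_cast at h1 ⊢
      rw [← h1, ← h2]
      congr 2
      ring
  rw [EventuallyEq, ae_restrict_iff' (measurableSet_cell hI)] at h
  rw [EventuallyEq, ae_restrict_iff' (isOpen_strip hI).measurableSet]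
  have h' : ∀ᵐ p : ℝ × ℝ, ∀ k : ℤ, (p.1 + k * (2 * π), p.2) ∈ cell I →
      f (p.1 + k * (2 * π), p.2) = 0 := by
    rw [ae_all_iff]
    intro k
    have := (measurePreserving_translate univ (k * (2 * π))).quasiMeasurePreserving
    rw [strip_univ, Measure.restrict_univ] at this
    exact this.ae h
  have hT' := fun k => (ae_restrict_iff' (isOpen_strip hI).measurableSet).1 (hT k)
  filter_upwards [h', ae_all_iff.2 hT'] with p h1 h2 hp
  obtain ⟨k, hk, -⟩ := existsUnique_add_zsmul_mem_Ioc Real.two_pi_pos p.1 0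
  have hk' : p.1 + k * (2 * π) ∈ Ioc 0 (2 * π) := by simpa using hk
  rw [Pi.zero_apply, ← h2 k hp]
  exact h1 k ⟨hk', hp.2⟩

/-! ### Weighted energy spaces -/

section

/-- Periodic, weakly differentiable functions on the strip `ℝ × I` whose energy, with weight `α(y)`
on the first and `β(y)` on the second partial derivative, is finite on a period cell. No
normalisation on `y = 0` is imposed. -/
structure FiniteEnergy (I : Set ℝ) (α β : ℝ → ℝ) (ψ : ℝ × ℝ → ℝ) : Prop where
  periodic : PeriodicOn I ψ
  weaklyDifferentiable : WeaklyDifferentiable I ψ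
  energy₁ : IntegrableOn (fun p => α p.2 * D₁ I ψ p ^ 2) (cell I)
  energy₂ : IntegrableOn (fun p => β p.2 * D₂ I ψ p ^ 2) (cell I)

/-- The energy form with weights `α` and `β`. -/
def energyForm (I : Set ℝ) (α β : ℝ → ℝ) (ψ φ : ℝ × ℝ → ℝ) : ℝ :=
  ∫ p in cell I, (α p.2 * (D₁ I ψ p * D₁ I φ p) + β p.2 * (D₂ I ψ p * D₂ I φ p))

/-- Functions of finite energy whose trace on `y = 0` has mean zero with respect to `κ(x) dx`. -/
def MemEnergy (I : Set ℝ) (α β κ : ℝ → ℝ) (ψ : ℝ × ℝ → ℝ) : Prop :=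
  FiniteEnergy I α β ψ ∧ ∃ t : ℝ → ℝ, IsTrace ψ t ∧ ∫ x in (0)..(2 * π), t x * κ x = 0

/-- The weights `α`, `β` are measurable, and nonnegative on the open interval `I`. -/
structure AdmissibleWeights (I : Set ℝ) (α β : ℝ → ℝ) : Prop where
  isOpen : IsOpen I
  zero_mem : (0 : ℝ) ∈ I
  measurable₁ : Measurable α
  measurable₂ : Measurable β
  nonneg₁ : ∀ y ∈ I, 0 ≤ α y
  nonneg₂ : ∀ y ∈ I, 0 ≤ β y

variable {I : Set ℝ} {α β κ : ℝ → ℝ}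

theorem WeaklyDifferentiable.D₁_add (hI : IsOpen I) {f g : ℝ × ℝ → ℝ}
    (hf : WeaklyDifferentiable I f) (hg : WeaklyDifferentiable I g) :
    D₁ I (f + g) =ᵐ[volume.restrict (strip I)] D₁ I f + D₁ I g :=
  (hf.hasD₁.add hg.hasD₁).weakDeriv_ae_eq (isOpen_strip hI)

theorem WeaklyDifferentiable.D₂_add (hI : IsOpen I) {f g : ℝ × ℝ → ℝ}
    (hf : WeaklyDifferentiable I f) (hg : WeaklyDifferentiable I g) :
    D₂ I (f + g) =ᵐ[volume.restrict (strip I)] D₂ I f + D₂ I g :=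
  (hf.hasD₂.add hg.hasD₂).weakDeriv_ae_eq (isOpen_strip hI)

theorem WeaklyDifferentiable.D₁_smul (hI : IsOpen I) {f : ℝ × ℝ → ℝ}
    (hf : WeaklyDifferentiable I f) (c : ℝ) :
    D₁ I (c • f) =ᵐ[volume.restrict (strip I)] c • D₁ I f :=
  (hf.hasD₁.const_smul c).weakDeriv_ae_eq (isOpen_strip hI)

theorem WeaklyDifferentiable.D₂_smul (hI : IsOpen I) {f : ℝ × ℝ → ℝ}
    (hf : WeaklyDifferentiable I f) (c : ℝ) :
    D₂ I (c • f) =ᵐ[volume.restrict (strip I)] c • D₂ I f :=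
  (hf.hasD₂.const_smul c).weakDeriv_ae_eq (isOpen_strip hI)

theorem WeaklyDifferentiable.D₁_congr (hI : IsOpen I) {f g : ℝ × ℝ → ℝ}
    (hf : WeaklyDifferentiable I f) (h : f =ᵐ[volume.restrict (strip I)] g) :
    D₁ I g =ᵐ[volume.restrict (strip I)] D₁ I f :=
  (hf.hasD₁.congr_ae (isOpen_strip hI) h (EventuallyEq.refl _ _)).weakDeriv_ae_eq
    (isOpen_strip hI)

theorem WeaklyDifferentiable.D₂_congr (hI : IsOpen I) {f g : ℝ × ℝ → ℝ}
    (hf : WeaklyDifferentiable I f) (h : f =ᵐ[volume.restrict (strip I)] g) :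
    D₂ I g =ᵐ[volume.restrict (strip I)] D₂ I f :=
  (hf.hasD₂.congr_ae (isOpen_strip hI) h (EventuallyEq.refl _ _)).weakDeriv_ae_eq
    (isOpen_strip hI)

theorem WeaklyDifferentiable.congr (hI : IsOpen I) {f g : ℝ × ℝ → ℝ}
    (hf : WeaklyDifferentiable I f) (h : f =ᵐ[volume.restrict (strip I)] g) :
    WeaklyDifferentiable I g :=
  ⟨⟨_, hf.hasD₁.congr_ae (isOpen_strip hI) h (EventuallyEq.refl _ _)⟩,
    ⟨_, hf.hasD₂.congr_ae (isOpen_strip hI) h (EventuallyEq.refl _ _)⟩⟩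

theorem aestronglyMeasurable_cell {g : ℝ × ℝ → ℝ}
    (hg : LocallyIntegrableOn g (strip I)) :
    AEStronglyMeasurable g (volume.restrict (cell I)) :=
  hg.aestronglyMeasurable.mono_measure (Measure.restrict_mono (cell_subset_strip I) le_rfl)

/-- The product of two functions that are square integrable for the same weight is integrable. -/
theorem integrableOn_weight_mul (hI : IsOpen I) (hα : Measurable α) (hα0 : ∀ y ∈ I, 0 ≤ α y)
    {f g : ℝ × ℝ → ℝ} (hf : AEStronglyMeasurable f (volume.restrict (cell I)))
    (hg : AEStronglyMeasurable g (volume.restrict (cell I)))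
    (hf2 : IntegrableOn (fun p => α p.2 * f p ^ 2) (cell I))
    (hg2 : IntegrableOn (fun p => α p.2 * g p ^ 2) (cell I)) :
    IntegrableOn (fun p => α p.2 * (f p * g p)) (cell I) := by
  refine Integrable.mono' (hf2.add hg2)
    ((hα.comp measurable_snd).aestronglyMeasurable.mul (hf.mul hg)) ?_
  filter_upwards [ae_restrict_mem (measurableSet_cell hI)] with p hp
  have h0 := hα0 p.2 hp.2
  rw [norm_mul, norm_mul, Real.norm_of_nonneg h0]
  simp only [Real.norm_eq_abs, Pi.add_apply]
  rw [← mul_add]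
  refine mul_le_mul_of_nonneg_left ?_ h0
  rw [← sq_abs (f p), ← sq_abs (g p)]
  nlinarith [sq_nonneg (|f p| - |g p|), sq_nonneg (|f p|), sq_nonneg (|g p|)]

namespace FiniteEnergy

variable {ψ φ χ : ℝ × ℝ → ℝ}

theorem integrable₁ (w : AdmissibleWeights I α β) (hψ : FiniteEnergy I α β ψ)
    (hφ : FiniteEnergy I α β φ) :
    IntegrableOn (fun p => α p.2 * (D₁ I ψ p * D₁ I φ p)) (cell I) :=
  integrableOn_weight_mul w.isOpen w.measurable₁ w.nonneg₁
    (aestronglyMeasurable_cell hψ.weaklyDifferentiable.hasD₁.2.1)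
    (aestronglyMeasurable_cell hφ.weaklyDifferentiable.hasD₁.2.1) hψ.energy₁ hφ.energy₁

theorem integrable₂ (w : AdmissibleWeights I α β) (hψ : FiniteEnergy I α β ψ)
    (hφ : FiniteEnergy I α β φ) :
    IntegrableOn (fun p => β p.2 * (D₂ I ψ p * D₂ I φ p)) (cell I) :=
  integrableOn_weight_mul w.isOpen w.measurable₂ w.nonneg₂
    (aestronglyMeasurable_cell hψ.weaklyDifferentiable.hasD₂.2.1)
    (aestronglyMeasurable_cell hφ.weaklyDifferentiable.hasD₂.2.1) hψ.energy₂ hφ.energy₂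

theorem add (w : AdmissibleWeights I α β) (hψ : FiniteEnergy I α β ψ)
    (hφ : FiniteEnergy I α β φ) : FiniteEnergy I α β (ψ + φ) := by
  refine ⟨hψ.periodic.add hφ.periodic, hψ.weaklyDifferentiable.add hφ.weaklyDifferentiable, ?_, ?_⟩
  · refine ((hψ.energy₁.add hφ.energy₁).add ((hψ.integrable₁ w hφ).const_mul 2)).congr ?_
    filter_upwards [ae_restrict_cell (hψ.weaklyDifferentiable.D₁_add w.isOpen
      hφ.weaklyDifferentiable)] with p hp
    simp only [hp, Pi.add_apply]
    ring
  · refine ((hψ.energy₂.add hφ.energy₂).add ((hψ.integrable₂ w hφ).const_mul 2)).congr ?_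
    filter_upwards [ae_restrict_cell (hψ.weaklyDifferentiable.D₂_add w.isOpen
      hφ.weaklyDifferentiable)] with p hp
    simp only [hp, Pi.add_apply]
    ring

theorem const_smul (w : AdmissibleWeights I α β) (hψ : FiniteEnergy I α β ψ) (c : ℝ) :
    FiniteEnergy I α β (c • ψ) := by
  refine ⟨hψ.periodic.const_smul c, hψ.weaklyDifferentiable.const_smul c, ?_, ?_⟩
  · refine (hψ.energy₁.const_mul (c ^ 2)).congr ?_
    filter_upwards [ae_restrict_cell (hψ.weaklyDifferentiable.D₁_smul w.isOpen c)] with p hp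
    simp only [hp, Pi.smul_apply, smul_eq_mul]
    ring
  · refine (hψ.energy₂.const_mul (c ^ 2)).congr ?_
    filter_upwards [ae_restrict_cell (hψ.weaklyDifferentiable.D₂_smul w.isOpen c)] with p hp
    simp only [hp, Pi.smul_apply, smul_eq_mul]
    ring

theorem congr_ae (w : AdmissibleWeights I α β) (hψ : FiniteEnergy I α β ψ)
    (h : ψ =ᵐ[volume.restrict (strip I)] φ) : FiniteEnergy I α β φ := by
  refine ⟨hψ.periodic.congr_ae h, hψ.weaklyDifferentiable.congr w.isOpen h, ?_, ?_⟩
  · refine hψ.energy₁.congr ?_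
    filter_upwards [ae_restrict_cell (hψ.weaklyDifferentiable.D₁_congr w.isOpen h)] with p hp
    simp only [hp]
  · refine hψ.energy₂.congr ?_
    filter_upwards [ae_restrict_cell (hψ.weaklyDifferentiable.D₂_congr w.isOpen h)] with p hp
    simp only [hp]

theorem const (w : AdmissibleWeights I α β) (c : ℝ) : FiniteEnergy I α β (fun _ => c) := by
  have hs : ContDiffOn ℝ ∞ (fun _ : ℝ × ℝ => c) (strip I) := contDiffOn_const
  have h1 := (hasWeakDeriv_of_contDiffOn (isOpen_strip w.isOpen) hs (1, 0)).weakDeriv_ae_eq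
    (isOpen_strip w.isOpen)
  have h2 := (hasWeakDeriv_of_contDiffOn (isOpen_strip w.isOpen) hs (0, 1)).weakDeriv_ae_eq
    (isOpen_strip w.isOpen)
  refine ⟨.of_forall fun p => rfl, weaklyDifferentiable_of_contDiffOn w.isOpen hs, ?_, ?_⟩
  · refine (integrable_zero _ _ _).congr ?_
    filter_upwards [ae_restrict_cell h1] with p hp
    rw [D₁, hp]
    simp
  · refine (integrable_zero _ _ _).congr ?_
    filter_upwards [ae_restrict_cell h2] with p hp
    rw [D₂, hp]
    simp

theorem energyForm_add (w : AdmissibleWeights I α β) (hψ : FiniteEnergy I α β ψ)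
    (hφ : FiniteEnergy I α β φ) (hχ : FiniteEnergy I α β χ) :
    energyForm I α β (ψ + φ) χ = energyForm I α β ψ χ + energyForm I α β φ χ := by
  unfold energyForm
  refine (integral_congr_ae ?_).trans (integral_add
    ((hψ.integrable₁ w hχ).add (hψ.integrable₂ w hχ))
    ((hφ.integrable₁ w hχ).add (hφ.integrable₂ w hχ)))
  filter_upwards [ae_restrict_cell (hψ.weaklyDifferentiable.D₁_add w.isOpen
    hφ.weaklyDifferentiable), ae_restrict_cell (hψ.weaklyDifferentiable.D₂_add w.isOpen
    hφ.weaklyDifferentiable)] with p h1 h2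
  simp only [h1, h2, Pi.add_apply]
  ring

theorem energyForm_smul (w : AdmissibleWeights I α β) (hψ : FiniteEnergy I α β ψ) (c : ℝ) :
    energyForm I α β (c • ψ) χ = c * energyForm I α β ψ χ := by
  unfold energyForm
  rw [← integral_const_mul]
  refine integral_congr_ae ?_
  filter_upwards [ae_restrict_cell (hψ.weaklyDifferentiable.D₁_smul w.isOpen c),
    ae_restrict_cell (hψ.weaklyDifferentiable.D₂_smul w.isOpen c)] with p h1 h2
  simp only [h1, h2, Pi.smul_apply, smul_eq_mul]
  ring

theorem energyForm_congr (w : AdmissibleWeights I α β) (hψ : FiniteEnergy I α β ψ)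
    (h : ψ =ᵐ[volume.restrict (strip I)] φ) :
    energyForm I α β φ χ = energyForm I α β ψ χ := by
  refine integral_congr_ae ?_
  filter_upwards [ae_restrict_cell (hψ.weaklyDifferentiable.D₁_congr w.isOpen h),
    ae_restrict_cell (hψ.weaklyDifferentiable.D₂_congr w.isOpen h)] with p h1 h2
  simp only [h1, h2]

end FiniteEnergy

theorem energyForm_comm (ψ φ : ℝ × ℝ → ℝ) : energyForm I α β ψ φ = energyForm I α β φ ψ :=
  integral_congr_ae (.of_forall fun p => by ring)

theorem energyForm_self_nonneg (w : AdmissibleWeights I α β) (ψ : ℝ × ℝ → ℝ) :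
    0 ≤ energyForm I α β ψ ψ := by
  refine setIntegral_nonneg (measurableSet_cell w.isOpen) fun p hp => ?_
  have h1 := w.nonneg₁ _ hp.2
  have h2 := w.nonneg₂ _ hp.2
  exact add_nonneg (mul_nonneg h1 (mul_self_nonneg _)) (mul_nonneg h2 (mul_self_nonneg _))

/-! ### Traces on the circle `y = 0` -/

theorem exists_pos_rect_subset (hI : IsOpen I) (h0 : (0 : ℝ) ∈ I) :
    ∃ r > 0, ∀ h, h < r → Icc 0 (2 * π) ×ˢ Icc (-h) h ⊆ strip I := by
  obtain ⟨r, hr, hb⟩ := Metric.isOpen_iff.1 hI 0 h0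
  refine ⟨r, hr, fun h hh p hp => ⟨trivial, hb ?_⟩⟩
  rw [Metric.mem_ball, dist_zero_right, Real.norm_eq_abs, abs_lt]
  exact ⟨by linarith [hp.2.1], by linarith [hp.2.2]⟩

theorem cell_subset_rect (h : ℝ) : cell (Ioo (-h) h) ⊆ Icc 0 (2 * π) ×ˢ Icc (-h) h :=
  prod_mono Ioc_subset_Icc_self Ioo_subset_Icc_self

theorem volume_restrict_cell (I : Set ℝ) : (volume : Measure (ℝ × ℝ)).restrict (cell I) =
    (volume.restrict (Ioc 0 (2 * π))).prod (volume.restrict I) := by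
  rw [Measure.prod_restrict, cell, Measure.volume_eq_prod]

theorem integrableOn_cell_fst {t : ℝ → ℝ} (ht : IntegrableOn t (Ioc 0 (2 * π))) (h : ℝ) :
    IntegrableOn (fun p : ℝ × ℝ => t p.1) (cell (Ioo (-h) h)) := by
  rw [IntegrableOn, volume_restrict_cell]
  exact Integrable.comp_fst ht _

theorem eventually_integrableOn_sub_trace (hI : IsOpen I) (h0 : (0 : ℝ) ∈ I) {f : ℝ × ℝ → ℝ}
    {t : ℝ → ℝ} (hf : LocallyIntegrableOn f (strip I)) (ht : IntegrableOn t (Ioc 0 (2 * π))) :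
    ∀ᶠ h in 𝓝[>] (0 : ℝ), IntegrableOn (fun p => |f p - t p.1|) (cell (Ioo (-h) h)) := by
  obtain ⟨r, hr, hb⟩ := exists_pos_rect_subset hI h0
  filter_upwards [Ioo_mem_nhdsGT hr] with h hh
  have h1 : IntegrableOn f (cell (Ioo (-h) h)) :=
    (hf.integrableOn_compact_subset (hb h hh.2) (isCompact_Icc.prod isCompact_Icc)).mono_set
      (cell_subset_rect h)
  exact (h1.sub (integrableOn_cell_fst ht h)).abs

theorem IsTrace.add (hI : IsOpen I) (h0 : (0 : ℝ) ∈ I) {f g : ℝ × ℝ → ℝ} {t s : ℝ → ℝ}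
    (hf : LocallyIntegrableOn f (strip I)) (hg : LocallyIntegrableOn g (strip I))
    (ht : IsTrace f t) (hs : IsTrace g s) : IsTrace (f + g) (t + s) := by
  refine ⟨ht.1.add hs.1, ?_⟩
  have hlim := ht.2.add hs.2
  rw [add_zero] at hlim
  refine squeeze_zero' ?_ ?_ hlim
  · filter_upwards [self_mem_nhdsWithin] with h hh
    rw [mem_Ioi] at hh
    positivity
  · filter_upwards [eventually_integrableOn_sub_trace hI h0 hf ht.1,
      eventually_integrableOn_sub_trace hI h0 hg hs.1, self_mem_nhdsWithin] with h h1 h2 hh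
    rw [mem_Ioi] at hh
    rw [← mul_add, ← integral_add h1 h2]
    refine mul_le_mul_of_nonneg_left (integral_mono_of_nonneg (.of_forall fun p => abs_nonneg _)
      (h1.add h2) (.of_forall fun p => ?_)) (by positivity)
    calc |(f + g) p - (t + s) p.1| = |(f p - t p.1) + (g p - s p.1)| := by
          simp only [Pi.add_apply]; congr 1; ring
      _ ≤ _ := abs_add_le _ _

theorem IsTrace.const_smul {f : ℝ × ℝ → ℝ} {t : ℝ → ℝ} (ht : IsTrace f t) (c : ℝ) :
    IsTrace (c • f) (c • t) := by
  refine ⟨ht.1.smul c, ?_⟩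
  have hlim := ht.2.const_mul |c|
  rw [mul_zero] at hlim
  refine hlim.congr fun h => ?_
  have : ∀ p : ℝ × ℝ, |(c • f) p - (c • t) p.1| = |c| * |f p - t p.1| := fun p => by
    rw [← abs_mul]; simp only [Pi.smul_apply, smul_eq_mul]; congr 1; ring
  simp only [this, integral_const_mul]
  ring

theorem IsTrace.congr_ae (hI : IsOpen I) (h0 : (0 : ℝ) ∈ I) {f g : ℝ × ℝ → ℝ} {t : ℝ → ℝ}
    (ht : IsTrace f t) (h : f =ᵐ[volume.restrict (strip I)] g) : IsTrace g t := by
  refine ⟨ht.1, ht.2.congr' ?_⟩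
  obtain ⟨r, hr, hb⟩ := exists_pos_rect_subset hI h0
  filter_upwards [Ioo_mem_nhdsGT hr] with δ hδ
  congr 1
  refine integral_congr_ae ?_
  filter_upwards [ae_restrict_of_ae_restrict_of_subset
    ((cell_subset_rect δ).trans (hb δ hδ.2)) h] with p hp
  simp only [hp]

/-- The trace of a constant function is that constant. -/
theorem IsTrace.ae_eq_of_const {c : ℝ} {t : ℝ → ℝ} (ht : IsTrace (fun _ => c) t) :
    t =ᵐ[volume.restrict (Ioc 0 (2 * π))] fun _ => c := by
  have hint : Integrable (fun x => |c - t x|) (volume.restrict (Ioc 0 (2 * π))) :=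
    ((integrable_const c).sub ht.1).abs
  have h1 : ∀ᶠ h in 𝓝[>] (0 : ℝ), ∫ x in Ioc 0 (2 * π), |c - t x| =
      (2 * h)⁻¹ * ∫ p in cell (Ioo (-h) h), |c - t p.1| := by
    filter_upwards [self_mem_nhdsWithin] with h hh
    rw [mem_Ioi] at hh
    rw [volume_restrict_cell, integral_fun_fst (fun x => |c - t x|)]
    have : (volume.restrict (Ioo (-h) h)).real univ = 2 * h := by
      rw [measureReal_restrict_apply_univ, Real.volume_real_Ioo_of_le (by linarith)]
      ring
    rw [this, smul_eq_mul, inv_mul_cancel_left₀ (by positivity)]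
  have h2 : ∫ x in Ioc 0 (2 * π), |c - t x| = 0 :=
    tendsto_nhds_unique (tendsto_const_nhds.congr' h1) ht.2
  rw [integral_eq_zero_iff_of_nonneg (fun x => abs_nonneg _) hint] at h2
  filter_upwards [h2] with x hx
  have := abs_eq_zero.1 hx
  linarith

theorem isTrace_of_continuousOn (hI : IsOpen I) (h0 : (0 : ℝ) ∈ I) {f : ℝ × ℝ → ℝ}
    (hf : ContinuousOn f (strip I)) : IsTrace f (fun x => f (x, 0)) := by
  have hc : Continuous fun x : ℝ => f (x, 0) :=
    hf.comp_continuous (by fun_prop) fun x => ⟨trivial, h0⟩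
  refine ⟨(hc.integrableOn_Icc).mono_set Ioc_subset_Icc_self, ?_⟩
  obtain ⟨r, hr, hb⟩ := exists_pos_rect_subset hI h0
  have hK : IsCompact (Icc (0 : ℝ) (2 * π) ×ˢ Icc (-(r / 2)) (r / 2)) :=
    isCompact_Icc.prod isCompact_Icc
  have hu := hK.uniformContinuousOn_of_continuous (hf.mono (hb _ (by linarith)))
  rw [Metric.uniformContinuousOn_iff] at hu
  rw [Metric.tendsto_nhds]
  intro ε hε
  obtain ⟨δ, hδ, hu⟩ := hu (ε / (4 * π)) (by positivity)
  filter_upwards [Ioo_mem_nhdsGT (show 0 < min δ (r / 2) by positivity)] with h hh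
  obtain ⟨hh0, hh1⟩ := hh
  rw [lt_min_iff] at hh1
  have hvol : volume.real (cell (Ioo (-h) h)) = 2 * π * (2 * h) := by
    rw [cell, Measure.volume_eq_prod, measureReal_prod_prod, Real.volume_real_Ioc_of_le
      (by positivity), Real.volume_real_Ioo_of_le (by linarith)]
    ring
  have hfin : volume (cell (Ioo (-h) h)) < ⊤ :=
    lt_of_le_of_lt (measure_mono (cell_subset_rect h))
      (isCompact_Icc.prod isCompact_Icc).measure_lt_top
  have hbd := norm_setIntegral_le_of_norm_le_const (f := fun p : ℝ × ℝ => |f p - f (p.1, 0)|)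
    (C := ε / (4 * π)) hfin (fun p hp => by
      rw [Real.norm_eq_abs, abs_abs, ← Real.dist_eq]
      refine (hu p ⟨Ioc_subset_Icc_self hp.1, by linarith [hp.2.1], by linarith [hp.2.2]⟩ (p.1, 0)
        ⟨Ioc_subset_Icc_self hp.1, by linarith, by linarith⟩ ?_).le
      rw [Prod.dist_eq, dist_self, max_eq_right dist_nonneg, dist_zero_right, Real.norm_eq_abs,
        abs_lt]
      exact ⟨by linarith [hp.2.1], by linarith [hp.2.2]⟩)
  rw [dist_zero_right, norm_mul, norm_inv, Real.norm_of_nonneg (by positivity : 0 ≤ 2 * h)]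
  calc (2 * h)⁻¹ * _ ≤ (2 * h)⁻¹ * (ε / (4 * π) * volume.real (cell (Ioo (-h) h))) := by gcongr
    _ = ε / 2 := by rw [hvol]; field_simp; ring
    _ < ε := by linarith

/-! ### The normalised energy space -/

/-- The normalised energy space as a subspace of all functions. -/
def energySubmodule (w : AdmissibleWeights I α β) (hκ : Continuous κ) :
    Submodule ℝ (ℝ × ℝ → ℝ) where
  carrier := {ψ | MemEnergy I α β κ ψ}
  add_mem' := by
    rintro ψ φ ⟨hψ, t, ht, ht0⟩ ⟨hφ, s, hs, hs0⟩
    refine ⟨hψ.add w hφ, t + s, ht.add w.isOpen w.zero_mem hψ.weaklyDifferentiable.hasD₁.1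
      hφ.weaklyDifferentiable.hasD₁.1 hs, ?_⟩
    have hi : ∀ {u : ℝ → ℝ}, IntegrableOn u (Ioc 0 (2 * π)) →
        IntervalIntegrable (fun x => u x * κ x) volume 0 (2 * π) := fun {u} hu =>
      ((intervalIntegrable_iff_integrableOn_Ioc_of_le Real.two_pi_pos.le).2 hu).mul_continuousOn
        hκ.continuousOn
    simp only [Pi.add_apply, add_mul]
    rw [intervalIntegral.integral_add (hi ht.1) (hi hs.1), ht0, hs0, add_zero]
  zero_mem' := by
    refine ⟨FiniteEnergy.const w 0, 0, ?_, by simp⟩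
    exact isTrace_of_continuousOn w.isOpen w.zero_mem continuousOn_const
  smul_mem' := by
    rintro c ψ ⟨hψ, t, ht, ht0⟩
    refine ⟨hψ.const_smul w c, c • t, ht.const_smul c, ?_⟩
    simp only [Pi.smul_apply, smul_eq_mul, mul_assoc, intervalIntegral.integral_const_mul]
    rw [ht0, mul_zero]

theorem MemEnergy.congr_ae (w : AdmissibleWeights I α β) {ψ φ : ℝ × ℝ → ℝ}
    (hψ : MemEnergy I α β κ ψ) (h : ψ =ᵐ[volume.restrict (strip I)] φ) :
    MemEnergy I α β κ φ := by
  obtain ⟨hψ, t, ht, ht0⟩ := hψ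
  exact ⟨hψ.congr_ae w h, t, ht.congr_ae w.isOpen w.zero_mem h, ht0⟩

/-- The only constant in the normalised energy space is zero. -/
theorem MemEnergy.const_eq_zero (hκ0 : ∫ x in (0)..(2 * π), κ x ≠ 0) {c : ℝ}
    (h : MemEnergy I α β κ fun _ => c) : c = 0 := by
  obtain ⟨-, t, ht, ht0⟩ := h
  have : ∫ x in (0)..(2 * π), t x * κ x = ∫ x in (0)..(2 * π), c * κ x := by
    rw [intervalIntegral.integral_of_le Real.two_pi_pos.le,
      intervalIntegral.integral_of_le Real.two_pi_pos.le]
    refine integral_congr_ae ?_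
    filter_upwards [ht.ae_eq_of_const] with x hx
    rw [hx]
  rw [this, intervalIntegral.integral_const_mul] at ht0
  exact (mul_eq_zero.1 ht0).resolve_right hκ0

/-- The energy form as a bilinear form on the normalised energy space. -/
def energyBilin (w : AdmissibleWeights I α β) (hκ : Continuous κ) :
    LinearMap.BilinForm ℝ (energySubmodule w hκ) :=
  LinearMap.mk₂ ℝ (fun ψ φ => energyForm I α β ψ.1 φ.1)
    (fun ψ φ χ => ψ.2.1.energyForm_add w φ.2.1 χ.2.1)
    (fun c ψ _ => ψ.2.1.energyForm_smul w c)
    (fun ψ φ χ => by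
      rw [energyForm_comm, energyForm_comm ψ.1, energyForm_comm ψ.1]
      exact φ.2.1.energyForm_add w χ.2.1 ψ.2.1)
    (fun c ψ φ => by
      rw [energyForm_comm, energyForm_comm ψ.1]
      exact φ.2.1.energyForm_smul w c)

end

/-! ### Weak derivatives and difference quotients -/

section Segment

variable {f g h : ℝ × ℝ → ℝ} {w : ℝ × ℝ}

theorem segmentAverage_eq_convolution (h : ℝ × ℝ → ℝ) (hh : Continuous h) (w : ℝ × ℝ) :
    (fun p : ℝ × ℝ => ∫ u in (0 : ℝ)..1, h (p - u • w)) =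
      convolution (fun _ => (1 : ℝ)) h (ContinuousLinearMap.mul ℝ ℝ)
        ((volume.restrict (Ioc (0 : ℝ) 1)).map fun u => u • w) := by
  ext p
  rw [convolution, integral_map (by fun_prop), intervalIntegral.integral_of_le zero_le_one]
  · simp
  · have : Continuous fun t => h (p - t) := by fun_prop
    simpa using this.aestronglyMeasurable

/-- The average of a smooth compactly supported function along a segment is smooth: it is a
convolution with the uniform measure on the segment. -/
theorem contDiff_segmentAverage (hh : ContDiff ℝ ∞ h) (hc : HasCompactSupport h) (w : ℝ × ℝ) :
    ContDiff ℝ ∞ fun p : ℝ × ℝ => ∫ u in (0 : ℝ)..1, h (p - u • w) := by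
  rw [segmentAverage_eq_convolution h hh.continuous w]
  have : IsFiniteMeasure ((volume.restrict (Ioc (0 : ℝ) 1)).map fun u => u • w) :=
    Measure.isFiniteMeasure_map _ _
  exact hc.contDiff_convolution_right _ (integrable_const 1).locallyIntegrable hh

/-- The union of all translates of the support of `h` along the segment from `0` to `w`. -/
def segmentSupport (h : ℝ × ℝ → ℝ) (w : ℝ × ℝ) : Set (ℝ × ℝ) :=
  (fun z : (ℝ × ℝ) × ℝ => z.1 + z.2 • w) '' (tsupport h ×ˢ Icc 0 1)

theorem isCompact_segmentSupport (hc : HasCompactSupport h) (w : ℝ × ℝ) :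
    IsCompact (segmentSupport h w) :=
  (IsCompact.prod hc isCompact_Icc).image (by fun_prop)

theorem eq_zero_of_notMem_segmentSupport {p : ℝ × ℝ} (hp : p ∉ segmentSupport h w) {u : ℝ}
    (hu : u ∈ Icc (0 : ℝ) 1) : h (p - u • w) = 0 := by
  by_contra hne
  exact hp ⟨(p - u • w, u), ⟨subset_tsupport _ hne, hu⟩, by simp⟩

theorem hasCompactSupport_segmentAverage (hc : HasCompactSupport h) (w : ℝ × ℝ) :
    HasCompactSupport fun p : ℝ × ℝ => ∫ u in (0 : ℝ)..1, h (p - u • w) := by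
  refine HasCompactSupport.intro (isCompact_segmentSupport hc w) fun p hp => ?_
  rw [intervalIntegral.integral_congr (g := fun _ => 0), intervalIntegral.integral_zero]
  intro u hu
  rw [uIcc_of_le zero_le_one] at hu
  exact eq_zero_of_notMem_segmentSupport hp hu

theorem fderiv_segmentAverage (hh : ContDiff ℝ ∞ h) (hc : HasCompactSupport h) (w p : ℝ × ℝ) :
    fderiv ℝ (fun p : ℝ × ℝ => ∫ u in (0 : ℝ)..1, h (p - u • w)) p w = h p - h (p - w) := by
  have hd : HasFDerivAt (fun p : ℝ × ℝ => ∫ u in (0 : ℝ)..1, h (p - u • w)) _ p :=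
    ((contDiff_segmentAverage hh hc w).contDiffAt.differentiableAt (by simp)).hasFDerivAt
  have hl : HasDerivAt (fun t : ℝ => p + t • w) w 0 := by
    simpa using ((hasDerivAt_id (0 : ℝ)).smul_const w).const_add p
  have hd0 : HasFDerivAt (fun p : ℝ × ℝ => ∫ u in (0 : ℝ)..1, h (p - u • w))
      (fderiv ℝ (fun p : ℝ × ℝ => ∫ u in (0 : ℝ)..1, h (p - u • w)) p) (p + (0 : ℝ) • w) := by
    simpa using hd
  have h1 := hd0.comp_hasDerivAt (0 : ℝ) hl
  have hcont : Continuous fun s : ℝ => h (p + s • w) := hh.continuous.comp (by fun_prop)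
  have h2 : ((fun p : ℝ × ℝ => ∫ u in (0 : ℝ)..1, h (p - u • w)) ∘ fun t : ℝ => p + t • w) =
      fun t => (∫ s in (0 : ℝ)..t, h (p + s • w)) - ∫ s in (0 : ℝ)..(t - 1), h (p + s • w) := by
    ext t
    have := intervalIntegral.integral_comp_sub_left (a := 0) (b := 1)
      (fun s => h (p + s • w)) t
    rw [sub_zero] at this
    rw [intervalIntegral.integral_interval_sub_left (hcont.intervalIntegrable _ _)
      (hcont.intervalIntegrable _ _), ← this]
    refine intervalIntegral.integral_congr fun u _ => ?_
    show h (p + t • w - u • w) = h (p + (t - u) • w)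
    rw [sub_smul, add_sub_assoc]
  have h3 : HasDerivAt (fun t : ℝ => (∫ s in (0 : ℝ)..t, h (p + s • w)) -
      ∫ s in (0 : ℝ)..(t - 1), h (p + s • w))
      (h (p + (0 : ℝ) • w) - h (p + (0 - 1 : ℝ) • w)) 0 := by
    refine (hcont.integral_hasStrictDerivAt 0 0).hasDerivAt.sub ?_
    have := (hcont.integral_hasStrictDerivAt 0 (0 - 1)).hasDerivAt
    exact this.comp_sub_const 0 1
  rw [h2] at h1
  have := h1.unique h3
  rw [this]
  simp [sub_eq_add_neg]

/-- The shear `(u, p) ↦ (u, p + u w)` preserves the product measure. -/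
theorem measurePreserving_shear (w : ℝ × ℝ) :
    MeasurePreserving (fun z : ℝ × (ℝ × ℝ) => (z.1, z.2 + z.1 • w))
      ((volume.restrict (Ioc (0 : ℝ) 1)).prod volume)
      ((volume.restrict (Ioc (0 : ℝ) 1)).prod volume) := by
  refine (MeasurePreserving.id (volume.restrict (Ioc (0 : ℝ) 1))).skew_product
    (g := fun u p => p + u • w) ?_ (.of_forall fun u => ?_)
  · exact Continuous.measurable (by unfold Function.uncurry; fun_prop)
  · exact (measurePreserving_add_right volume (u • w)).map_eq

theorem integrable_mul_segment (hg : LocallyIntegrable g) (hh : Continuous h)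
    (hc : HasCompactSupport h) (w : ℝ × ℝ) :
    Integrable (fun z : ℝ × (ℝ × ℝ) => g z.2 * h (z.2 - z.1 • w))
      ((volume.restrict (Ioc (0 : ℝ) 1)).prod volume) := by
  obtain ⟨C, hC⟩ := hh.bounded_above_of_compact_support hc
  have hK := isCompact_segmentSupport hc w
  have hgK : Integrable ((segmentSupport h w).indicator g) :=
    (integrable_indicator_iff hK.measurableSet).2 (hg.integrableOn_isCompact hK)
  have h1 : Integrable (fun z : ℝ × (ℝ × ℝ) => (segmentSupport h w).indicator g z.2)
      ((volume.restrict (Ioc (0 : ℝ) 1)).prod volume) := hgK.comp_snd _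
  have h2 := h1.mul_bdd (g := fun z : ℝ × (ℝ × ℝ) => h (z.2 - z.1 • w)) (c := C)
    (Continuous.aestronglyMeasurable (by fun_prop)) (.of_forall fun z => hC _)
  refine h2.congr ?_
  have hmem : ∀ᵐ z ∂((volume.restrict (Ioc (0 : ℝ) 1)).prod (volume : Measure (ℝ × ℝ))),
      z.1 ∈ Ioc (0 : ℝ) 1 :=
    Measure.quasiMeasurePreserving_fst.ae (ae_restrict_mem measurableSet_Ioc)
  filter_upwards [hmem] with z hz
  by_cases hp : z.2 ∈ segmentSupport h w
  · simp [hp]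
  · simp [hp, eq_zero_of_notMem_segmentSupport hp (Ioc_subset_Icc_self hz)]

theorem integrable_segment_mul (hg : LocallyIntegrable g) (hh : Continuous h)
    (hc : HasCompactSupport h) (w : ℝ × ℝ) :
    Integrable (fun z : ℝ × (ℝ × ℝ) => g (z.2 + z.1 • w) * h z.2)
      ((volume.restrict (Ioc (0 : ℝ) 1)).prod volume) := by
  have := (measurePreserving_shear w).integrable_comp_of_integrable
    (integrable_mul_segment hg hh hc w)
  simpa [Function.comp_def] using this

theorem integral_mul_segmentAverage (hg : LocallyIntegrable g) (hh : Continuous h)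
    (hc : HasCompactSupport h) (w : ℝ × ℝ) :
    ∫ p, g p * ∫ u in (0 : ℝ)..1, h (p - u • w) =
      ∫ p, (∫ u in (0 : ℝ)..1, g (p + u • w)) * h p := by
  have e1 := integral_prod_symm _ (integrable_mul_segment hg hh hc w)
  have e2 := integral_prod_symm _ (integrable_segment_mul hg hh hc w)
  have e3 : ∫ z, g z.2 * h (z.2 - z.1 • w) ∂((volume.restrict (Ioc (0 : ℝ) 1)).prod volume) =
      ∫ z, g (z.2 + z.1 • w) * h z.2 ∂((volume.restrict (Ioc (0 : ℝ) 1)).prod volume) := by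
    conv_lhs => rw [← (measurePreserving_shear w).map_eq]
    rw [integral_map (measurePreserving_shear w).measurable.aemeasurable]
    · simp
    · rw [(measurePreserving_shear w).map_eq]
      exact (integrable_mul_segment hg hh hc w).aestronglyMeasurable
  simp only [intervalIntegral.integral_of_le zero_le_one, ← integral_const_mul,
    ← integral_mul_const]
  rw [← e1, ← e2, e3]

theorem locallyIntegrable_segmentAverage (hg : LocallyIntegrable g) (w : ℝ × ℝ) :
    LocallyIntegrable fun p => ∫ u in (0 : ℝ)..1, g (p + u • w) := by
  rw [locallyIntegrable_iff]
  intro K hK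
  obtain ⟨h, hh1, hc, -⟩ := exists_continuousMap_one_of_isCompact_subset_isOpen hK isOpen_univ
    (subset_univ K)
  have h1 := (integrable_segment_mul hg h.continuous hc w).integral_prod_right
  refine (h1.integrableOn (s := K)).congr ?_
  filter_upwards [ae_restrict_mem hK.measurableSet] with p hp
  have : h p = 1 := hh1 hp
  simp [this, intervalIntegral.integral_of_le zero_le_one]

/-- The fundamental theorem of calculus along a fixed translation: a function with a weak
derivative `g` in the direction `w` satisfies `f(p + w) - f(p) = ∫₀¹ g(p + u w) du` almost
everywhere. -/
theorem HasWeakDeriv.sub_eq_integral (hfg : HasWeakDeriv univ w f g) :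
    ∀ᵐ p, f (p + w) - f p = ∫ u in (0 : ℝ)..1, g (p + u • w) := by
  have hf : LocallyIntegrable f := locallyIntegrableOn_univ.1 hfg.1
  have hg : LocallyIntegrable g := locallyIntegrableOn_univ.1 hfg.2.1
  have hfw : LocallyIntegrable fun p => f (p + w) := by
    rw [locallyIntegrable_iff]
    intro K hK
    have hmp := (measurePreserving_add_right volume w).restrict_image_emb
      (MeasurableEquiv.addRight w).measurableEmbedding K
    exact (hmp.integrable_comp_emb (MeasurableEquiv.addRight w).measurableEmbedding).2
      (hf.integrableOn_isCompact (hK.image (by fun_prop)))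
  have hgw := locallyIntegrable_segmentAverage hg w
  have key := ae_eq_zero_of_integral_contDiff_smul_eq_zero ((hfw.sub hf).sub hgw) ?_
  · exact key.mono fun p hp => sub_eq_zero.1 hp
  intro h hh hc
  have e := hfg.integral_eq (contDiff_segmentAverage hh hc w)
    (hasCompactSupport_segmentAverage hc w) (subset_univ _)
  simp only [fderiv_segmentAverage hh hc w] at e
  rw [integral_mul_segmentAverage hg hh.continuous hc w] at e
  have hI : ∀ {k : ℝ × ℝ → ℝ}, LocallyIntegrable k → Integrable fun p => k p * h p :=
    fun {k} hk => integrable_mul_of_compactSupport (hk.locallyIntegrableOn univ) hh.continuous hc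
      (subset_univ _)
  have hI' : Integrable fun p => f p * h (p - w) := by
    have := (hI hfw).comp_sub_right w
    simpa using this
  have e1 : ∫ p, f p * (h p - h (p - w)) = (∫ p, f p * h p) - ∫ p, f (p + w) * h p := by
    simp only [mul_sub]
    rw [integral_sub (hI hf) hI']
    congr 1
    rw [← integral_add_right_eq_self _ w]
    simp
  rw [e1] at e
  calc ∫ p, h p • ((((fun p => f (p + w)) - f) - fun p => ∫ u in (0 : ℝ)..1, g (p + u • w)) p)
      = ∫ p, ((f (p + w) * h p - f p * h p) - (∫ u in (0 : ℝ)..1, g (p + u • w)) * h p) :=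
        integral_congr_ae (.of_forall fun p => by simp; ring)
    _ = 0 := by
        have i1 : Integrable fun p => f (p + w) * h p - f p * h p := (hI hfw).sub (hI hf)
        rw [integral_sub i1 (hI hgw), integral_sub (hI hfw) (hI hf)]
        linarith

end Segment

/-- Almost every horizontal line is good: the fundamental theorem of calculus in the direction `v`
holds from almost every base point on it and for almost every step. -/
theorem HasWeakDeriv.ae_eq_add_integral {v : ℝ × ℝ} {f g : ℝ × ℝ → ℝ}
    (hfg : HasWeakDeriv univ v f g) (hf : StronglyMeasurable f) (hg : StronglyMeasurable g) :
    ∀ᵐ y : ℝ, ∀ᵐ z : ℝ × ℝ, f ((z.1, y) + z.2 • v) =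
      f (z.1, y) + ∫ s in (0 : ℝ)..z.2, g ((z.1, y) + s • v) := by
  have hM : ∀ M : ℝ, ∀ᵐ p : ℝ × ℝ, f (p + M • v) - f p =
      ∫ u in (0 : ℝ)..1, M * g (p + u • (M • v)) := fun M => by
    simpa using (hfg.smul_direction M).sub_eq_integral
  have hmeas : MeasurableSet {z : (ℝ × ℝ) × ℝ | f ((z.1.2, z.1.1) + z.2 • v) - f (z.1.2, z.1.1) =
      ∫ u in (0 : ℝ)..1, z.2 * g ((z.1.2, z.1.1) + u • (z.2 • v))} := by
    refine measurableSet_eq_fun ?_ ?_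
    · exact (hf.measurable.comp (by fun_prop)).sub (hf.measurable.comp (by fun_prop))
    · have : StronglyMeasurable fun q : ((ℝ × ℝ) × ℝ) × ℝ =>
          q.1.2 * g ((q.1.1.2, q.1.1.1) + q.2 • (q.1.2 • v)) :=
        (measurable_snd.comp measurable_fst).stronglyMeasurable.mul
          (hg.comp_measurable (by fun_prop))
      simp only [intervalIntegral.integral_of_le zero_le_one]
      exact this.integral_prod_right.measurable
  have h1 : ∀ᵐ z : (ℝ × ℝ) × ℝ, f ((z.1.2, z.1.1) + z.2 • v) - f (z.1.2, z.1.1) =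
      ∫ u in (0 : ℝ)..1, z.2 * g ((z.1.2, z.1.1) + u • (z.2 • v)) := by
    have hms : MeasurableSet (Prod.swap ⁻¹' {z : (ℝ × ℝ) × ℝ |
        f ((z.1.2, z.1.1) + z.2 • v) - f (z.1.2, z.1.1) =
        ∫ u in (0 : ℝ)..1, z.2 * g ((z.1.2, z.1.1) + u • (z.2 • v))}) := measurable_swap hmeas
    have h2 : ∀ᵐ z : ℝ × (ℝ × ℝ), z ∈ Prod.swap ⁻¹' {z : (ℝ × ℝ) × ℝ |
        f ((z.1.2, z.1.1) + z.2 • v) - f (z.1.2, z.1.1) =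
        ∫ u in (0 : ℝ)..1, z.2 * g ((z.1.2, z.1.1) + u • (z.2 • v))} := by
      rw [Measure.volume_eq_prod, Measure.ae_prod_mem_iff_ae_ae_mem hms]
      refine .of_forall fun M => ?_
      exact (Measure.measurePreserving_swap (μ := (volume : Measure ℝ))
        (ν := (volume : Measure ℝ))).quasiMeasurePreserving.ae (hM M)
    exact (Measure.measurePreserving_swap (μ := (volume : Measure (ℝ × ℝ)))
        (ν := (volume : Measure ℝ))).quasiMeasurePreserving.ae h2
  have h3 := (measurePreserving_prodAssoc (volume : Measure ℝ) (volume : Measure ℝ)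
    (volume : Measure ℝ)).symm.quasiMeasurePreserving.ae h1
  filter_upwards [Measure.ae_ae_of_ae_prod h3] with y hy
  filter_upwards [hy] with z hz
  have hz' : f ((z.1, y) + z.2 • v) - f (z.1, y) =
    ∫ u in (0 : ℝ)..1, z.2 * g ((z.1, y) + u • (z.2 • v)) := hz
  have h4 := intervalIntegral.mul_integral_comp_mul_right (a := 0) (b := 1)
    (f := fun s => g ((z.1, y) + s • v)) (c := z.2)
  rw [intervalIntegral.integral_const_mul] at hz'
  simp only [zero_mul, one_mul, mul_smul] at h4
  rw [h4] at hz'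
  linarith

/-! ### Functions of finite energy on the cylinder are square integrable for decaying weights -/

theorem sq_intervalIntegral_le {k : ℝ → ℝ} (hk : AEStronglyMeasurable k)
    (hk2 : Integrable fun s => k s ^ 2) (a b : ℝ) :
    (∫ s in a..b, k s) ^ 2 ≤ |b - a| * ∫ s, k s ^ 2 := by
  set μ : Measure ℝ := volume.restrict (uIoc a b) with hμ
  have hfin : IsFiniteMeasure μ := ⟨by
    rw [hμ, Measure.restrict_apply_univ, uIoc, Real.volume_Ioc]; exact ENNReal.ofReal_lt_top⟩
  have hL2 : MemLp k 2 μ := ((memLp_two_iff_integrable_sq hk).2 hk2).restrict _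
  have hk1 : Integrable (fun s => |k s|) μ := (hL2.integrable one_le_two).abs
  have hm : μ.real univ = |b - a| := by
    rw [hμ, measureReal_restrict_apply_univ, uIoc, Real.volume_real_Ioc_of_le min_le_max,
      max_sub_min_eq_abs]
  have h2 : ∀ c : ℝ, 0 ≤ |b - a| * (c * c) + (-2 * ∫ s, |k s| ∂μ) * c + ∫ s, k s ^ 2 ∂μ := by
    intro c
    have h0 : 0 ≤ ∫ s, (|k s| - c) ^ 2 ∂μ := integral_nonneg fun s => sq_nonneg _
    have e : ∫ s, (|k s| - c) ^ 2 ∂μ = ∫ s, (k s ^ 2 - 2 * c * |k s| + c ^ 2) ∂μ :=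
      integral_congr_ae (.of_forall fun s => by
        show (|k s| - c) ^ 2 = k s ^ 2 - 2 * c * |k s| + c ^ 2
        rw [← sq_abs (k s)]; ring)
    have hi : Integrable (fun s => k s ^ 2 - 2 * c * |k s|) μ :=
      hL2.integrable_sq.sub (hk1.const_mul (2 * c))
    rw [e, integral_add hi (integrable_const _),
      integral_sub hL2.integrable_sq (hk1.const_mul (2 * c)), integral_const_mul,
      integral_const, hm, smul_eq_mul] at h0
    nlinarith
  have hd := discrim_le_zero h2
  rw [discrim] at hd
  have h3 : ∫ s, k s ^ 2 ∂μ ≤ ∫ s, k s ^ 2 := setIntegral_le_integral hk2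
    (.of_forall fun s => sq_nonneg _)
  have h4 : |∫ s in a..b, k s| ≤ ∫ s, |k s| ∂μ := by
    have := intervalIntegral.norm_integral_le_integral_norm_uIoc (f := k) (a := a) (b := b)
      (μ := volume)
    simpa using this
  calc (∫ s in a..b, k s) ^ 2 = |∫ s in a..b, k s| ^ 2 := (sq_abs _).symm
    _ ≤ (∫ s, |k s| ∂μ) ^ 2 := by gcongr
    _ ≤ |b - a| * ∫ s, k s ^ 2 ∂μ := by nlinarith
    _ ≤ _ := by gcongr

theorem integrable_exp_neg_mul_abs {c : ℝ} (hc : 0 < c) :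
    Integrable fun y : ℝ => exp (-(c * |y|)) := by
  rw [← integrableOn_univ, ← Iic_union_Ioi (a := (0 : ℝ))]
  refine IntegrableOn.union ?_ ?_
  · refine (integrableOn_exp_mul_Iic hc 0).congr_fun (fun y hy => ?_) measurableSet_Iic
    simp only [abs_of_nonpos (mem_Iic.1 hy)]
    congr 1
    ring
  · refine (integrableOn_exp_mul_Ioi (neg_lt_zero.2 hc) 0).congr_fun (fun y hy => ?_)
      measurableSet_Ioi
    simp only [abs_of_pos (mem_Ioi.1 hy)]
    congr 1
    ring

theorem integrable_abs_mul_exp_neg_abs : Integrable fun y : ℝ => |y| * exp (-|y|) := by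
  refine ((integrable_exp_neg_mul_abs (c := 1 / 2) (by norm_num)).const_mul 2).mono'
    (Continuous.aestronglyMeasurable (by fun_prop)) (.of_forall fun y => ?_)
  rw [Real.norm_of_nonneg (by positivity)]
  have h1 : |y| / 2 ≤ exp (|y| / 2) := by linarith [add_one_le_exp (|y| / 2)]
  have h2 : exp (-|y|) = exp (-(1 / 2 * |y|)) * exp (-(1 / 2 * |y|)) := by
    rw [← exp_add]; congr 1; ring
  have h3 : exp (|y| / 2) * exp (-(1 / 2 * |y|)) = 1 := by
    rw [← exp_add, exp_eq_one_iff]; ring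
  rw [h2, ← mul_assoc]
  refine mul_le_mul_of_nonneg_right ?_ (exp_pos _).le
  calc |y| * exp (-(1 / 2 * |y|)) ≤ (2 * exp (|y| / 2)) * exp (-(1 / 2 * |y|)) := by
        gcongr; linarith
    _ = 2 := by rw [mul_assoc, h3, mul_one]

/-- The weighted square integrability of functions of finite energy, for measurable
representatives. A good horizontal line carries a bound for `f` by integration along it, and the
remaining values are reached by integration along vertical lines. -/
theorem integrableOn_exp_mul_sq_of_stronglyMeasurable {f g₁ g₂ : ℝ × ℝ → ℝ}
    (hf : StronglyMeasurable f) (hg₁ : StronglyMeasurable g₁) (hg₂ : StronglyMeasurable g₂)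
    (h₁ : HasWeakDeriv univ (1, 0) f g₁) (h₂ : HasWeakDeriv univ (0, 1) f g₂)
    (he₁ : IntegrableOn (fun p => g₁ p ^ 2) (cell univ))
    (he₂ : IntegrableOn (fun p => g₂ p ^ 2) (cell univ)) :
    IntegrableOn (fun p => exp (-|p.2|) * f p ^ 2) (cell univ) := by
  rw [IntegrableOn, volume_restrict_cell, Measure.restrict_univ] at he₁ he₂ ⊢
  -- a horizontal line `y = y₀` on which both fundamental theorems of calculus hold
  obtain ⟨y₀, hy1, hy2, hy3⟩ := ((h₁.ae_eq_add_integral hf hg₁).and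
    ((h₂.ae_eq_add_integral hf hg₂).and he₁.prod_left_ae)).exists
  -- a good base point on this line
  have hne : (ae (volume.restrict (Ioc (0 : ℝ) (2 * π)))).NeBot := by
    rw [ae_neBot, Ne, Measure.restrict_eq_zero, Real.volume_Ioc]
    simp [Real.pi_pos]
  obtain ⟨x₀, hx0, hx0m⟩ := ((ae_restrict_of_ae (s := Ioc (0 : ℝ) (2 * π))
    (Measure.ae_ae_of_ae_prod hy1)).and (ae_restrict_mem measurableSet_Ioc)).exists
  have hg1i : IntegrableOn (fun x => g₁ (x, y₀)) (Ioc 0 (2 * π)) := by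
    have := (memLp_two_iff_integrable_sq (hg₁.comp_measurable
      (measurable_id.prodMk measurable_const : Measurable fun x : ℝ => (x, y₀))
      ).aestronglyMeasurable).2 hy3
    exact this.integrable one_le_two
  set B : ℝ := |f (x₀, y₀)| + ∫ x in Ioc 0 (2 * π), |g₁ (x, y₀)| with hB
  have hbd : ∀ᵐ x ∂(volume.restrict (Ioc 0 (2 * π))), |f (x, y₀)| ≤ B := by
    have hx0' : ∀ᵐ x, f ((x₀, y₀) + (x - x₀) • ((1, 0) : ℝ × ℝ)) =
        f (x₀, y₀) + ∫ s in (0 : ℝ)..(x - x₀), g₁ ((x₀, y₀) + s • ((1, 0) : ℝ × ℝ)) :=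
      (measurePreserving_sub_right volume x₀).quasiMeasurePreserving.ae hx0
    filter_upwards [ae_restrict_of_ae hx0', ae_restrict_mem measurableSet_Ioc] with x hx hxm
    have e1 : ((x₀, y₀) : ℝ × ℝ) + (x - x₀) • ((1, 0) : ℝ × ℝ) = (x, y₀) := by
      ext <;> simp
    have e2 : ∫ s in (0 : ℝ)..(x - x₀), g₁ ((x₀, y₀) + s • ((1, 0) : ℝ × ℝ)) =
        ∫ s in x₀..x, g₁ (s, y₀) := by
      have := intervalIntegral.integral_comp_add_left (a := 0) (b := x - x₀)
        (fun s => g₁ (s, y₀)) x₀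
      rw [add_zero, add_sub_cancel] at this
      rw [← this]
      refine intervalIntegral.integral_congr fun s _ => ?_
      simp
    rw [e1, e2] at hx
    rw [hx]
    refine (abs_add_le _ _).trans (add_le_add_right ?_ _)
    have h3 := intervalIntegral.norm_integral_le_integral_norm_uIoc
      (f := fun s => g₁ (s, y₀)) (a := x₀) (b := x) (μ := volume)
    refine h3.trans (setIntegral_mono_set hg1i.norm (.of_forall fun s => norm_nonneg _)
      (LE.le.eventuallyLE ?_))
    intro s hs
    exact ⟨(le_min hx0m.1.le hxm.1.le).trans_lt hs.1, hs.2.trans (max_le hx0m.2 hxm.2)⟩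
  have hvert : ∀ᵐ z : ℝ × ℝ, f z = f (z.1, y₀) + ∫ s in (0 : ℝ)..(z.2 - y₀), g₂ (z.1, y₀ + s) := by
    have hmp : MeasurePreserving (fun z : ℝ × ℝ => (z.1, z.2 - y₀)) volume volume := by
      have := measurePreserving_sub_right (volume : Measure (ℝ × ℝ)) (0, y₀)
      convert this using 2 with z
      ext <;> simp
    filter_upwards [hmp.quasiMeasurePreserving.ae hy2] with z hz
    have e1 : ((z.1, y₀) : ℝ × ℝ) + (z.2 - y₀) • ((0, 1) : ℝ × ℝ) = z := by
      ext <;> simp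
    rw [e1] at hz
    rw [hz]
    congr 1
    refine intervalIntegral.integral_congr fun s _ => ?_
    simp
  set G : ℝ → ℝ := fun x => ∫ s, g₂ (x, s) ^ 2 with hG
  have hGi : Integrable G (volume.restrict (Ioc 0 (2 * π))) := he₂.integral_prod_left
  have hE : Integrable (fun y : ℝ => exp (-|y|)) := by
    simpa using integrable_exp_neg_mul_abs one_pos
  have hdom : Integrable (fun z : ℝ × ℝ => 2 * B ^ 2 * (1 * exp (-|z.2|)) +
      2 * (G z.1 * (|z.2| * exp (-|z.2|) + |y₀| * exp (-|z.2|))))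
      ((volume.restrict (Ioc 0 (2 * π))).prod volume) := by
    refine Integrable.add ?_ ?_
    · exact ((integrable_const (1 : ℝ)).mul_prod hE).const_mul _
    · exact (hGi.mul_prod (integrable_abs_mul_exp_neg_abs.add (hE.const_mul |y₀|))).const_mul _
  refine hdom.mono' ?_ ?_
  · exact ((Continuous.stronglyMeasurable (by fun_prop)).mul (hf.pow 2)).aestronglyMeasurable
  · have hv' : ∀ᵐ z ∂((volume.restrict (Ioc 0 (2 * π))).prod (volume : Measure ℝ)),
        f z = f (z.1, y₀) + ∫ s in (0 : ℝ)..(z.2 - y₀), g₂ (z.1, y₀ + s) := by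
      have := ae_restrict_of_ae (s := cell univ) hvert
      rwa [volume_restrict_cell, Measure.restrict_univ] at this
    filter_upwards [hv', Measure.quasiMeasurePreserving_fst.ae hbd,
      Measure.quasiMeasurePreserving_fst.ae he₂.prod_right_ae] with z hz hzB hzi
    rw [Real.norm_of_nonneg (by positivity), hz]
    have hsh : Integrable fun s => g₂ (z.1, y₀ + s) ^ 2 := hzi.comp_add_left y₀
    have hcs := sq_intervalIntegral_le (k := fun s => g₂ (z.1, y₀ + s))
      (hg₂.comp_measurable (by fun_prop)).aestronglyMeasurable hsh 0 (z.2 - y₀)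
    have hGe : ∫ s, g₂ (z.1, y₀ + s) ^ 2 = G z.1 :=
      integral_add_left_eq_self (fun s => g₂ (z.1, s) ^ 2) y₀
    rw [hGe, sub_zero] at hcs
    have hG0 : 0 ≤ G z.1 := integral_nonneg fun s => sq_nonneg _
    have hab : |z.2 - y₀| ≤ |z.2| + |y₀| := abs_sub _ _
    have hB2 : f (z.1, y₀) ^ 2 ≤ B ^ 2 := sq_le_sq' (by linarith [neg_abs_le (f (z.1, y₀))])
      ((le_abs_self _).trans hzB)
    have hR : (∫ s in (0 : ℝ)..(z.2 - y₀), g₂ (z.1, y₀ + s)) ^ 2 ≤ (|z.2| + |y₀|) * G z.1 :=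
      hcs.trans (by gcongr)
    have hsq : (f (z.1, y₀) + ∫ s in (0 : ℝ)..(z.2 - y₀), g₂ (z.1, y₀ + s)) ^ 2 ≤
        2 * B ^ 2 + 2 * ((|z.2| + |y₀|) * G z.1) := by
      nlinarith [sq_nonneg (f (z.1, y₀) - ∫ s in (0 : ℝ)..(z.2 - y₀), g₂ (z.1, y₀ + s))]
    calc _ ≤ exp (-|z.2|) * (2 * B ^ 2 + 2 * ((|z.2| + |y₀|) * G z.1)) := by gcongr
      _ = _ := by ring

/-- A function of finite Dirichlet energy on the cylinder is square integrable with respect to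
`e^{-|y|} dx dy`. -/
theorem FiniteEnergy.integrableOn_exp_mul_sq {ψ : ℝ × ℝ → ℝ}
    (hψ : FiniteEnergy univ (fun _ => 1) (fun _ => 1) ψ) :
    IntegrableOn (fun p => exp (-|p.2|) * ψ p ^ 2) (cell univ) := by
  have hf := hψ.weaklyDifferentiable.hasD₁.1.aestronglyMeasurable
  have hg1 := hψ.weaklyDifferentiable.hasD₁.2.1.aestronglyMeasurable
  have hg2 := hψ.weaklyDifferentiable.hasD₂.2.1.aestronglyMeasurable
  have h1 := hψ.weaklyDifferentiable.hasD₁.congr_ae (isOpen_strip isOpen_univ) hf.ae_eq_mk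
    hg1.ae_eq_mk
  have h2 := hψ.weaklyDifferentiable.hasD₂.congr_ae (isOpen_strip isOpen_univ) hf.ae_eq_mk
    hg2.ae_eq_mk
  have e1 : IntegrableOn (fun p => hg1.mk _ p ^ 2) (cell univ) := by
    refine hψ.energy₁.congr ?_
    filter_upwards [ae_restrict_cell hg1.ae_eq_mk] with p hp
    rw [hp, one_mul]
  have e2 : IntegrableOn (fun p => hg2.mk _ p ^ 2) (cell univ) := by
    refine hψ.energy₂.congr ?_
    filter_upwards [ae_restrict_cell hg2.ae_eq_mk] with p hp
    rw [hp, one_mul]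
  refine (integrableOn_exp_mul_sq_of_stronglyMeasurable hf.stronglyMeasurable_mk
    hg1.stronglyMeasurable_mk hg2.stronglyMeasurable_mk (strip_univ.subst (motive :=
      fun U => HasWeakDeriv U (1, 0) _ _) h1) (strip_univ.subst (motive :=
      fun U => HasWeakDeriv U (0, 1) _ _) h2) e1 e2).congr ?_
  filter_upwards [ae_restrict_cell hf.ae_eq_mk] with p hp
  rw [hp]

/-! ### Unfolding integrals over a period cell -/

/-- A smooth step from `0` to `1`, constant outside `(π/2, 3π/2)`. -/
def step (x : ℝ) : ℝ := smoothTransition (x / π - 1 / 2)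

theorem contDiff_step : ContDiff ℝ ∞ step :=
  Real.smoothTransition.contDiff.comp (by fun_prop)

theorem step_eq_zero {x : ℝ} (h : x ≤ π / 2) : step x = 0 := by
  refine smoothTransition.zero_of_nonpos ?_
  rw [sub_nonpos, div_le_iff₀ pi_pos]
  linarith

theorem step_eq_one {x : ℝ} (h : 3 * π / 2 ≤ x) : step x = 1 := by
  refine smoothTransition.one_of_one_le ?_
  rw [le_sub_iff_add_le, le_div_iff₀ pi_pos]
  linarith

/-- A smooth compactly supported function whose translates by `2πℤ` sum to `1`. -/
def periodCutoff (x : ℝ) : ℝ := step x - step (x - 2 * π)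

theorem contDiff_periodCutoff : ContDiff ℝ ∞ periodCutoff :=
  contDiff_step.sub (contDiff_step.comp (by fun_prop))

theorem periodCutoff_eq_zero {x : ℝ} (h : x ≤ π / 2 ∨ 7 * π / 2 ≤ x) : periodCutoff x = 0 := by
  have hpi := pi_pos
  rcases h with h | h
  · rw [periodCutoff, step_eq_zero h, step_eq_zero (by linarith), sub_zero]
  · rw [periodCutoff, step_eq_one (by linarith), step_eq_one (by linarith), sub_self]

theorem hasCompactSupport_periodCutoff : HasCompactSupport periodCutoff := by
  refine HasCompactSupport.intro (isCompact_Icc (a := π / 2) (b := 7 * π / 2)) fun x hx => ?_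
  refine periodCutoff_eq_zero ?_
  rw [mem_Icc, not_and_or, not_le, not_le] at hx
  exact hx.imp le_of_lt le_of_lt

theorem periodCutoff_add {x : ℝ} (h0 : -(π / 2) ≤ x) (h1 : x ≤ 5 * π / 2) :
    periodCutoff x + periodCutoff (x + 2 * π) = 1 := by
  rw [periodCutoff, periodCutoff, add_sub_cancel_right, step_eq_zero (x := x - 2 * π) (by linarith),
    step_eq_one (x := x + 2 * π) (by linarith)]
  ring

theorem deriv_periodCutoff_eq_zero {x : ℝ} (h : x < π / 2 ∨ 7 * π / 2 < x) :
    deriv periodCutoff x = 0 := by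
  have : periodCutoff =ᶠ[𝓝 x] fun _ => 0 := by
    rcases h with h | h
    · filter_upwards [Iio_mem_nhds h] with y hy using periodCutoff_eq_zero (.inl hy.le)
    · filter_upwards [Ioi_mem_nhds h] with y hy using periodCutoff_eq_zero (.inr hy.le)
  rw [this.deriv_eq, deriv_const]

theorem deriv_periodCutoff_add {x : ℝ} (h : x ∈ Ioc 0 (2 * π)) :
    deriv periodCutoff x + deriv periodCutoff (x + 2 * π) = 0 := by
  have hpi := pi_pos
  have hd : Differentiable ℝ periodCutoff := contDiff_periodCutoff.differentiable (by simp)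
  have h1 : (fun y => periodCutoff y + periodCutoff (y + 2 * π)) =ᶠ[𝓝 x] fun _ => 1 := by
    filter_upwards [Ioo_mem_nhds (show -(π / 2) < x by linarith [h.1])
      (show x < 5 * π / 2 by linarith [h.2])] with y hy using periodCutoff_add hy.1.le hy.2.le
  have h2 := h1.deriv_eq
  rw [deriv_const, deriv_fun_add (f := periodCutoff) (g := fun y => periodCutoff (y + 2 * π))
    hd.differentiableAt
    (hd.comp (by fun_prop : Differentiable ℝ fun y : ℝ => y + 2 * π)).differentiableAt,
    deriv_comp_add_const] at h2
  exact h2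

/-- Multiplication by a function of `x` supported in two periods turns an integral over the plane
into an integral over the period cell. -/
theorem integral_mul_eq_integral_cell {F : ℝ × ℝ → ℝ} {k : ℝ → ℝ} (hF : PeriodicOn univ F)
    (hFi : IntegrableOn F (cell univ)) (hk : Continuous k) (hc : HasCompactSupport k)
    (hk0 : ∀ x, x ≤ 0 ∨ 4 * π < x → k x = 0) :
    Integrable (fun p : ℝ × ℝ => k p.1 * F p) ∧ ∫ p : ℝ × ℝ, k p.1 * F p =
      ∫ p in cell univ, (k p.1 + k (p.1 + 2 * π)) * F p := by
  obtain ⟨C, hC⟩ := hk.bounded_above_of_compact_support hc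
  have hpi := pi_pos
  set A : Set (ℝ × ℝ) := cell univ with hA
  set B : Set (ℝ × ℝ) := Ioc (2 * π) (4 * π) ×ˢ univ with hB
  have hAm : MeasurableSet A := measurableSet_cell isOpen_univ
  have hBm : MeasurableSet B := measurableSet_Ioc.prod MeasurableSet.univ
  have hτ : MeasurePreserving (fun p : ℝ × ℝ => (p.1 + 2 * π, p.2)) (volume.restrict A)
      (volume.restrict B) := by
    have h := measurePreserving_translate univ (2 * π)
    rw [strip_univ, Measure.restrict_univ] at h
    have h2 := h.restrict_preimage_emb (measurableEmbedding_translate (2 * π)) B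
    have : (fun p : ℝ × ℝ => (p.1 + 2 * π, p.2)) ⁻¹' B = A := by
      ext p
      simp only [hA, hB, cell, mem_preimage, mem_prod, mem_Ioc, mem_univ, and_true]
      constructor <;> rintro ⟨h1, h2⟩ <;> constructor <;> linarith
    rwa [this] at h2
  have iA : IntegrableOn (fun p : ℝ × ℝ => k p.1 * F p) A :=
    hFi.bdd_mul (c := C) (hk.comp continuous_fst).aestronglyMeasurable (.of_forall fun p => hC _)
  have iA2 : IntegrableOn (fun p : ℝ × ℝ => k (p.1 + 2 * π) * F p) A :=
    hFi.bdd_mul (c := C) (hk.comp (by fun_prop)).aestronglyMeasurable (.of_forall fun p => hC _)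
  have hper : ∀ᵐ p ∂(volume.restrict A), k (p.1 + 2 * π) * F p =
      (fun p : ℝ × ℝ => k p.1 * F p) (p.1 + 2 * π, p.2) := by
    filter_upwards [ae_restrict_cell hF] with p hp
    simp only [hp]
  have iB : IntegrableOn (fun p : ℝ × ℝ => k p.1 * F p) B :=
    (hτ.integrable_comp_emb (measurableEmbedding_translate _)).1 (iA2.congr hper)
  have eB : ∫ p in B, k p.1 * F p = ∫ p in A, k (p.1 + 2 * π) * F p := by
    rw [integral_congr_ae hper, hτ.integral_comp (measurableEmbedding_translate _)
      (fun p : ℝ × ℝ => k p.1 * F p)]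
  have hsupp : ∀ p : ℝ × ℝ, p ∉ A ∪ B → k p.1 * F p = 0 := by
    intro p hp
    rw [hk0, zero_mul]
    by_contra hcon
    push Not at hcon
    refine hp ?_
    rcases le_or_gt p.1 (2 * π) with h | h
    · exact .inl ⟨⟨hcon.1, h⟩, trivial⟩
    · exact .inr ⟨⟨h, hcon.2⟩, trivial⟩
  have hdisj : Disjoint A B := by
    rw [Set.disjoint_left]
    rintro p ⟨h1, -⟩ ⟨h2, -⟩
    exact absurd h2.1 (not_lt.2 h1.2)
  refine ⟨?_, ?_⟩
  · refine (integrableOn_iff_integrable_of_support_subset ?_).1 (iA.union iB)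
    intro p hp
    by_contra h
    exact hp (hsupp p h)
  · rw [← setIntegral_eq_integral_of_forall_compl_eq_zero hsupp, setIntegral_union hdisj hBm iA iB,
      eB, ← integral_add iA iA2]
    simp only [add_mul]

theorem integral_periodCutoff_mul {F : ℝ × ℝ → ℝ} (hF : PeriodicOn univ F)
    (hFi : IntegrableOn F (cell univ)) : Integrable (fun p : ℝ × ℝ => periodCutoff p.1 * F p) ∧
      ∫ p : ℝ × ℝ, periodCutoff p.1 * F p = ∫ p in cell univ, F p := by
  have hpi := pi_pos
  obtain ⟨h1, h2⟩ := integral_mul_eq_integral_cell hF hFi contDiff_periodCutoff.continuous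
    hasCompactSupport_periodCutoff fun x hx => periodCutoff_eq_zero
      (hx.imp (fun h => by linarith) fun h => by linarith)
  refine ⟨h1, h2.trans (setIntegral_congr_fun (measurableSet_cell isOpen_univ) fun p hp => ?_)⟩
  rw [periodCutoff_add (by linarith [hp.1.1]) (by linarith [hp.1.2]), one_mul]

theorem integral_deriv_periodCutoff_mul {F : ℝ × ℝ → ℝ} (hF : PeriodicOn univ F)
    (hFi : IntegrableOn F (cell univ)) :
    Integrable (fun p : ℝ × ℝ => deriv periodCutoff p.1 * F p) ∧
      ∫ p : ℝ × ℝ, deriv periodCutoff p.1 * F p = 0 := by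
  have hpi := pi_pos
  obtain ⟨h1, h2⟩ := integral_mul_eq_integral_cell hF hFi
    (contDiff_periodCutoff.continuous_deriv (by simp))
    hasCompactSupport_periodCutoff.deriv fun x hx => deriv_periodCutoff_eq_zero
      (hx.imp (fun h => by linarith) fun h => by linarith)
  refine ⟨h1, h2.trans ?_⟩
  refine setIntegral_eq_zero_of_forall_eq_zero fun p hp => ?_
  rw [deriv_periodCutoff_add hp.1, zero_mul]

/-! ### Green's identity on the cylinder -/

/-- Smooth cutoffs in `y` that exhaust the line. -/
def heightCutoff (n : ℕ) (y : ℝ) : ℝ :=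
  (⟨1, 2, one_pos, one_lt_two⟩ : ContDiffBump (0 : ℝ)) (y / (n + 1))

theorem contDiff_heightCutoff (n : ℕ) : ContDiff ℝ ∞ (heightCutoff n) :=
  (ContDiffBump.contDiff _).comp (by fun_prop)

theorem hasCompactSupport_heightCutoff (n : ℕ) : HasCompactSupport (heightCutoff n) := by
  have hn : (0 : ℝ) < n + 1 := by positivity
  refine HasCompactSupport.intro (isCompact_Icc (a := -(2 * (n + 1) : ℝ)) (b := 2 * (n + 1)))
    fun y hy => ContDiffBump.zero_of_le_dist _ ?_
  rw [dist_zero_right, Real.norm_eq_abs, abs_div, abs_of_pos hn, le_div_iff₀ hn]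
  by_contra hcon
  exact hy (abs_le.1 (not_le.1 hcon).le)

theorem abs_heightCutoff_le (n : ℕ) (y : ℝ) : |heightCutoff n y| ≤ 1 := by
  rw [heightCutoff, abs_of_nonneg (ContDiffBump.nonneg _)]
  exact ContDiffBump.le_one _

theorem tendsto_heightCutoff (y : ℝ) : Tendsto (fun n => heightCutoff n y) atTop (𝓝 1) := by
  refine tendsto_const_nhds.congr' ?_
  obtain ⟨N, hN⟩ := exists_nat_ge |y|
  filter_upwards [eventually_ge_atTop N] with n hn
  have hn0 : (0 : ℝ) < n + 1 := by positivity
  have hn' : (N : ℝ) ≤ n := by exact_mod_cast hn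
  refine (ContDiffBump.one_of_mem_closedBall _ ?_).symm
  rw [Metric.mem_closedBall, dist_zero_right, Real.norm_eq_abs, abs_div, abs_of_pos hn0,
    div_le_iff₀ hn0]
  linarith

theorem exists_deriv_heightCutoff_le :
    ∃ C : ℝ, 0 ≤ C ∧ ∀ n y, |deriv (heightCutoff n) y| ≤ C * (1 / ((n : ℝ) + 1)) := by
  set b : ContDiffBump (0 : ℝ) := ⟨1, 2, one_pos, one_lt_two⟩ with hb
  have hbs : ContDiff ℝ ∞ b := b.contDiff
  obtain ⟨C, hC⟩ := (hbs.continuous_deriv (by simp)).bounded_above_of_compact_support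
    b.hasCompactSupport.deriv
  refine ⟨C, (norm_nonneg _).trans (hC 0), fun n y => ?_⟩
  have hn0 : (0 : ℝ) < n + 1 := by positivity
  have h1 : HasDerivAt b (deriv b (y / (n + 1))) (y / (n + 1)) :=
    (hbs.differentiable (by simp)).differentiableAt.hasDerivAt
  have h2 : HasDerivAt (heightCutoff n) (deriv b (y / (n + 1)) * (1 / (n + 1))) y :=
    h1.comp y ((hasDerivAt_id y).div_const _)
  rw [h2.deriv, abs_mul, abs_of_pos (by positivity : (0 : ℝ) < 1 / (n + 1))]
  exact mul_le_mul_of_nonneg_right (hC _) (by positivity)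

theorem fderiv_cutoff_mul {a b : ℝ → ℝ} {E : ℝ × ℝ → ℝ} (ha : Differentiable ℝ a)
    (hb : Differentiable ℝ b) (hE : Differentiable ℝ E) (p v : ℝ × ℝ) :
    fderiv ℝ (fun q : ℝ × ℝ => a q.1 * (b q.2 * E q)) p v =
      v.1 * deriv a p.1 * (b p.2 * E p) + a p.1 * (v.2 * deriv b p.2 * E p)
        + a p.1 * (b p.2 * fderiv ℝ E p v) := by
  have h1 := (ha p.1).hasDerivAt.comp_hasFDerivAt p (hasFDerivAt_fst (𝕜 := ℝ) (p := p))
  have h2 := (hb p.2).hasDerivAt.comp_hasFDerivAt p (hasFDerivAt_snd (𝕜 := ℝ) (p := p))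
  have h3 := h1.mul (h2.mul (hE p).hasFDerivAt)
  have h4 : fderiv ℝ (fun q : ℝ × ℝ => a q.1 * (b q.2 * E q)) p = _ := h3.fderiv
  rw [h4]
  simp
  ring

theorem fderiv_periodic {e : ℝ × ℝ → ℝ} (hper : ∀ p : ℝ × ℝ, e (p.1 + 2 * π, p.2) = e p)
    (p : ℝ × ℝ) : fderiv ℝ e (p.1 + 2 * π, p.2) = fderiv ℝ e p := by
  have h : (fun q : ℝ × ℝ => e (q + (2 * π, 0))) = e := by
    ext q
    rw [← hper q]
    congr 1
    ext <;> simp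
  conv_rhs => rw [← h, fderiv_comp_add_right]
  congr 1
  ext <;> simp

theorem integrableOn_exp_neg_abs : IntegrableOn (fun p : ℝ × ℝ => exp (-|p.2|)) (cell univ) := by
  rw [IntegrableOn, volume_restrict_cell, Measure.restrict_univ]
  have := integrable_exp_neg_mul_abs one_pos
  simp only [one_mul] at this
  exact this.comp_snd _

/-- A function of finite Dirichlet energy is integrable against exponentially decaying functions. -/
theorem FiniteEnergy.integrableOn_mul_of_decay {φ L : ℝ × ℝ → ℝ} {C : ℝ}
    (hφ : FiniteEnergy univ (fun _ => 1) (fun _ => 1) φ) (hL : Continuous L)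
    (hLb : ∀ p, |L p| ≤ C * exp (-|p.2|)) : IntegrableOn (fun p => L p * φ p) (cell univ) := by
  refine ((integrableOn_exp_neg_abs.add hφ.integrableOn_exp_mul_sq).const_mul C).mono'
    (hL.aestronglyMeasurable.mul
      (aestronglyMeasurable_cell hφ.weaklyDifferentiable.hasD₁.1)) (.of_forall fun p => ?_)
  have h1 : |φ p| ≤ 1 + φ p ^ 2 := by
    rw [← sq_abs (φ p)]
    nlinarith [sq_nonneg (|φ p| - 1), abs_nonneg (φ p)]
  have h0 : 0 ≤ C * exp (-|p.2|) := (abs_nonneg _).trans (hLb p)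
  rw [Real.norm_eq_abs, abs_mul]
  calc |L p| * |φ p| ≤ C * exp (-|p.2|) * (1 + φ p ^ 2) :=
        mul_le_mul (hLb p) h1 (abs_nonneg _) h0
    _ = _ := by simp only [Pi.add_apply]; ring

theorem integrableOn_mul_of_sq_of_decay {g E : ℝ × ℝ → ℝ} {C : ℝ}
    (hg : AEStronglyMeasurable g (volume.restrict (cell univ)))
    (hg2 : IntegrableOn (fun p => g p ^ 2) (cell univ)) (hE : Continuous E)
    (hEb : ∀ p, |E p| ≤ C * exp (-|p.2|)) : IntegrableOn (fun p => E p * g p) (cell univ) := by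
  refine ((integrableOn_exp_neg_abs.const_mul (C ^ 2)).add hg2).mono'
    (hE.aestronglyMeasurable.mul hg) (.of_forall fun p => ?_)
  have h1 : E p ^ 2 ≤ C ^ 2 * exp (-|p.2|) := by
    have h2 : exp (-|p.2|) ≤ 1 := exp_le_one_iff.2 (by simp)
    have h3 := exp_pos (-|p.2|)
    calc E p ^ 2 = |E p| ^ 2 := (sq_abs _).symm
      _ ≤ (C * exp (-|p.2|)) ^ 2 := pow_le_pow_left₀ (abs_nonneg _) (hEb p) 2
      _ = C ^ 2 * (exp (-|p.2|) * exp (-|p.2|)) := by ring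
      _ ≤ C ^ 2 * (exp (-|p.2|) * 1) := by gcongr
      _ = _ := by ring
  rw [Real.norm_eq_abs, abs_mul, Pi.add_apply]
  rw [← sq_abs] at h1
  rw [← sq_abs (g p)]
  nlinarith [sq_nonneg (|E p| - |g p|), sq_nonneg |E p|, sq_nonneg |g p|]

/-- Green's identity between a smooth function whose derivatives decay exponentially and a
function of finite Dirichlet energy. -/
theorem FiniteEnergy.energyForm_eq_integral {e L φ : ℝ × ℝ → ℝ} {C : ℝ} (he : ContDiff ℝ ∞ e)
    (hper : ∀ p : ℝ × ℝ, e (p.1 + 2 * π, p.2) = e p)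
    (h₁ : ∀ p, |fderiv ℝ e p (1, 0)| ≤ C * exp (-|p.2|))
    (h₂ : ∀ p, |fderiv ℝ e p (0, 1)| ≤ C * exp (-|p.2|))
    (hL : Continuous L) (hLb : ∀ p, |L p| ≤ C * exp (-|p.2|)) (hLper : PeriodicOn univ L)
    (hΔ : ∀ p, fderiv ℝ (fun q => fderiv ℝ e q (1, 0)) p (1, 0) +
      fderiv ℝ (fun q => fderiv ℝ e q (0, 1)) p (0, 1) = - L p)
    (hφ : FiniteEnergy univ (fun _ => 1) (fun _ => 1) φ) :
    energyForm univ (fun _ => 1) (fun _ => 1) e φ = ∫ p in cell univ, L p * φ p := by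
  set e₁ : ℝ × ℝ → ℝ := fun p => fderiv ℝ e p (1, 0) with he₁
  set e₂ : ℝ × ℝ → ℝ := fun p => fderiv ℝ e p (0, 1) with he₂
  have s₁ : ContDiff ℝ ∞ e₁ := contDiff_fderiv_apply he _
  have s₂ : ContDiff ℝ ∞ e₂ := contDiff_fderiv_apply he _
  have p₁ : PeriodicOn univ e₁ := .of_forall fun p => by simp only [he₁, fderiv_periodic hper]
  have p₂ : PeriodicOn univ e₂ := .of_forall fun p => by simp only [he₂, fderiv_periodic hper]
  set φ₁ := D₁ univ φ
  set φ₂ := D₂ univ φ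
  have w₁ : HasWeakDeriv (strip univ) (1, 0) φ φ₁ := hφ.weaklyDifferentiable.hasD₁
  have w₂ : HasWeakDeriv (strip univ) (0, 1) φ φ₂ := hφ.weaklyDifferentiable.hasD₂
  have i₁ : IntegrableOn (fun p => e₁ p * φ₁ p) (cell univ) :=
    integrableOn_mul_of_sq_of_decay (aestronglyMeasurable_cell w₁.2.1) (by simpa using hφ.energy₁)
      s₁.continuous h₁
  have i₂ : IntegrableOn (fun p => e₂ p * φ₂ p) (cell univ) :=
    integrableOn_mul_of_sq_of_decay (aestronglyMeasurable_cell w₂.2.1) (by simpa using hφ.energy₂)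
      s₂.continuous h₂
  have i₃ := hφ.integrableOn_mul_of_decay hL hLb
  have i₄ := hφ.integrableOn_mul_of_decay s₁.continuous h₁
  have i₅ := hφ.integrableOn_mul_of_decay s₂.continuous h₂
  have hc : ∀ n, Continuous fun p : ℝ × ℝ => heightCutoff n p.2 := fun n =>
    (contDiff_heightCutoff n).continuous.comp continuous_snd
  have hd : ∀ n, Continuous fun p : ℝ × ℝ => deriv (heightCutoff n) p.2 := fun n =>
    ((contDiff_heightCutoff n).continuous_deriv (by simp)).comp continuous_snd
  obtain ⟨K, hK0, hK⟩ := exists_deriv_heightCutoff_le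
  have hcut : ∀ n {F : ℝ × ℝ → ℝ}, IntegrableOn F (cell univ) →
      IntegrableOn (fun p => heightCutoff n p.2 * F p) (cell univ) := fun n F hF =>
    hF.bdd_mul (c := 1) (hc n).aestronglyMeasurable (.of_forall fun p => abs_heightCutoff_le n _)
  have hdcut : ∀ n {F : ℝ × ℝ → ℝ}, IntegrableOn F (cell univ) →
      IntegrableOn (fun p => deriv (heightCutoff n) p.2 * F p) (cell univ) := fun n F hF =>
    hF.bdd_mul (c := K * (1 / ((n : ℝ) + 1))) (hd n).aestronglyMeasurable
      (.of_forall fun p => hK n _)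
  have hpm : ∀ (b : ℝ → ℝ) {F G : ℝ × ℝ → ℝ}, PeriodicOn univ F → PeriodicOn univ G →
      PeriodicOn univ (fun p => b p.2 * (F p * G p)) := fun b F G hF hG => by
    filter_upwards [hF, hG] with p h1 h2
    simp only [h1, h2]
  -- the identity with a cutoff in `y`
  have key : ∀ n, (∫ p in cell univ, heightCutoff n p.2 * (e₁ p * φ₁ p)) +
      (∫ p in cell univ, heightCutoff n p.2 * (e₂ p * φ₂ p)) =
      (∫ p in cell univ, heightCutoff n p.2 * (L p * φ p)) -
      ∫ p in cell univ, deriv (heightCutoff n) p.2 * (e₂ p * φ p) := by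
    intro n
    have hχd := contDiff_periodCutoff.differentiable (n := ∞) (by simp)
    have hζd := (contDiff_heightCutoff n).differentiable (by simp)
    have test : ∀ {E : ℝ × ℝ → ℝ}, ContDiff ℝ ∞ E →
        ContDiff ℝ ∞ (fun q : ℝ × ℝ => periodCutoff q.1 * (heightCutoff n q.2 * E q)) ∧
        HasCompactSupport (fun q : ℝ × ℝ => periodCutoff q.1 * (heightCutoff n q.2 * E q)) := by
      intro E hE
      refine ⟨(contDiff_periodCutoff.comp contDiff_fst).mul
        (((contDiff_heightCutoff n).comp contDiff_snd).mul hE), ?_⟩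
      refine HasCompactSupport.intro (IsCompact.prod hasCompactSupport_periodCutoff
        (hasCompactSupport_heightCutoff n)) fun p hp => ?_
      rw [mem_prod, not_and_or] at hp
      rcases hp with hp | hp
      · rw [image_eq_zero_of_notMem_tsupport hp, zero_mul]
      · rw [image_eq_zero_of_notMem_tsupport hp, zero_mul, mul_zero]
    have t₁ := w₁.integral_eq (test s₁).1 (test s₁).2 (by simp [strip_univ])
    have t₂ := w₂.integral_eq (test s₂).1 (test s₂).2 (by simp [strip_univ])
    simp only [fderiv_cutoff_mul hχd hζd (s₁.differentiable (by simp)),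
      fderiv_cutoff_mul hχd hζd (s₂.differentiable (by simp)), one_mul, zero_mul, mul_zero,
      add_zero, zero_add] at t₁ t₂
    obtain ⟨ia, ea⟩ := integral_periodCutoff_mul
      (hpm (heightCutoff n) p₁ (w₁.periodic isOpen_univ hφ.periodic)) (hcut n i₁)
    obtain ⟨ib, eb⟩ := integral_periodCutoff_mul
      (hpm (heightCutoff n) p₂ (w₂.periodic isOpen_univ hφ.periodic)) (hcut n i₂)
    obtain ⟨ic, ec⟩ := integral_periodCutoff_mul
      (hpm (heightCutoff n) hLper hφ.periodic) (hcut n i₃)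
    obtain ⟨id, ed⟩ := integral_deriv_periodCutoff_mul
      (hpm (heightCutoff n) p₁ hφ.periodic) (hcut n i₄)
    obtain ⟨ie, ee⟩ := integral_periodCutoff_mul
      (hpm (deriv (heightCutoff n)) p₂ hφ.periodic) (hdcut n i₅)
    have m₁ := integrable_mul_of_compactSupport w₁.1
      (continuous_fderiv_apply (test s₁).1 (1, 0)) ((test s₁).2.fderiv_apply ℝ _)
      (by simp [strip_univ])
    have m₂ := integrable_mul_of_compactSupport w₂.1
      (continuous_fderiv_apply (test s₂).1 (0, 1)) ((test s₂).2.fderiv_apply ℝ _)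
      (by simp [strip_univ])
    simp only [fderiv_cutoff_mul hχd hζd (s₁.differentiable (by simp)),
      fderiv_cutoff_mul hχd hζd (s₂.differentiable (by simp)), one_mul, zero_mul, mul_zero,
      add_zero, zero_add] at m₁ m₂
    have hsum := integral_add m₁ m₂
    rw [t₁, t₂] at hsum
    have e1 : ∀ p, φ p * (deriv periodCutoff p.1 * (heightCutoff n p.2 * e₁ p) +
        periodCutoff p.1 * (heightCutoff n p.2 * fderiv ℝ e₁ p (1, 0))) +
        φ p * (periodCutoff p.1 * (deriv (heightCutoff n) p.2 * e₂ p) +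
        periodCutoff p.1 * (heightCutoff n p.2 * fderiv ℝ e₂ p (0, 1))) =
        (deriv periodCutoff p.1 * (heightCutoff n p.2 * (e₁ p * φ p)) +
        periodCutoff p.1 * (deriv (heightCutoff n) p.2 * (e₂ p * φ p))) -
        periodCutoff p.1 * (heightCutoff n p.2 * (L p * φ p)) := fun p => by
      have := hΔ p
      linear_combination φ p * periodCutoff p.1 * heightCutoff n p.2 * this
    simp only [e1] at hsum
    have ide : Integrable fun p : ℝ × ℝ =>
        deriv periodCutoff p.1 * (heightCutoff n p.2 * (e₁ p * φ p)) +
        periodCutoff p.1 * (deriv (heightCutoff n) p.2 * (e₂ p * φ p)) := id.add ie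
    rw [integral_sub ide ic, integral_add id ie, ed, ee, ec] at hsum
    have c₁ : ∫ p, φ₁ p * (periodCutoff p.1 * (heightCutoff n p.2 * e₁ p)) =
        ∫ p in cell univ, heightCutoff n p.2 * (e₁ p * φ₁ p) := by
      rw [← ea]
      exact integral_congr_ae (.of_forall fun p => by ring)
    have c₂ : ∫ p, φ₂ p * (periodCutoff p.1 * (heightCutoff n p.2 * e₂ p)) =
        ∫ p in cell univ, heightCutoff n p.2 * (e₂ p * φ₂ p) := by
      rw [← eb]
      exact integral_congr_ae (.of_forall fun p => by ring)
    rw [c₁, c₂] at hsum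
    linarith
  -- passage to the limit
  have lim : ∀ {F : ℝ × ℝ → ℝ}, IntegrableOn F (cell univ) →
      Tendsto (fun n => ∫ p in cell univ, heightCutoff n p.2 * F p) atTop
        (𝓝 (∫ p in cell univ, F p)) := by
    intro F hF
    refine tendsto_integral_of_dominated_convergence (fun p => |F p|)
      (fun n => (hcut n hF).aestronglyMeasurable) hF.abs (fun n => .of_forall fun p => ?_)
      (.of_forall fun p => ?_)
    · rw [Real.norm_eq_abs, abs_mul]
      exact mul_le_of_le_one_left (abs_nonneg _) (abs_heightCutoff_le n _)
    · simpa using (tendsto_heightCutoff p.2).mul_const (F p)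
  have lim0 : Tendsto (fun n => ∫ p in cell univ, deriv (heightCutoff n) p.2 * (e₂ p * φ p)) atTop
      (𝓝 0) := by
    have hz : Tendsto (fun n : ℕ => K * (1 / ((n : ℝ) + 1)) * ∫ p in cell univ, |e₂ p * φ p|) atTop
        (𝓝 0) := by
      simpa using (tendsto_one_div_add_atTop_nhds_zero_nat.const_mul K).mul_const
        (∫ p in cell univ, |e₂ p * φ p|)
    refine squeeze_zero_norm (fun n => ?_) hz
    rw [← integral_const_mul]
    refine norm_integral_le_of_norm_le (i₅.abs.const_mul _) (.of_forall fun p => ?_)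
    rw [Real.norm_eq_abs, abs_mul]
    exact mul_le_mul_of_nonneg_right (hK n _) (abs_nonneg _)
  have hlim := tendsto_nhds_unique (((lim i₁).add (lim i₂)).congr key) ((lim i₃).sub lim0)
  rw [sub_zero] at hlim
  rw [← hlim, ← integral_add i₁ i₂]
  refine integral_congr_ae ?_
  have d₁ := (hasWeakDeriv_of_contDiffOn (isOpen_strip isOpen_univ) he.contDiffOn
    (1, 0)).weakDeriv_ae_eq (isOpen_strip isOpen_univ)
  have d₂ := (hasWeakDeriv_of_contDiffOn (isOpen_strip isOpen_univ) he.contDiffOn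
    (0, 1)).weakDeriv_ae_eq (isOpen_strip isOpen_univ)
  filter_upwards [ae_restrict_cell d₁, ae_restrict_cell d₂] with p h1 h2
  rw [D₁, D₂, h1, h2, one_mul, one_mul]

/-! ### Eigenvalue problems with a complete system of eigenvectors -/

section Spectral

variable {H V σ : Type*} [NormedAddCommGroup H] [InnerProductSpace ℝ H]
  [AddCommGroup V] [Module ℝ V] {a : LinearMap.BilinForm ℝ V} {j : V →ₗ[ℝ] H}
  {E : σ → Submodule ℝ V} {lam : σ → ℝ} {u : H}

/-- A symmetric nonnegative form `a` on `V`, a linear map `j` from `V` into the orthogonal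
complement of a vector `u` of a Hilbert space, and finite-dimensional spaces `E n` of eigenvectors
for distinct eigenvalues `lam n`, whose images under `j` are complete in the orthogonal complement
of `u`. -/
structure CompleteEigensystem (a : LinearMap.BilinForm ℝ V) (j : V →ₗ[ℝ] H)
    (E : σ → Submodule ℝ V) (lam : σ → ℝ) (u : H) : Prop where
  symm : ∀ ψ φ, a ψ φ = a φ ψ
  nonneg : ∀ ψ, 0 ≤ a ψ ψ
  finite : ∀ n, FiniteDimensional ℝ (E n)
  eigen : ∀ n, ∀ e ∈ E n, ∀ φ, a e φ = lam n * inner ℝ (j e) (j φ)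
  injective : Function.Injective lam
  orthogonal : ∀ ψ, inner ℝ (j ψ) u = 0
  complete : ∀ v, inner ℝ v u = 0 → (∀ n, ∀ e ∈ E n, inner ℝ v (j e) = 0) → v = 0

namespace CompleteEigensystem

theorem inner_eq_zero_of_ne (h : CompleteEigensystem a j E lam u) {l : ℝ} {ψ : V}
    (hψ : ∀ φ, a ψ φ = l * inner ℝ (j ψ) (j φ)) {n : σ} (hn : l ≠ lam n) {e : V} (he : e ∈ E n) :
    inner ℝ (j ψ) (j e) = 0 := by
  have h1 := hψ e
  rw [h.symm, h.eigen n e he, real_inner_comm] at h1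
  have h2 : (l - lam n) * inner ℝ (j ψ) (j e) = 0 := by linarith
  exact (mul_eq_zero.1 h2).resolve_left (sub_ne_zero.2 hn)

theorem eq_zero_of_forall_ne (h : CompleteEigensystem a j E lam u) {l : ℝ} {ψ : V}
    (hψ : ∀ φ, a ψ φ = l * inner ℝ (j ψ) (j φ)) (hl : ∀ n, l ≠ lam n) : j ψ = 0 :=
  h.complete _ (h.orthogonal ψ) fun n _ he => h.inner_eq_zero_of_ne hψ (hl n) he

theorem inner_eq_zero (h : CompleteEigensystem a j E lam u) {n m : σ} (hnm : n ≠ m) {e e' : V}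
    (he : e ∈ E n) (he' : e' ∈ E m) : inner ℝ (j e) (j e') = 0 :=
  h.inner_eq_zero_of_ne (h.eigen n e he) (h.injective.ne hnm) he'

/-- The orthogonal projection onto the image of one eigenspace. -/
theorem exists_projection (h : CompleteEigensystem a j E lam u) (v : H) (n : σ) :
    ∃ e ∈ E n, ∀ e' ∈ E n, inner ℝ (v - j e) (j e') = 0 := by
  have := h.finite n
  have : FiniteDimensional ℝ ((E n).map j) := inferInstance
  obtain ⟨e, he, hej⟩ := Submodule.mem_map.1 (((E n).map j).starProjection_apply_mem v)
  refine ⟨e, he, fun e' he' => ?_⟩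
  rw [hej, real_inner_comm]
  exact Submodule.inner_right_of_mem_orthogonal (Submodule.mem_map_of_mem he')
    (Submodule.sub_starProjection_mem_orthogonal v)

theorem exists_mem_of_eigen (h : CompleteEigensystem a j E lam u) {n : σ} {ψ : V}
    (hψ : ∀ φ, a ψ φ = lam n * inner ℝ (j ψ) (j φ)) : ∃ e ∈ E n, j ψ = j e := by
  obtain ⟨e, he, hp⟩ := h.exists_projection (j ψ) n
  refine ⟨e, he, sub_eq_zero.1 (h.complete _ ?_ fun m e' he' => ?_)⟩
  · rw [inner_sub_left, h.orthogonal, h.orthogonal, sub_zero]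
  · by_cases hnm : n = m
    · subst hnm
      exact hp e' he'
    · rw [inner_sub_left, h.inner_eq_zero_of_ne hψ (h.injective.ne hnm) he',
        h.inner_eq_zero hnm he he', sub_zero]

variable [CompleteSpace H]

/-- The images of the eigenspaces span a dense subspace of the orthogonal complement of `u`. -/
theorem mem_closure (h : CompleteEigensystem a j E lam u) {v : H} (hv : inner ℝ v u = 0) :
    v ∈ (⨆ n, (E n).map j).topologicalClosure := by
  set K := (⨆ n, (E n).map j).topologicalClosure with hK
  have hKu : K ≤ (ℝ ∙ u)ᗮ := by
    refine Submodule.topologicalClosure_minimal _ (iSup_le fun n => ?_)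
      (Submodule.isClosed_orthogonal _)
    rintro _ ⟨e, -, rfl⟩
    rw [Submodule.mem_orthogonal_singleton_iff_inner_left]
    exact h.orthogonal e
  have : CompleteSpace K := (Submodule.isClosed_topologicalClosure _).completeSpace_coe
  have h0 : v - K.starProjection v = 0 := by
    refine h.complete _ ?_ fun n e he => ?_
    · rw [inner_sub_left, hv, Submodule.mem_orthogonal_singleton_iff_inner_left.1
        (hKu (K.starProjection_apply_mem v)), sub_zero]
    · rw [real_inner_comm]
      refine Submodule.inner_right_of_mem_orthogonal ?_
        (K.sub_starProjection_mem_orthogonal v)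
      exact Submodule.le_topologicalClosure _ (Submodule.mem_iSup_of_mem n
        (Submodule.mem_map_of_mem he))
  rw [sub_eq_zero.1 h0]
  exact K.starProjection_apply_mem v

/-- Coercivity: if all eigenvalues other than `lam n₀` are at least `Λ`, then `a ≥ Λ` on the
orthogonal complement of the eigenspace of `lam n₀`. The projection of `ψ` to finitely many
eigenspaces satisfies the inequality, and these projections exhaust the norm of `j ψ`. -/
theorem le_form (h : CompleteEigensystem a j E lam u) {Λ : ℝ} (hΛ : 0 ≤ Λ) {n₀ : σ}
    (hlam : ∀ n, n ≠ n₀ → Λ ≤ lam n) {ψ : V}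
    (hψ : ∀ e ∈ E n₀, inner ℝ (j ψ) (j e) = 0) :
    Λ * inner ℝ (j ψ) (j ψ) ≤ a ψ ψ := by
  classical
  set v := j ψ with hv
  choose e he hp using h.exists_projection v
  have hpe : ∀ n, inner ℝ v (j (e n)) = inner ℝ (j (e n)) (j (e n)) := fun n => by
    have := hp n (e n) (he n)
    rwa [inner_sub_left, sub_eq_zero] at this
  have hn0 : inner ℝ (j (e n₀)) (j (e n₀)) = 0 := by rw [← hpe, hψ _ (he n₀)]
  have hsq : ∀ s : Finset σ, inner ℝ (∑ n ∈ s, j (e n)) (∑ n ∈ s, j (e n)) =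
      ∑ n ∈ s, inner ℝ (j (e n)) (j (e n)) := fun s => by
    rw [sum_inner]
    refine Finset.sum_congr rfl fun n hn => ?_
    rw [inner_sum]
    exact Finset.sum_eq_single_of_mem n hn fun m _ hmn =>
      h.inner_eq_zero (Ne.symm hmn) (he n) (he m)
  -- the form bounds the contribution of finitely many eigenspaces
  have hle : ∀ s : Finset σ, Λ * ∑ n ∈ s, inner ℝ (j (e n)) (j (e n)) ≤ a ψ ψ := by
    intro s
    have h0 := h.nonneg (ψ - ∑ n ∈ s, e n)
    have h1 : ∀ φ, a (∑ n ∈ s, e n) φ = ∑ n ∈ s, lam n * inner ℝ (j (e n)) (j φ) := fun φ => by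
      rw [map_sum, LinearMap.sum_apply]
      exact Finset.sum_congr rfl fun n _ => h.eigen n _ (he n) φ
    have h2 : a (∑ n ∈ s, e n) ψ = ∑ n ∈ s, lam n * inner ℝ (j (e n)) (j (e n)) := by
      rw [h1]
      exact Finset.sum_congr rfl fun n _ => by rw [real_inner_comm, ← hv, hpe]
    have h3 : a (∑ n ∈ s, e n) (∑ n ∈ s, e n) =
        ∑ n ∈ s, lam n * inner ℝ (j (e n)) (j (e n)) := by
      rw [h1]
      refine Finset.sum_congr rfl fun n hn => ?_
      rw [map_sum, inner_sum, Finset.sum_eq_single_of_mem n hn fun m _ hmn =>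
        h.inner_eq_zero (Ne.symm hmn) (he n) (he m)]
    simp only [map_sub, LinearMap.sub_apply] at h0
    rw [h.symm ψ (∑ n ∈ s, e n), h2, h3] at h0
    have h4 : Λ * ∑ n ∈ s, inner ℝ (j (e n)) (j (e n)) ≤
        ∑ n ∈ s, lam n * inner ℝ (j (e n)) (j (e n)) := by
      rw [Finset.mul_sum]
      refine Finset.sum_le_sum fun n _ => ?_
      by_cases hn : n = n₀
      · subst hn
        rw [hn0, mul_zero, mul_zero]
      · exact mul_le_mul_of_nonneg_right (hlam n hn) real_inner_self_nonneg
    linarith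
  -- these contributions exhaust the norm
  have happ : ∀ δ > 0, Λ * inner ℝ v v ≤ a ψ ψ + Λ * δ ^ 2 := by
    intro δ hδ
    obtain ⟨w, hw, hwv⟩ := Metric.mem_closure_iff.1 (h.mem_closure (h.orthogonal ψ)) δ hδ
    obtain ⟨s, hs⟩ := Submodule.mem_iSup_iff_exists_finset.1 hw
    set q := ∑ n ∈ s, j (e n) with hq
    have hqorth : ∀ n ∈ s, ∀ e' ∈ E n, inner ℝ (v - q) (j e') = 0 := by
      intro n hn e' he'
      have : inner ℝ q (j e') = inner ℝ (j (e n)) (j e') := by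
        rw [hq, sum_inner]
        exact Finset.sum_eq_single_of_mem n hn fun m _ hmn => h.inner_eq_zero hmn (he m) he'
      rw [inner_sub_left, this, ← inner_sub_left]
      exact hp n e' he'
    have hperp : ∀ z ∈ ⨆ n ∈ s, (E n).map j, inner ℝ (v - q) z = 0 := by
      have : (⨆ n ∈ s, (E n).map j) ≤ (ℝ ∙ (v - q))ᗮ := by
        refine iSup₂_le fun n hn => ?_
        rintro _ ⟨e', he', rfl⟩
        rw [Submodule.mem_orthogonal_singleton_iff_inner_right]
        exact hqorth n hn e' he'
      exact fun z hz => Submodule.mem_orthogonal_singleton_iff_inner_right.1 (this hz)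
    have hqmem : q ∈ ⨆ n ∈ s, (E n).map j := Submodule.sum_mem _ fun n hn =>
      Submodule.mem_iSup_of_mem n (Submodule.mem_iSup_of_mem hn (Submodule.mem_map_of_mem (he n)))
    have h1 : inner ℝ v v = inner ℝ (v - q) (v - q) + inner ℝ q q := by
      have := hperp q hqmem
      rw [inner_sub_left] at this
      rw [inner_sub_left, inner_sub_right, inner_sub_right, real_inner_comm v q]
      linarith
    have h2 : inner ℝ (v - q) (v - q) ≤ inner ℝ (v - w) (v - w) := by
      have h3 := hperp (q - w) (Submodule.sub_mem _ hqmem hs)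
      have h4 : v - w = (v - q) + (q - w) := by abel
      rw [h4, inner_add_left, inner_add_right, inner_add_right, h3,
        real_inner_comm (v - q) (q - w), h3]
      linarith [real_inner_self_nonneg (x := q - w)]
    have h3 : inner ℝ (v - w) (v - w) ≤ δ ^ 2 := by
      rw [real_inner_self_eq_norm_sq, ← dist_eq_norm]
      gcongr
    have h4 := hle s
    rw [← hsq s] at h4
    have h5 : Λ * inner ℝ (v - q) (v - q) ≤ Λ * δ ^ 2 :=
      mul_le_mul_of_nonneg_left (h2.trans h3) hΛ
    rw [h1, mul_add]
    linarith
  have hlim : Tendsto (fun δ : ℝ => a ψ ψ + Λ * δ ^ 2) (𝓝[>] 0) (𝓝 (a ψ ψ)) := by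
    have : Continuous fun δ : ℝ => a ψ ψ + Λ * δ ^ 2 := by fun_prop
    simpa using (this.tendsto 0).mono_left nhdsWithin_le_nhds
  exact ge_of_tendsto hlim (by filter_upwards [self_mem_nhdsWithin] with δ hδ using happ δ hδ)

end CompleteEigensystem

end Spectral

/-! ### Legendre polynomials -/

open Polynomial in
/-- Repeated differentiation of `(1 - X²) u' + 2nX u = 0`, where `u = (X² - 1)ⁿ`. -/
theorem iterate_derivative_sq_sub_one_pow (n m : ℕ) :
    (1 - X ^ 2) * derivative^[m + 2] ((X ^ 2 - 1 : ℝ[X]) ^ n) +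
      C (2 * n - 2 - 2 * m : ℝ) * X * derivative^[m + 1] ((X ^ 2 - 1 : ℝ[X]) ^ n) +
      C (2 * n + m * (2 * n - 2) - m * (m - 1) : ℝ) * derivative^[m] ((X ^ 2 - 1 : ℝ[X]) ^ n)
        = 0 := by
  induction m with
  | zero =>
    have h1 : (1 - X ^ 2) * derivative ((X ^ 2 - 1 : ℝ[X]) ^ n) +
        C (2 * n : ℝ) * X * (X ^ 2 - 1 : ℝ[X]) ^ n = 0 := by
      cases n with
      | zero => simp
      | succ n =>
        rw [derivative_pow_succ]
        simp only [derivative_sub, derivative_X_pow, derivative_one, map_natCast, map_mul,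
          map_ofNat]
        push_cast
        simp
        ring
    have h2 := congrArg derivative h1
    simp only [derivative_add, derivative_mul, derivative_sub, derivative_one, derivative_X_pow,
      derivative_C, derivative_X, derivative_zero] at h2
    simp only [Function.iterate_succ_apply', Function.iterate_zero_apply, Nat.cast_zero]
    simp only [map_sub, map_add, map_mul, map_zero, map_natCast, map_ofNat, map_one] at h2 ⊢
    linear_combination h2
  | succ m ih =>
    have h2 := congrArg derivative ih
    simp only [derivative_add, derivative_mul, derivative_sub, derivative_one, derivative_X_pow,
      derivative_C, derivative_X, derivative_zero] at h2
    simp only [Function.iterate_succ_apply'] at h2 ⊢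
    simp only [map_sub, map_add, map_mul, map_natCast, map_ofNat, map_one, Nat.cast_add,
      Nat.cast_one] at h2 ⊢
    linear_combination h2

open Polynomial in
theorem iterate_derivative_legendre (n k : ℕ) :
    derivative^[k] (legendre n) =
      C (1 / (2 ^ n * (n.factorial : ℝ))) * derivative^[k + n] ((X ^ 2 - 1) ^ n) := by
  rw [legendre, iterate_derivative_C_mul, Function.iterate_add_apply]

open Polynomial in
/-- The differential equation of the `k`-th derivative of `L_n`. -/
theorem legendre_ode (n k : ℕ) (s : ℝ) :
    (1 - s ^ 2) * (derivative^[k + 2] (legendre n)).eval s -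
      2 * (k + 1) * s * (derivative^[k + 1] (legendre n)).eval s +
      (n * (n + 1) - k * (k + 1)) * (derivative^[k] (legendre n)).eval s = 0 := by
  have h := congrArg (eval s) (iterate_derivative_sq_sub_one_pow n (k + n))
  simp only [eval_add, eval_mul, eval_sub, eval_one, eval_pow, eval_X, eval_C, eval_zero] at h
  simp only [iterate_derivative_legendre, eval_mul, eval_C]
  rw [show k + 2 + n = k + n + 2 by ring, show k + 1 + n = k + n + 1 by ring]
  push_cast at h
  linear_combination (1 / (2 ^ n * (n.factorial : ℝ))) * h

open Polynomial in
theorem degree_iterate_derivative_real {p : ℝ[X]} (hp : p ≠ 0) {k : ℕ} (hk : k ≤ p.natDegree) :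
    (derivative^[k] p).degree = (p.natDegree - k : ℕ) := by
  induction k with
  | zero => simpa using degree_eq_natDegree hp
  | succ k ih =>
    have h1 := ih (by omega)
    have h2 := natDegree_eq_of_degree_eq_some h1
    rw [Function.iterate_succ_apply', degree_derivative (by omega), h2]
    congr 1

open Polynomial in
theorem degree_legendre (n : ℕ) : (legendre n).degree = n := by
  have h1 : (X ^ 2 - 1 : ℝ[X]).Monic := by
    simpa using monic_X_pow_sub_C (1 : ℝ) (n := 2) (by norm_num)
  have h2 : (X ^ 2 - 1 : ℝ[X]).natDegree = 2 := by
    simpa using natDegree_X_pow_sub_C (n := 2) (r := (1 : ℝ))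
  have h3 : ((X ^ 2 - 1 : ℝ[X]) ^ n).natDegree = n * 2 := by rw [natDegree_pow, h2]
  rw [legendre, degree_C_mul (by positivity), degree_iterate_derivative_real
    (h1.pow n).ne_zero (by omega), h3]
  congr 1
  omega

theorem legendre_ne_zero (n : ℕ) : legendre n ≠ 0 := by
  intro h
  have h1 := degree_legendre n
  rw [h, Polynomial.degree_zero] at h1
  exact WithBot.natCast_ne_bot n h1.symm

open Polynomial in
/-- The `k`-th derivatives of `L_k, L_{k+1}, …`, of degrees `0, 1, …`. -/
def legendreSequence (k : ℕ) : Polynomial.Sequence ℝ where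
  elems' i := derivative^[k] (legendre (i + k))
  degree_eq' i := by
    have h1 := degree_legendre (i + k)
    have h2 := natDegree_eq_of_degree_eq_some h1
    rw [degree_iterate_derivative_real (legendre_ne_zero _) (by omega), h2,
      Nat.add_sub_cancel]

open Polynomial in
theorem mem_span_iterate_derivative_legendre (k : ℕ) (p : ℝ[X]) :
    p ∈ Submodule.span ℝ (range fun i => derivative^[k] (legendre (i + k))) := by
  have h := (legendreSequence k).span fun i =>
    (leadingCoeff_ne_zero.2 ((legendreSequence k).ne_zero i)).isUnit
  have : p ∈ (⊤ : Submodule ℝ ℝ[X]) := trivial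
  rw [← h] at this
  exact this

open Polynomial in
theorem legendre_one : legendre 1 = X := by
  have h : derivative ((X ^ 2 - 1 : ℝ[X]) ^ 1) = C 2 * X := by
    simp [one_add_one_eq_two]
  rw [legendre, Function.iterate_one, h, ← mul_assoc, ← C_mul]
  norm_num

/-! ### Completeness of the spherical harmonics -/

/-- The unit sphere of `ℂ × ℝ`, with points `(z, γ)`. -/
def unitSphere : Set (ℂ × ℝ) := {w | Complex.normSq w.1 + w.2 ^ 2 = 1}

theorem isCompact_unitSphere : IsCompact unitSphere := by
  refine Metric.isCompact_of_isClosed_isBounded ?_ ?_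
  · exact isClosed_eq (by fun_prop) continuous_const
  · refine (Metric.isBounded_closedBall (x := (0 : ℂ × ℝ)) (r := 1)).subset fun w hw => ?_
    rw [mem_closedBall_zero_iff, Prod.norm_def, max_le_iff]
    have h : Complex.normSq w.1 + w.2 ^ 2 = 1 := hw
    rw [Complex.normSq_eq_norm_sq] at h
    constructor
    · exact (sq_le_one_iff₀ (norm_nonneg _)).1 (by nlinarith [sq_nonneg w.2])
    · rw [Real.norm_eq_abs]
      exact (sq_le_one_iff_abs_le_one _).1 (by nlinarith [sq_nonneg ‖w.1‖])

/-- The function `q(γ) Re(c zᵏ)` of `(z, γ)`. -/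
def sphericalFun (q : Polynomial ℝ) (k : ℕ) (c : ℂ) (w : ℂ × ℝ) : ℝ :=
  q.eval w.2 * (c * w.1 ^ k).re

theorem continuous_sphericalFun (q : Polynomial ℝ) (k : ℕ) (c : ℂ) :
    Continuous (sphericalFun q k c) := by
  have : Continuous fun w : ℂ × ℝ => q.eval w.2 := q.continuous.comp continuous_snd
  unfold sphericalFun
  fun_prop

/-- The span of the functions `q(γ) Re(c zᵏ)`. -/
def sphericalSpan : Submodule ℝ (ℂ × ℝ → ℝ) :=
  Submodule.span ℝ {F | ∃ q k c, F = sphericalFun q k c}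

theorem sphericalFun_mem_span (q : Polynomial ℝ) (k : ℕ) (c : ℂ) :
    sphericalFun q k c ∈ sphericalSpan := Submodule.subset_span ⟨q, k, c, rfl⟩

/-- The functions whose products with elements of `sphericalSpan` agree on the sphere with
elements of `sphericalSpan`. -/
def IsSphericalMultiplier (g : ℂ × ℝ → ℝ) : Prop :=
  ∀ F ∈ sphericalSpan, ∃ F' ∈ sphericalSpan, ∀ w ∈ unitSphere, g w * F w = F' w

theorem isSphericalMultiplier_of_generators {g : ℂ × ℝ → ℝ}
    (h : ∀ q k c, ∃ F' ∈ sphericalSpan, ∀ w ∈ unitSphere, g w * sphericalFun q k c w = F' w) :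
    IsSphericalMultiplier g := by
  intro F hF
  induction hF using Submodule.span_induction with
  | mem F hF =>
    obtain ⟨q, k, c, rfl⟩ := hF
    exact h q k c
  | zero => exact ⟨0, Submodule.zero_mem _, fun w _ => by simp⟩
  | add F₁ F₂ _ _ h₁ h₂ =>
    obtain ⟨G₁, hG₁, e₁⟩ := h₁
    obtain ⟨G₂, hG₂, e₂⟩ := h₂
    exact ⟨G₁ + G₂, Submodule.add_mem _ hG₁ hG₂, fun w hw => by
      rw [Pi.add_apply, mul_add, e₁ w hw, e₂ w hw, Pi.add_apply]⟩
  | smul r F _ h =>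
    obtain ⟨G, hG, e⟩ := h
    exact ⟨r • G, Submodule.smul_mem _ r hG, fun w hw => by
      rw [Pi.smul_apply, Pi.smul_apply, ← e w hw, smul_eq_mul, smul_eq_mul]; ring⟩

theorem isSphericalMultiplier_snd : IsSphericalMultiplier fun w => w.2 :=
  isSphericalMultiplier_of_generators fun q k c =>
    ⟨sphericalFun (Polynomial.X * q) k c, sphericalFun_mem_span _ _ _, fun w _ => by
      simp [sphericalFun, mul_assoc]⟩

/-- Multiplication by `Re(d z)`: the product with `Re(c zᵏ)` splits into harmonics of order
`k + 1` and `k - 1`, because `|z|² = 1 - γ²` on the sphere. -/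
theorem isSphericalMultiplier_re (d : ℂ) : IsSphericalMultiplier fun w => (d * w.1).re := by
  refine isSphericalMultiplier_of_generators fun q k c => ?_
  cases k with
  | zero =>
    refine ⟨sphericalFun q 1 (c.re * d), sphericalFun_mem_span _ _ _, fun w _ => ?_⟩
    simp [sphericalFun]
    ring
  | succ k =>
    refine ⟨sphericalFun q (k + 2) (c * d / 2) + sphericalFun ((1 - Polynomial.X ^ 2) * q) k
      (c * (starRingEnd ℂ) d / 2), Submodule.add_mem _ (sphericalFun_mem_span _ _ _)
      (sphericalFun_mem_span _ _ _), fun w hw => ?_⟩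
    have hw' : Complex.normSq w.1 = 1 - w.2 ^ 2 := eq_sub_of_add_eq hw
    have h1 : ∀ a b : ℂ, a.re * b.re = (a * b / 2).re + (a * (starRingEnd ℂ) b / 2).re := by
      intro a b
      simp
      ring
    have h2 : c * w.1 ^ (k + 1) * (starRingEnd ℂ) (d * w.1) / 2 =
        ((1 - w.2 ^ 2 : ℝ) : ℂ) * (c * (starRingEnd ℂ) d / 2 * w.1 ^ k) := by
      rw [← hw', Complex.normSq_eq_conj_mul_self, map_mul]
      ring
    have h3 : c * w.1 ^ (k + 1) * (d * w.1) / 2 = c * d / 2 * w.1 ^ (k + 2) := by ring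
    have h4 := h1 (c * w.1 ^ (k + 1)) (d * w.1)
    rw [h2, h3, Complex.re_ofReal_mul] at h4
    simp only [sphericalFun, Pi.add_apply, Polynomial.eval_mul, Polynomial.eval_sub,
      Polynomial.eval_one, Polynomial.eval_pow, Polynomial.eval_X]
    linear_combination q.eval w.2 * h4

/-- The algebra of polynomial functions of `(z, γ)`. -/
def coordinateAlgebra : Subalgebra ℝ C(ℂ × ℝ, ℝ) :=
  Algebra.adjoin ℝ {⟨fun w => w.2, by fun_prop⟩, ⟨fun w => (1 * w.1).re, by fun_prop⟩,
    ⟨fun w => (-Complex.I * w.1).re, by fun_prop⟩}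

theorem separatesPoints_coordinateAlgebra : coordinateAlgebra.SeparatesPoints := by
  intro x y hxy
  by_contra hcon
  push Not at hcon
  refine hxy ?_
  have h : ∀ f ∈ coordinateAlgebra, f x = f y := fun f hf =>
    hcon (f : ℂ × ℝ → ℝ) ⟨f, hf, rfl⟩
  have h1 := h _ (Algebra.subset_adjoin (.inl rfl))
  have h2 := h _ (Algebra.subset_adjoin (.inr (.inl rfl)))
  have h3 := h _ (Algebra.subset_adjoin (.inr (.inr rfl)))
  refine Prod.ext (Complex.ext ?_ ?_) h1
  · simpa using h2
  · simpa using h3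

theorem isSphericalMultiplier_of_mem {g : C(ℂ × ℝ, ℝ)} (hg : g ∈ coordinateAlgebra) :
    IsSphericalMultiplier g := by
  induction hg using Algebra.adjoin_induction with
  | mem g hg =>
    rcases hg with rfl | rfl | rfl
    · exact isSphericalMultiplier_snd
    · exact isSphericalMultiplier_re _
    · exact isSphericalMultiplier_re _
  | algebraMap r =>
    exact fun F hF => ⟨r • F, Submodule.smul_mem _ r hF, fun w _ => by simp⟩
  | add g₁ g₂ _ _ h₁ h₂ =>
    intro F hF
    obtain ⟨G₁, hG₁, e₁⟩ := h₁ F hF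
    obtain ⟨G₂, hG₂, e₂⟩ := h₂ F hF
    exact ⟨G₁ + G₂, Submodule.add_mem _ hG₁ hG₂, fun w hw => by
      rw [ContinuousMap.add_apply, add_mul, e₁ w hw, e₂ w hw, Pi.add_apply]⟩
  | mul g₁ g₂ _ _ h₁ h₂ =>
    intro F hF
    obtain ⟨G₂, hG₂, e₂⟩ := h₂ F hF
    obtain ⟨G₁, hG₁, e₁⟩ := h₁ G₂ hG₂
    exact ⟨G₁, hG₁, fun w hw => by
      rw [ContinuousMap.mul_apply, mul_assoc, e₂ w hw, e₁ w hw]⟩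

section

variable {A : Type*} [MeasurableSpace A] {μ : Measure A} {G : A → ℂ × ℝ} {h : A → ℝ}

theorem integrable_mul_comp_sphere (hG : Measurable G) (hGs : ∀ᵐ p ∂μ, G p ∈ unitSphere)
    (hh : Integrable h μ) {F : ℂ × ℝ → ℝ} (hF : Continuous F) :
    Integrable (fun p => h p * F (G p)) μ := by
  obtain ⟨C, hC⟩ := isCompact_unitSphere.exists_bound_of_continuousOn hF.continuousOn
  refine hh.mul_bdd (c := C) (hF.measurable.comp hG).aestronglyMeasurable ?_
  filter_upwards [hGs] with p hp using hC _ hp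

theorem integral_mul_eq_zero_of_mem_span (hG : Measurable G)
    (hGs : ∀ᵐ p ∂μ, G p ∈ unitSphere) (hh : Integrable h μ)
    (h0 : ∀ q k c, ∫ p, h p * sphericalFun q k c (G p) ∂μ = 0) {F : ℂ × ℝ → ℝ}
    (hF : F ∈ sphericalSpan) : Continuous F ∧ ∫ p, h p * F (G p) ∂μ = 0 := by
  induction hF using Submodule.span_induction with
  | mem F hF =>
    obtain ⟨q, k, c, rfl⟩ := hF
    exact ⟨continuous_sphericalFun q k c, h0 q k c⟩
  | zero => exact ⟨continuous_zero, by simp⟩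
  | add F₁ F₂ _ _ h₁ h₂ =>
    refine ⟨h₁.1.add h₂.1, ?_⟩
    simp only [Pi.add_apply, mul_add]
    rw [integral_add (integrable_mul_comp_sphere hG hGs hh h₁.1)
      (integrable_mul_comp_sphere hG hGs hh h₂.1), h₁.2, h₂.2, add_zero]
  | smul r F _ hF =>
    refine ⟨hF.1.const_smul r, ?_⟩
    simp only [Pi.smul_apply, smul_eq_mul, mul_left_comm, integral_const_mul, hF.2, mul_zero]

theorem integral_mul_eq_zero_of_continuous (hG : Measurable G)
    (hGs : ∀ᵐ p ∂μ, G p ∈ unitSphere) (hh : Integrable h μ)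
    (h0 : ∀ q k c, ∫ p, h p * sphericalFun q k c (G p) ∂μ = 0) {F : ℂ × ℝ → ℝ}
    (hF : Continuous F) : ∫ p, h p * F (G p) ∂μ = 0 := by
  have hA : ∀ g ∈ coordinateAlgebra, ∫ p, h p * g (G p) ∂μ = 0 := by
    intro g hg
    obtain ⟨F', hF', e⟩ := isSphericalMultiplier_of_mem hg _ (sphericalFun_mem_span 1 0 1)
    rw [← (integral_mul_eq_zero_of_mem_span hG hGs hh h0 hF').2]
    refine integral_congr_ae ?_
    filter_upwards [hGs] with p hp
    rw [← e _ hp]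
    simp [sphericalFun]
  have hb : ∀ δ > 0, |∫ p, h p * F (G p) ∂μ| ≤ δ * ∫ p, |h p| ∂μ := by
    intro δ hδ
    obtain ⟨g, hg, hgF⟩ :=
      ContinuousMap.exists_mem_subalgebra_near_continuous_of_isCompact_of_separatesPoints
        separatesPoints_coordinateAlgebra ⟨F, hF⟩ isCompact_unitSphere hδ
    have e : ∫ p, h p * F (G p) ∂μ = ∫ p, (h p * F (G p) - h p * g (G p)) ∂μ := by
      rw [integral_sub (integrable_mul_comp_sphere hG hGs hh hF)
        (integrable_mul_comp_sphere hG hGs hh g.continuous), hA g hg, sub_zero]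
    rw [e, ← integral_const_mul, ← Real.norm_eq_abs]
    refine norm_integral_le_of_norm_le (hh.abs.const_mul δ) ?_
    filter_upwards [hGs] with p hp
    rw [← mul_sub, Real.norm_eq_abs, abs_mul, mul_comm]
    refine mul_le_mul_of_nonneg_right ?_ (abs_nonneg _)
    have := (hgF _ hp).le
    rwa [Real.norm_eq_abs, abs_sub_comm] at this
  have hlim : Tendsto (fun δ : ℝ => δ * ∫ p, |h p| ∂μ) (𝓝[>] 0) (𝓝 0) := by
    have : Continuous fun δ : ℝ => δ * ∫ p, |h p| ∂μ := by fun_prop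
    simpa using (this.tendsto 0).mono_left nhdsWithin_le_nhds
  exact abs_nonpos_iff.1 (ge_of_tendsto hlim
    (by filter_upwards [self_mem_nhdsWithin] with δ hδ using hb δ hδ))

/-- An integrable function that is orthogonal to all `q(γ) Re(c zᵏ)` vanishes, if `(z, γ)` is an
injective parametrisation of a part of the sphere. -/
theorem ae_eq_zero_of_integral_sphericalFun [StandardBorelSpace A] [Nonempty A] {S : Set A}
    (hS : MeasurableSet S) (hμS : ∀ᵐ p ∂μ, p ∈ S) (hG : Measurable G) (hinj : InjOn G S)
    (hGs : ∀ p ∈ S, G p ∈ unitSphere) (hh : Integrable h μ)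
    (h0 : ∀ q k c, ∫ p, h p * sphericalFun q k c (G p) ∂μ = 0) : h =ᵐ[μ] 0 := by
  have hGs' : ∀ᵐ p ∂μ, G p ∈ unitSphere := hμS.mono hGs
  have hSb : StandardBorelSpace S := hS.standardBorel
  have hemb : MeasurableEmbedding fun p : S => G p :=
    (hG.comp measurable_subtype_coe).measurableEmbedding fun p q hpq =>
      Subtype.ext (hinj p.2 q.2 hpq)
  obtain ⟨R, hR, hRG⟩ := hemb.exists_measurable_extend (g := fun p : S => (p : A))
    measurable_subtype_coe fun _ => inferInstance
  have hRG' : ∀ p ∈ S, R (G p) = p := fun p hp => congrFun hRG ⟨p, hp⟩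
  -- a measurable representative of `h`, transported to the sphere
  set k : A → ℝ := hh.aestronglyMeasurable.mk h with hk
  have hkm : StronglyMeasurable k := hh.aestronglyMeasurable.stronglyMeasurable_mk
  have hkh : h =ᵐ[μ] k := hh.aestronglyMeasurable.ae_eq_mk
  have hcomp : (fun p => k (R (G p))) =ᵐ[μ] h := by
    filter_upwards [hμS, hkh] with p hp hp2
    rw [hRG' p hp, hp2]
  have hkR : StronglyMeasurable fun w => k (R w) := hkm.comp_measurable hR
  have hint : Integrable (fun w => k (R w)) (μ.map G) := by
    rw [integrable_map_measure hkR.aestronglyMeasurable hG.aemeasurable]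
    exact hh.congr hcomp.symm
  have key := ae_eq_zero_of_integral_contDiff_smul_eq_zero hint.locallyIntegrable
    fun g hg _ => by
      have hm : AEStronglyMeasurable (fun w => g w • k (R w)) (μ.map G) :=
        hg.continuous.aestronglyMeasurable.smul hkR.aestronglyMeasurable
      rw [integral_map hG.aemeasurable hm,
        ← integral_mul_eq_zero_of_continuous hG hGs' hh h0 hg.continuous]
      refine integral_congr_ae ?_
      filter_upwards [hcomp] with p hp
      rw [hp, smul_eq_mul, mul_comm]
  have key2 := ae_of_ae_map hG.aemeasurable key
  filter_upwards [key2, hcomp] with p h1 h2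
  rw [← h2, h1, Pi.zero_apply]

/-- Completeness of the spherical harmonics `L_n^{(k)}(γ) Re(c zᵏ)`, `k ≤ n`. -/
theorem ae_eq_zero_of_integral_legendre [StandardBorelSpace A] [Nonempty A] {S : Set A}
    (hS : MeasurableSet S) (hμS : ∀ᵐ p ∂μ, p ∈ S) (hG : Measurable G) (hinj : InjOn G S)
    (hGs : ∀ p ∈ S, G p ∈ unitSphere) (hh : Integrable h μ)
    (h0 : ∀ n k c, k ≤ n →
      ∫ p, h p * sphericalFun (Polynomial.derivative^[k] (legendre n)) k c (G p) ∂μ = 0) :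
    h =ᵐ[μ] 0 := by
  refine ae_eq_zero_of_integral_sphericalFun hS hμS hG hinj hGs hh fun q k c => ?_
  have hGs' : ∀ᵐ p ∂μ, G p ∈ unitSphere := hμS.mono hGs
  have hq := mem_span_iterate_derivative_legendre k q
  induction hq using Submodule.span_induction with
  | mem q hq =>
    obtain ⟨i, rfl⟩ := hq
    exact h0 (i + k) k c (by omega)
  | zero => simp [sphericalFun]
  | add q₁ q₂ _ _ h₁ h₂ =>
    have e : ∀ p, h p * sphericalFun (q₁ + q₂) k c (G p) =
        h p * sphericalFun q₁ k c (G p) + h p * sphericalFun q₂ k c (G p) := fun p => by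
      simp only [sphericalFun, Polynomial.eval_add]; ring
    simp only [e]
    rw [integral_add
      (integrable_mul_comp_sphere hG hGs' hh (continuous_sphericalFun q₁ k c))
      (integrable_mul_comp_sphere hG hGs' hh (continuous_sphericalFun q₂ k c)), h₁, h₂, add_zero]
  | smul r q _ h₁ =>
    have e : ∀ p, h p * sphericalFun (r • q) k c (G p) =
        r * (h p * sphericalFun q k c (G p)) := fun p => by
      simp only [sphericalFun, Polynomial.eval_smul, smul_eq_mul]; ring
    simp only [e, integral_const_mul, h₁, mul_zero]

end

/-! ### The conformal map from the cylinder to the sphere -/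

/-- The point `(ξ_ε + i η_ε, γ_ε)` of the unit sphere. -/
def sphereMap (ε : ℝ) (p : ℝ × ℝ) : ℂ × ℝ := (⟨xiFun ε p, etaFun ε p⟩, gammaFun ε p)

/-- The conformal factor `g'(ψ_ε) / 2` of the map to the sphere. -/
def conformalFactor (ε : ℝ) (p : ℝ × ℝ) : ℝ := (1 - ε ^ 2) / (cosh p.2 + ε * cos p.1) ^ 2

theorem mul_cosh_le_denom {ε : ℝ} (hε0 : 0 ≤ ε) (p : ℝ × ℝ) :
    (1 - ε) * cosh p.2 ≤ cosh p.2 + ε * cos p.1 := by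
  have h1 := one_le_cosh p.2
  have h2 := neg_one_le_cos p.1
  nlinarith [mul_nonneg hε0 (by linarith : 0 ≤ cosh p.2 + cos p.1)]

section Geometry

variable {ε : ℝ} (hε0 : 0 ≤ ε) (hε1 : ε < 1)

include hε0 hε1

theorem one_sub_sq_pos : 0 < 1 - ε ^ 2 := by nlinarith

theorem sqrt_one_sub_sq_pos : 0 < √(1 - ε ^ 2) := sqrt_pos.2 (one_sub_sq_pos hε0 hε1)

theorem sq_sqrt_one_sub_sq : √(1 - ε ^ 2) ^ 2 = 1 - ε ^ 2 :=
  sq_sqrt (one_sub_sq_pos hε0 hε1).le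

theorem denom_pos (p : ℝ × ℝ) : 0 < cosh p.2 + ε * cos p.1 :=
  (mul_pos (by linarith) (cosh_pos _)).trans_le (mul_cosh_le_denom hε0 p)

theorem sphereMap_mem (p : ℝ × ℝ) : sphereMap ε p ∈ unitSphere := by
  have hD := (denom_pos hε0 hε1 p).ne'
  have hb := sq_sqrt_one_sub_sq hε0 hε1
  show Complex.normSq ⟨xiFun ε p, etaFun ε p⟩ + gammaFun ε p ^ 2 = 1
  rw [Complex.normSq_mk, xiFun, etaFun, gammaFun]
  field_simp
  rw [hb]
  have h1 := cosh_sq p.2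
  have h2 := sin_sq p.1
  linear_combination (1 - ε ^ 2) * h2 - (1 - ε ^ 2) * h1

theorem xi_sq_add (p : ℝ × ℝ) : xiFun ε p ^ 2 + etaFun ε p ^ 2 + gammaFun ε p ^ 2 = 1 := by
  have h : Complex.normSq ⟨xiFun ε p, etaFun ε p⟩ + gammaFun ε p ^ 2 = 1 :=
    sphereMap_mem hε0 hε1 p
  rw [Complex.normSq_mk] at h
  linarith

theorem contDiff_xiFun : ContDiff ℝ ∞ (xiFun ε) :=
  ContDiff.div (by fun_prop) (by fun_prop) fun p => (denom_pos hε0 hε1 p).ne'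

theorem contDiff_etaFun : ContDiff ℝ ∞ (etaFun ε) :=
  ContDiff.div (by fun_prop) (by fun_prop) fun p => (denom_pos hε0 hε1 p).ne'

theorem contDiff_gammaFun : ContDiff ℝ ∞ (gammaFun ε) :=
  ContDiff.div (by fun_prop) (by fun_prop) fun p => (denom_pos hε0 hε1 p).ne'

theorem contDiff_conformalFactor : ContDiff ℝ ∞ (conformalFactor ε) :=
  ContDiff.div (by fun_prop) (by fun_prop) fun p => pow_ne_zero 2 (denom_pos hε0 hε1 p).ne'

theorem conformalFactor_pos (p : ℝ × ℝ) : 0 < conformalFactor ε p :=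
  div_pos (one_sub_sq_pos hε0 hε1) (pow_pos (denom_pos hε0 hε1 p) 2)

theorem gPrime_eq (p : ℝ × ℝ) : gPrime ε p = 2 * conformalFactor ε p := by
  have hD := denom_pos hε0 hε1 p
  have hb := sqrt_one_sub_sq_pos hε0 hε1
  have h1 : -2 * log ((cosh p.2 + ε * cos p.1) / √(1 - ε ^ 2)) =
      log (((cosh p.2 + ε * cos p.1) / √(1 - ε ^ 2))⁻¹ ^ 2) := by
    rw [log_pow, log_inv]
    push_cast
    ring
  rw [gPrime, streamFunction, h1, exp_log (by positivity), conformalFactor, inv_div, div_pow,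
    sq_sqrt_one_sub_sq hε0 hε1]

/-- The conformal factor in terms of the coordinates of the sphere. -/
theorem conformalFactor_eq (p : ℝ × ℝ) : (1 - ε ^ 2) * conformalFactor ε p =
    (1 - ε * xiFun ε p) ^ 2 - (1 - ε ^ 2) * gammaFun ε p ^ 2 := by
  have hD := (denom_pos hε0 hε1 p).ne'
  have hb := sq_sqrt_one_sub_sq hε0 hε1
  rw [conformalFactor, xiFun, gammaFun]
  field_simp
  rw [hb]
  linear_combination -(1 - ε ^ 2) ^ 2 * cosh_sq p.2

theorem conformalFactor_le (p : ℝ × ℝ) :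
    conformalFactor ε p ≤ (2 / (1 - ε) * exp (-|p.2|)) ^ 2 := by
  have h1 : exp |p.2| ≤ 2 * cosh p.2 := by
    rw [← cosh_abs, cosh_eq]
    linarith [exp_pos (-|p.2|)]
  have h2 := mul_cosh_le_denom hε0 p
  have h3 : (1 - ε) / 2 * exp |p.2| ≤ cosh p.2 + ε * cos p.1 := by
    refine le_trans ?_ h2
    have : 0 < 1 - ε := by linarith
    nlinarith
  have h4 : 0 < (1 - ε) / 2 * exp |p.2| := mul_pos (by linarith) (exp_pos _)
  calc conformalFactor ε p ≤ 1 / ((1 - ε) / 2 * exp |p.2|) ^ 2 := by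
        refine div_le_div₀ zero_le_one (by nlinarith) (by positivity) ?_
        gcongr
    _ = _ := by
        rw [exp_neg]
        field_simp

/-! The first derivatives of the coordinates are polynomials in the coordinates. -/

theorem hasDerivAt_gamma_fst (x y : ℝ) : HasDerivAt (fun x => gammaFun ε (x, y))
    (ε * gammaFun ε (x, y) * etaFun ε (x, y) / √(1 - ε ^ 2)) x := by
  have hD := (denom_pos hε0 hε1 (x, y)).ne'
  have hb := (sqrt_one_sub_sq_pos hε0 hε1).ne'
  have h := (hasDerivAt_const x (√(1 - ε ^ 2) * sinh y)).div
    (((hasDerivAt_cos x).const_mul ε).const_add (cosh y)) hD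
  refine h.congr_deriv ?_
  simp only [gammaFun, etaFun]
  field_simp
  ring

theorem hasDerivAt_gamma_snd (x y : ℝ) : HasDerivAt (fun y => gammaFun ε (x, y))
    ((1 - ε * xiFun ε (x, y) - gammaFun ε (x, y) ^ 2) / √(1 - ε ^ 2)) y := by
  have hD := (denom_pos hε0 hε1 (x, y)).ne'
  have hb := (sqrt_one_sub_sq_pos hε0 hε1).ne'
  have hb2 := sq_sqrt_one_sub_sq hε0 hε1
  have h := ((hasDerivAt_sinh y).const_mul √(1 - ε ^ 2)).div
    ((hasDerivAt_cosh y).add_const (ε * cos x)) hD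
  refine h.congr_deriv ?_
  simp only [gammaFun, xiFun]
  field_simp
  rw [hb2]
  ring

theorem hasDerivAt_xi_fst (x y : ℝ) : HasDerivAt (fun x => xiFun ε (x, y))
    (-(etaFun ε (x, y) * (1 - ε * xiFun ε (x, y))) / √(1 - ε ^ 2)) x := by
  have hD := (denom_pos hε0 hε1 (x, y)).ne'
  have hb := (sqrt_one_sub_sq_pos hε0 hε1).ne'
  have h := ((hasDerivAt_cos x).const_add (ε * cosh y)).div
    (((hasDerivAt_cos x).const_mul ε).const_add (cosh y)) hD
  refine h.congr_deriv ?_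
  simp only [etaFun, xiFun]
  field_simp
  ring

theorem hasDerivAt_xi_snd (x y : ℝ) : HasDerivAt (fun y => xiFun ε (x, y))
    (-((xiFun ε (x, y) - ε) * gammaFun ε (x, y)) / √(1 - ε ^ 2)) y := by
  have hD := (denom_pos hε0 hε1 (x, y)).ne'
  have hb := (sqrt_one_sub_sq_pos hε0 hε1).ne'
  have h := (((hasDerivAt_cosh y).const_mul ε).add_const (cos x)).div
    ((hasDerivAt_cosh y).add_const (ε * cos x)) hD
  refine h.congr_deriv ?_
  simp only [gammaFun, xiFun]
  field_simp
  ring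

theorem hasDerivAt_eta_fst (x y : ℝ) : HasDerivAt (fun x => etaFun ε (x, y))
    ((xiFun ε (x, y) - ε + ε * etaFun ε (x, y) ^ 2) / √(1 - ε ^ 2)) x := by
  have hD := (denom_pos hε0 hε1 (x, y)).ne'
  have hb := (sqrt_one_sub_sq_pos hε0 hε1).ne'
  have hb2 := sq_sqrt_one_sub_sq hε0 hε1
  have h := ((hasDerivAt_sin x).const_mul √(1 - ε ^ 2)).div
    (((hasDerivAt_cos x).const_mul ε).const_add (cosh y)) hD
  refine h.congr_deriv ?_
  simp only [etaFun, xiFun]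
  field_simp
  rw [hb2]
  ring

theorem hasDerivAt_eta_snd (x y : ℝ) : HasDerivAt (fun y => etaFun ε (x, y))
    (-(etaFun ε (x, y) * gammaFun ε (x, y)) / √(1 - ε ^ 2)) y := by
  have hD := (denom_pos hε0 hε1 (x, y)).ne'
  have hb := (sqrt_one_sub_sq_pos hε0 hε1).ne'
  have h := (hasDerivAt_const y (√(1 - ε ^ 2) * sin x)).div
    ((hasDerivAt_cosh y).add_const (ε * cos x)) hD
  refine h.congr_deriv ?_
  simp only [gammaFun, etaFun]
  field_simp
  ring

end Geometry

/-! ### The Laplacian of the spherical harmonics on the cylinder -/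

theorem fderiv_fst_eq {f : ℝ × ℝ → ℝ} {p : ℝ × ℝ} {a : ℝ} (hf : DifferentiableAt ℝ f p)
    (h : HasDerivAt (fun x => f (x, p.2)) a p.1) : fderiv ℝ f p (1, 0) = a := by
  have h1 : HasDerivAt (fun x : ℝ => (x, p.2)) ((1 : ℝ), (0 : ℝ)) p.1 :=
    (hasDerivAt_id p.1).prodMk (hasDerivAt_const p.1 p.2)
  exact (hf.hasFDerivAt.comp_hasDerivAt (f := fun x : ℝ => (x, p.2)) p.1 h1).unique h

theorem fderiv_snd_eq {f : ℝ × ℝ → ℝ} {p : ℝ × ℝ} {a : ℝ} (hf : DifferentiableAt ℝ f p)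
    (h : HasDerivAt (fun y => f (p.1, y)) a p.2) : fderiv ℝ f p (0, 1) = a := by
  have h1 : HasDerivAt (fun y : ℝ => (p.1, y)) ((0 : ℝ), (1 : ℝ)) p.2 :=
    (hasDerivAt_const p.2 p.1).prodMk (hasDerivAt_id p.2)
  exact (hf.hasFDerivAt.comp_hasDerivAt (f := fun y : ℝ => (p.1, y)) p.2 h1).unique h

section Line

open Polynomial

variable {g g₁ : ℝ → ℝ} {z z₁ : ℝ → ℂ} {t : ℝ}

theorem hasDerivAt_re {f : ℝ → ℂ} {f' : ℂ} (h : HasDerivAt f f' t) :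
    HasDerivAt (fun s => (f s).re) f'.re t :=
  Complex.reCLM.hasFDerivAt.comp_hasDerivAt t h

theorem hasDerivAt_eval_comp (q : ℝ[X]) {d : ℝ} (hg : HasDerivAt g d t) :
    HasDerivAt (fun s => ((q.eval (g s) : ℝ) : ℂ)) (((derivative q).eval (g t) * d : ℝ) : ℂ) t :=
  ((q.hasDerivAt (g t)).comp t hg).ofReal_comp

theorem hasDerivAt_pow_comp (k : ℕ) {d : ℂ} (hz : HasDerivAt z d t) :
    HasDerivAt (fun s => z s ^ k) (k * z t ^ (k - 1) * d) t :=
  hz.fun_pow k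

/-- First derivative of `q(γ) Re(c zᵏ)` along a curve `(z(t), γ(t))`. -/
theorem hasDerivAt_sphericalFun_line (q : ℝ[X]) (k : ℕ) (c : ℂ) {d : ℝ} {e : ℂ}
    (hg : HasDerivAt g d t) (hz : HasDerivAt z e t) :
    HasDerivAt (fun s => sphericalFun q k c (z s, g s))
      (c * ((((derivative q).eval (g t) * d : ℝ) : ℂ) * z t ^ k +
        ((q.eval (g t) : ℝ) : ℂ) * (k * z t ^ (k - 1) * e))).re t := by
  have h := hasDerivAt_re (((hasDerivAt_eval_comp q hg).mul (hasDerivAt_pow_comp k hz)).const_mul c)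
  refine h.congr_of_eventuallyEq (.of_forall fun s => ?_)
  simp only [sphericalFun, Pi.mul_apply]
  rw [mul_left_comm, Complex.re_ofReal_mul]

/-- Second derivative of `q(γ) Re(c zᵏ)` along a curve `(z(t), γ(t))`. -/
theorem hasDerivAt_sphericalFun_line_two (q : ℝ[X]) (k : ℕ) (c : ℂ) {g₂ : ℝ} {z₂ : ℂ}
    (hg : HasDerivAt g (g₁ t) t) (hz : HasDerivAt z (z₁ t) t)
    (hg₁ : HasDerivAt g₁ g₂ t) (hz₁ : HasDerivAt z₁ z₂ t) :
    HasDerivAt (fun s => (c * ((((derivative q).eval (g s) * g₁ s : ℝ) : ℂ) * z s ^ k +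
        ((q.eval (g s) : ℝ) : ℂ) * (k * z s ^ (k - 1) * z₁ s))).re)
      (c * ((((derivative (derivative q)).eval (g t) : ℝ) : ℂ) * g₁ t ^ 2 * z t ^ k +
        (((derivative q).eval (g t) : ℝ) : ℂ) * g₂ * z t ^ k +
        2 * (((derivative q).eval (g t) : ℝ) : ℂ) * (g₁ t * z₁ t) * (k * z t ^ (k - 1)) +
        ((q.eval (g t) : ℝ) : ℂ) * (z₁ t ^ 2 * (k * ((k - 1 : ℕ) * z t ^ (k - 1 - 1))) +
          z₂ * (k * z t ^ (k - 1))))).re t := by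
  have h1 := (((q.derivative.hasDerivAt (g t)).comp t hg).mul hg₁).ofReal_comp
  have h2 := h1.mul (hasDerivAt_pow_comp k hz)
  have h3 := (hasDerivAt_eval_comp q hg).mul
    (((hasDerivAt_pow_comp (k - 1) hz).const_mul (k : ℂ)).mul hz₁)
  have h4 := hasDerivAt_re ((h2.add h3).const_mul c)
  refine (h4.congr_of_eventuallyEq (.of_forall fun s => ?_)).congr_deriv ?_
  · simp [Function.comp]
  · congr 1
    simp only [Function.comp, Pi.mul_apply]
    push_cast
    ring

end Line

section Laplacian

open Polynomial

variable {ε : ℝ} (hε0 : 0 ≤ ε) (hε1 : ε < 1)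

/-- The `x`-derivative of `ξ + iη` at the point `w` of the sphere. -/
def zDerivFst (ε : ℝ) (w : ℂ × ℝ) : ℂ :=
  (Complex.I * w.1 + ε * w.1.im * w.1 - Complex.I * ε) / (√(1 - ε ^ 2) : ℝ)

/-- The `y`-derivative of `ξ + iη` at the point `w` of the sphere. -/
def zDerivSnd (ε : ℝ) (w : ℂ × ℝ) : ℂ := -(w.2 * (w.1 - ε)) / (√(1 - ε ^ 2) : ℝ)

/-- The `x`-derivative of `γ` at the point `w` of the sphere. -/
def gammaDerivFst (ε : ℝ) (w : ℂ × ℝ) : ℝ := ε * w.2 * w.1.im / √(1 - ε ^ 2)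

/-- The `y`-derivative of `γ` at the point `w` of the sphere. -/
def gammaDerivSnd (ε : ℝ) (w : ℂ × ℝ) : ℝ := (1 - ε * w.1.re - w.2 ^ 2) / √(1 - ε ^ 2)

theorem hasDerivAt_of_re_im {f : ℝ → ℂ} {a b t : ℝ} {f' : ℂ}
    (hr : HasDerivAt (fun s => (f s).re) a t) (hi : HasDerivAt (fun s => (f s).im) b t)
    (ha : f'.re = a) (hb : f'.im = b) : HasDerivAt f f' t := by
  have h := hr.ofReal_comp.add (hi.ofReal_comp.mul_const Complex.I)
  refine (h.congr_of_eventuallyEq (.of_forall fun s => ?_)).congr_deriv ?_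
  · simp [Complex.re_add_im]
  · rw [← ha, ← hb, Complex.re_add_im]

include hε0 hε1

theorem hasDerivAt_z_fst (x y : ℝ) :
    HasDerivAt (fun x => (sphereMap ε (x, y)).1) (zDerivFst ε (sphereMap ε (x, y))) x := by
  refine hasDerivAt_of_re_im (hasDerivAt_xi_fst hε0 hε1 x y) (hasDerivAt_eta_fst hε0 hε1 x y) ?_ ?_
  · rw [zDerivFst, Complex.div_ofReal_re]
    simp [sphereMap]
    ring
  · rw [zDerivFst, Complex.div_ofReal_im]
    simp [sphereMap]
    ring

theorem hasDerivAt_z_snd (x y : ℝ) :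
    HasDerivAt (fun y => (sphereMap ε (x, y)).1) (zDerivSnd ε (sphereMap ε (x, y))) y := by
  refine hasDerivAt_of_re_im (hasDerivAt_xi_snd hε0 hε1 x y) (hasDerivAt_eta_snd hε0 hε1 x y) ?_ ?_
  · rw [zDerivSnd, Complex.div_ofReal_re]
    simp [sphereMap]
    ring
  · rw [zDerivSnd, Complex.div_ofReal_im]
    simp [sphereMap]
    ring

theorem hasDerivAt_g_fst (x y : ℝ) :
    HasDerivAt (fun x => (sphereMap ε (x, y)).2) (gammaDerivFst ε (sphereMap ε (x, y))) x :=
  hasDerivAt_gamma_fst hε0 hε1 x y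

theorem hasDerivAt_g_snd (x y : ℝ) :
    HasDerivAt (fun y => (sphereMap ε (x, y)).2) (gammaDerivSnd ε (sphereMap ε (x, y))) y :=
  hasDerivAt_gamma_snd hε0 hε1 x y

theorem contDiff_sphericalFun_comp (q : ℝ[X]) (k : ℕ) (c : ℂ) :
    ContDiff ℝ ∞ fun p => sphericalFun q k c (sphereMap ε p) := by
  have hz : ContDiff ℝ ∞ fun p => (sphereMap ε p).1 := by
    have : (fun p => (sphereMap ε p).1) =
        fun p => (xiFun ε p : ℂ) + etaFun ε p * Complex.I := by
      ext p
      exact (Complex.re_add_im (sphereMap ε p).1).symm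
    rw [this]
    exact (Complex.ofRealCLM.contDiff.comp (contDiff_xiFun hε0 hε1)).add
      ((Complex.ofRealCLM.contDiff.comp (contDiff_etaFun hε0 hε1)).mul contDiff_const)
  have hq' : ContDiff ℝ ∞ fun s => q.eval s := by
    simp_rw [Polynomial.eval_eq_sum_range]
    fun_prop
  have hq : ContDiff ℝ ∞ fun p => q.eval (sphereMap ε p).2 :=
    hq'.comp (contDiff_gammaFun hε0 hε1)
  exact hq.mul (Complex.reCLM.contDiff.comp (contDiff_const.mul (hz.pow k)))

theorem fderiv_sphericalFun_fst (q : ℝ[X]) (k : ℕ) (c : ℂ) (p : ℝ × ℝ) :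
    fderiv ℝ (fun p => sphericalFun q k c (sphereMap ε p)) p (1, 0) =
      (c * ((((derivative q).eval (sphereMap ε p).2 * gammaDerivFst ε (sphereMap ε p) : ℝ) : ℂ) *
        (sphereMap ε p).1 ^ k + ((q.eval (sphereMap ε p).2 : ℝ) : ℂ) *
        (k * (sphereMap ε p).1 ^ (k - 1) * zDerivFst ε (sphereMap ε p)))).re :=
  fderiv_fst_eq ((contDiff_sphericalFun_comp hε0 hε1 q k c).differentiable (by simp) p)
    (hasDerivAt_sphericalFun_line q k c (hasDerivAt_g_fst hε0 hε1 p.1 p.2)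
      (hasDerivAt_z_fst hε0 hε1 p.1 p.2))

theorem fderiv_sphericalFun_snd (q : ℝ[X]) (k : ℕ) (c : ℂ) (p : ℝ × ℝ) :
    fderiv ℝ (fun p => sphericalFun q k c (sphereMap ε p)) p (0, 1) =
      (c * ((((derivative q).eval (sphereMap ε p).2 * gammaDerivSnd ε (sphereMap ε p) : ℝ) : ℂ) *
        (sphereMap ε p).1 ^ k + ((q.eval (sphereMap ε p).2 : ℝ) : ℂ) *
        (k * (sphereMap ε p).1 ^ (k - 1) * zDerivSnd ε (sphereMap ε p)))).re :=
  fderiv_snd_eq ((contDiff_sphericalFun_comp hε0 hε1 q k c).differentiable (by simp) p)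
    (hasDerivAt_sphericalFun_line q k c (hasDerivAt_g_snd hε0 hε1 p.1 p.2)
      (hasDerivAt_z_snd hε0 hε1 p.1 p.2))

/-- The Laplacian of `q(γ_ε) Re(c (ξ_ε + i η_ε)ᵏ)`. By conformality,
`∇γ·∇γ = ρ(1 - γ²)`, `∇z·∇z = -ρz²`, `∇γ·∇z = -ργz`, `Δγ = -2ργ` and `Δz = -2ρz`, where `ρ` is the
conformal factor and `z = ξ + iη`. -/
theorem laplacian_sphericalFun (q : ℝ[X]) (k : ℕ) (c : ℂ) (p : ℝ × ℝ) :
    fderiv ℝ (fun p => fderiv ℝ (fun p => sphericalFun q k c (sphereMap ε p)) p (1, 0)) p (1, 0) +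
      fderiv ℝ (fun p => fderiv ℝ (fun p => sphericalFun q k c (sphereMap ε p)) p (0, 1)) p (0, 1) =
    conformalFactor ε p * sphericalFun ((1 - X ^ 2) * derivative (derivative q) -
      C (2 * (k + 1) : ℝ) * X * derivative q - C (k * (k + 1) : ℝ) * q) k c (sphereMap ε p) := by
  have hs := contDiff_sphericalFun_comp hε0 hε1 q k c
  have hb0 := (sqrt_one_sub_sq_pos hε0 hε1).ne'
  set b := √(1 - ε ^ 2) with hb
  obtain ⟨x, y⟩ := p
  set w := sphereMap ε (x, y) with hw
  -- second derivatives of the coordinates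
  have gxx : HasDerivAt (fun x => gammaDerivFst ε (sphereMap ε (x, y)))
      (ε * (gammaDerivFst ε w * w.1.im + w.2 * ((w.1.re - ε + ε * w.1.im ^ 2) / b)) / b) x := by
    have h := (((hasDerivAt_g_fst hε0 hε1 x y).const_mul ε).mul
      (hasDerivAt_eta_fst hε0 hε1 x y)).div_const b
    refine h.congr_deriv ?_
    simp only [hw, sphereMap]
    ring
  have gyy : HasDerivAt (fun y => gammaDerivSnd ε (sphereMap ε (x, y)))
      ((ε * ((w.1.re - ε) * w.2 / b) - 2 * w.2 * gammaDerivSnd ε w) / b) y := by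
    have h := ((((hasDerivAt_xi_snd hε0 hε1 x y).const_mul ε).const_sub 1).sub
      ((hasDerivAt_g_snd hε0 hε1 x y).pow 2)).div_const b
    refine h.congr_deriv ?_
    simp only [hw, sphereMap]
    ring
  have zxx : HasDerivAt (fun x => zDerivFst ε (sphereMap ε (x, y)))
      ((Complex.I * zDerivFst ε w + ε * (((w.1.re - ε + ε * w.1.im ^ 2) / b : ℝ) : ℂ) * w.1 +
        ε * w.1.im * zDerivFst ε w) / b) x := by
    have hz := hasDerivAt_z_fst hε0 hε1 x y
    have h := (((hz.const_mul Complex.I).add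
      (((hasDerivAt_eta_fst hε0 hε1 x y).ofReal_comp.const_mul (ε : ℂ)).mul hz)).sub_const
        (Complex.I * ε)).div_const (b : ℂ)
    refine h.congr_deriv ?_
    simp only [hw, sphereMap]
    ring
  have zyy : HasDerivAt (fun y => zDerivSnd ε (sphereMap ε (x, y)))
      (-(gammaDerivSnd ε w * (w.1 - ε) + w.2 * zDerivSnd ε w) / b) y := by
    have hz := hasDerivAt_z_snd hε0 hε1 x y
    exact ((hasDerivAt_g_snd hε0 hε1 x y).ofReal_comp.mul (hz.sub_const (ε : ℂ))).neg.div_const _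
  have exx : fderiv ℝ (fun p => fderiv ℝ (fun p => sphericalFun q k c (sphereMap ε p)) p (1, 0))
      (x, y) (1, 0) = _ :=
    fderiv_fst_eq ((contDiff_fderiv_apply hs _).differentiable (by simp) _) <| by
      simp only [fderiv_sphericalFun_fst hε0 hε1]
      exact hasDerivAt_sphericalFun_line_two q k c (hasDerivAt_g_fst hε0 hε1 x y)
        (hasDerivAt_z_fst hε0 hε1 x y) gxx zxx
  have eyy : fderiv ℝ (fun p => fderiv ℝ (fun p => sphericalFun q k c (sphereMap ε p)) p (0, 1))
      (x, y) (0, 1) = _ :=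
    fderiv_snd_eq ((contDiff_fderiv_apply hs _).differentiable (by simp) _) <| by
      simp only [fderiv_sphericalFun_snd hε0 hε1]
      exact hasDerivAt_sphericalFun_line_two q k c (hasDerivAt_g_snd hε0 hε1 x y)
        (hasDerivAt_z_snd hε0 hε1 x y) gyy zyy
  rw [exx, eyy, ← Complex.add_re, ← mul_add]
  -- the conformality relations
  have hsph : w.1.re ^ 2 + w.1.im ^ 2 + w.2 ^ 2 = 1 := xi_sq_add hε0 hε1 (x, y)
  have hb2 : b ^ 2 = 1 - ε ^ 2 := sq_sqrt_one_sub_sq hε0 hε1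
  have hρ : b ^ 2 * conformalFactor ε (x, y) =
      (1 - ε * w.1.re) ^ 2 - (1 - ε ^ 2) * w.2 ^ 2 := by
    rw [hb2]
    exact conformalFactor_eq hε0 hε1 (x, y)
  set ρ := conformalFactor ε (x, y)
  have hρC : (b : ℂ) ^ 2 * ρ = (1 - ε * w.1.re) ^ 2 - (1 - ε ^ 2) * w.2 ^ 2 := by
    exact_mod_cast congrArg Complex.ofReal hρ
  have hbC : (b : ℂ) ≠ 0 := by exact_mod_cast hb0
  have k1 : gammaDerivFst ε w ^ 2 + gammaDerivSnd ε w ^ 2 = ρ * (1 - w.2 ^ 2) := by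
    rw [gammaDerivFst, gammaDerivSnd, ← hb]
    field_simp
    linear_combination ε ^ 2 * w.2 ^ 2 * hsph - (1 - w.2 ^ 2) * hρ
  have k4 : ε * (gammaDerivFst ε w * w.1.im + w.2 * ((w.1.re - ε + ε * w.1.im ^ 2) / b)) / b +
      (ε * ((w.1.re - ε) * w.2 / b) - 2 * w.2 * gammaDerivSnd ε w) / b = -2 * ρ * w.2 := by
    rw [gammaDerivFst, gammaDerivSnd, ← hb]
    field_simp
    linear_combination 2 * ε ^ 2 * w.2 * hsph + 2 * w.2 * hρ
  have k2 : zDerivFst ε w ^ 2 + zDerivSnd ε w ^ 2 = -ρ * w.1 ^ 2 := by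
    have : (Complex.I * w.1 + ε * w.1.im * w.1 - Complex.I * ε) ^ 2 + (w.2 * (w.1 - ε)) ^ 2 =
        -((1 - ε * w.1.re) ^ 2 - (1 - ε ^ 2) * w.2 ^ 2) * w.1 ^ 2 := by
      apply Complex.ext
      · simp [pow_two]
        linear_combination (ε ^ 2 * (w.1.re ^ 2 - w.1.im ^ 2) - 2 * ε * w.1.re + ε ^ 2) * hsph
      · simp [pow_two]
        linear_combination (2 * ε ^ 2 * w.1.re * w.1.im - 2 * ε * w.1.im) * hsph
    rw [zDerivFst, zDerivSnd, ← hb]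
    field_simp
    linear_combination this + w.1 ^ 2 * hρC
  have k3 : gammaDerivFst ε w * zDerivFst ε w + gammaDerivSnd ε w * zDerivSnd ε w =
      -ρ * w.2 * w.1 := by
    have : ε * w.2 * w.1.im * (Complex.I * w.1 + ε * w.1.im * w.1 - Complex.I * ε) -
        (1 - ε * w.1.re - w.2 ^ 2) * (w.2 * (w.1 - ε)) =
        -((1 - ε * w.1.re) ^ 2 - (1 - ε ^ 2) * w.2 ^ 2) * w.2 * w.1 := by
      apply Complex.ext
      · simp [pow_two]
        linear_combination w.2 * (ε ^ 2 * w.1.re - ε) * hsph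
      · simp [pow_two]
        linear_combination w.2 * ε ^ 2 * w.1.im * hsph
    rw [zDerivFst, zDerivSnd, gammaDerivFst, gammaDerivSnd, ← hb]
    push_cast
    field_simp
    linear_combination this + w.2 * w.1 * hρC
  have k5 : (Complex.I * zDerivFst ε w + ε * (((w.1.re - ε + ε * w.1.im ^ 2) / b : ℝ) : ℂ) * w.1 +
        ε * w.1.im * zDerivFst ε w) / b +
      -(gammaDerivSnd ε w * (w.1 - ε) + w.2 * zDerivSnd ε w) / b = -2 * ρ * w.1 := by
    have : Complex.I * (Complex.I * w.1 + ε * w.1.im * w.1 - Complex.I * ε) +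
        ε * (w.1.re - ε + ε * w.1.im ^ 2) * w.1 +
        ε * w.1.im * (Complex.I * w.1 + ε * w.1.im * w.1 - Complex.I * ε) -
        (1 - ε * w.1.re - w.2 ^ 2) * (w.1 - ε) + w.2 * (w.2 * (w.1 - ε)) =
        -2 * ((1 - ε * w.1.re) ^ 2 - (1 - ε ^ 2) * w.2 ^ 2) * w.1 := by
      apply Complex.ext
      · simp [pow_two]
        linear_combination (2 * ε ^ 2 * w.1.re - 2 * ε) * hsph
      · simp [pow_two]
        linear_combination 2 * ε ^ 2 * w.1.im * hsph
    rw [zDerivFst, zDerivSnd, gammaDerivSnd, ← hb]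
    push_cast
    field_simp
    linear_combination this + 2 * w.1 * hρC
  have z1 : w.1 * (k * w.1 ^ (k - 1)) = k * w.1 ^ k := by
    cases k with
    | zero => simp
    | succ k => simp only [Nat.add_sub_cancel]; ring
  have z2 : w.1 ^ 2 * (k * ((k - 1 : ℕ) * w.1 ^ (k - 1 - 1))) = k * (k - 1) * w.1 ^ k := by
    match k with
    | 0 => simp
    | 1 => simp
    | k + 2 => simp only [Nat.add_sub_cancel, show k + 2 - 1 = k + 1 by omega]; push_cast; ring
  have k1C : (gammaDerivFst ε w : ℂ) ^ 2 + (gammaDerivSnd ε w : ℂ) ^ 2 = ρ * (1 - w.2 ^ 2) := by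
    exact_mod_cast congrArg Complex.ofReal k1
  have k4C := congrArg Complex.ofReal k4
  have k4R : ((-2 * ρ * w.2 : ℝ) : ℂ) = -2 * ρ * w.2 := by push_cast; ring
  rw [Complex.ofReal_add, k4R] at k4C
  have e1 : ρ * sphericalFun ((1 - X ^ 2) * derivative (derivative q) -
      C (2 * (k + 1) : ℝ) * X * derivative q - C (k * (k + 1) : ℝ) * q) k c w =
      (c * (ρ * ((1 - w.2 ^ 2) * (((derivative (derivative q)).eval w.2 : ℝ) : ℂ) -
        2 * (k + 1) * w.2 * (((derivative q).eval w.2 : ℝ) : ℂ) -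
        k * (k + 1) * ((q.eval w.2 : ℝ) : ℂ)) * w.1 ^ k)).re := by
    rw [sphericalFun, ← mul_assoc, ← Complex.re_ofReal_mul]
    congr 1
    simp only [eval_sub, eval_mul, eval_C, eval_X, eval_one, eval_pow]
    push_cast
    ring
  rw [e1]
  congr 2
  linear_combination (((derivative (derivative q)).eval w.2 : ℝ) : ℂ) * w.1 ^ k * k1C +
    (((derivative q).eval w.2 : ℝ) : ℂ) * w.1 ^ k * k4C +
    2 * (((derivative q).eval w.2 : ℝ) : ℂ) * (k * w.1 ^ (k - 1)) * k3 +
    ((q.eval w.2 : ℝ) : ℂ) * (k * ((k - 1 : ℕ) * w.1 ^ (k - 1 - 1))) * k2 +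
    ((q.eval w.2 : ℝ) : ℂ) * (k * w.1 ^ (k - 1)) * k5 -
    (2 * (((derivative q).eval w.2 : ℝ) : ℂ) * ρ * w.2 + 2 * ((q.eval w.2 : ℝ) : ℂ) * ρ) * z1 -
    ((q.eval w.2 : ℝ) : ℂ) * ρ * z2

/-- The functions `L_n^{(k)}(γ_ε) Re(c (ξ_ε + i η_ε)ᵏ)` satisfy `-Δe = n(n+1) ρ e`. -/
theorem laplacian_legendre (n k : ℕ) (c : ℂ) (p : ℝ × ℝ) :
    fderiv ℝ (fun p => fderiv ℝ (fun p => sphericalFun (derivative^[k] (legendre n)) k c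
        (sphereMap ε p)) p (1, 0)) p (1, 0) +
      fderiv ℝ (fun p => fderiv ℝ (fun p => sphericalFun (derivative^[k] (legendre n)) k c
        (sphereMap ε p)) p (0, 1)) p (0, 1) =
    -(n * (n + 1) * conformalFactor ε p *
      sphericalFun (derivative^[k] (legendre n)) k c (sphereMap ε p)) := by
  rw [laplacian_sphericalFun hε0 hε1, sphericalFun, sphericalFun]
  have h := legendre_ode n k (sphereMap ε p).2
  simp only [Function.iterate_succ_apply'] at h
  simp only [eval_sub, eval_mul, eval_C, eval_X, eval_one, eval_pow]
  linear_combination conformalFactor ε p * (c * (sphereMap ε p).1 ^ k).re * h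

end Laplacian

/-! ### Eigenvalue problems in weighted energy spaces -/

section WeightedProblem

variable {I : Set ℝ} {α β κ : ℝ → ℝ} {μ : Measure (ℝ × ℝ)} {σ : Type*} {lam : σ → ℝ}
  {S : σ → Set (ℝ × ℝ → ℝ)}

/-- `ψ` is a weak solution, in the energy space, of the equation
`-∂₁(α ∂₁ψ) - ∂₂(β ∂₂ψ) = l (ψ - ⨍ ψ dμ) μ`. -/
structure IsWeakSolution (I : Set ℝ) (α β κ : ℝ → ℝ) (μ : Measure (ℝ × ℝ)) (l : ℝ)
    (ψ : ℝ × ℝ → ℝ) : Prop where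
  mem : MemEnergy I α β κ ψ
  eq : ∀ φ, MemEnergy I α β κ φ →
    energyForm I α β ψ φ = l * ∫ p, (ψ p - ⨍ q, ψ q ∂μ) * φ p ∂μ

/-- An eigenvalue problem in the energy space, with a measure `μ` equivalent to the area on a period
cell, for which finite sets `S n` of eigenfunctions with distinct eigenvalues `lam n` are known that
are complete among the functions of mean zero in `L²(μ)`. -/
structure CompleteProblem (I : Set ℝ) (α β κ : ℝ → ℝ) (μ : Measure (ℝ × ℝ)) (lam : σ → ℝ)
    (S : σ → Set (ℝ × ℝ → ℝ)) : Prop where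
  weights : AdmissibleWeights I α β
  continuous : Continuous κ
  integral_ne : ∫ x in (0)..(2 * π), κ x ≠ 0
  isFinite : IsFiniteMeasure μ
  ac : μ ≪ volume.restrict (cell I)
  ac' : volume.restrict (cell I) ≪ μ
  memLp : ∀ ψ, MemEnergy I α β κ ψ → MemLp ψ 2 μ
  finite : ∀ n, (S n).Finite
  solution : ∀ n, ∀ e ∈ S n, IsWeakSolution I α β κ μ (lam n) e
  nonzero : ∀ n, ∃ e ∈ S n, ¬ e =ᵐ[volume.restrict (strip I)] 0
  injective : Function.Injective lam
  complete : ∀ v, MemLp v 2 μ → ∫ p, v p ∂μ = 0 →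
    (∀ n, ∀ e ∈ S n, ∫ p, v p * e p ∂μ = 0) → v =ᵐ[μ] 0

theorem inner_toLp {f g : ℝ × ℝ → ℝ} (hf : MemLp f 2 μ) (hg : MemLp g 2 μ) :
    inner ℝ (hf.toLp f) (hg.toLp g) = ∫ p, f p * g p ∂μ := by
  rw [L2.inner_def]
  refine integral_congr_ae ?_
  filter_upwards [hf.coeFn_toLp, hg.coeFn_toLp] with p h1 h2
  rw [h1, h2]
  simp [mul_comm]

theorem memLp_sub_average [IsFiniteMeasure μ] {f : ℝ × ℝ → ℝ} (hf : MemLp f 2 μ) :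
    MemLp (fun p => f p - ⨍ q, f q ∂μ) 2 μ :=
  hf.sub (memLp_const _)

theorem integral_sub_average_mul_sub_average [IsFiniteMeasure μ] {f g : ℝ × ℝ → ℝ}
    (hf : MemLp f 2 μ) (hg : MemLp g 2 μ) :
    ∫ p, (f p - ⨍ q, f q ∂μ) * (g p - ⨍ q, g q ∂μ) ∂μ = ∫ p, (f p - ⨍ q, f q ∂μ) * g p ∂μ := by
  simp_rw [mul_sub]
  have h1 : Integrable (fun p => (f p - ⨍ q, f q ∂μ) * g p) μ :=
    (memLp_sub_average hf).integrable_mul hg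
  have h2 := ((memLp_sub_average hf).integrable one_le_two).mul_const (⨍ q, g q ∂μ)
  rw [integral_sub h1 h2, integral_mul_const, integral_sub_average, zero_mul, sub_zero]

/-- The map `ψ ↦ ψ - ⨍ ψ dμ` from a space of functions into `L²(μ)`. -/
def centering [IsFiniteMeasure μ] {V : Submodule ℝ (ℝ × ℝ → ℝ)} (h : ∀ ψ ∈ V, MemLp ψ 2 μ) :
    V →ₗ[ℝ] Lp ℝ 2 μ where
  toFun ψ := (memLp_sub_average (h ψ.1 ψ.2)).toLp _
  map_add' ψ φ := by
    rw [← MemLp.toLp_add]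
    refine MemLp.toLp_congr _ _ (.of_forall fun p => ?_)
    have hi := (h ψ.1 ψ.2).integrable one_le_two
    have hj := (h φ.1 φ.2).integrable one_le_two
    have : ⨍ q, (ψ.1 + φ.1) q ∂μ = (⨍ q, ψ.1 q ∂μ) + ⨍ q, φ.1 q ∂μ := by
      simp only [average_eq, Pi.add_apply]
      rw [integral_add hi hj, smul_add]
    simp only [Submodule.coe_add, Pi.add_apply] at this ⊢
    rw [this]
    ring
  map_smul' c ψ := by
    rw [RingHom.id_apply, ← MemLp.toLp_const_smul]
    refine MemLp.toLp_congr _ _ (.of_forall fun p => ?_)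
    have : ⨍ q, (c • ψ.1) q ∂μ = c * ⨍ q, ψ.1 q ∂μ := by
      simp only [average_eq, Pi.smul_apply, smul_eq_mul]
      rw [integral_const_mul]
      ring
    simp only [Submodule.coe_smul, Pi.smul_apply, smul_eq_mul] at this ⊢
    rw [this]
    ring

theorem inner_centering [IsFiniteMeasure μ] {V : Submodule ℝ (ℝ × ℝ → ℝ)}
    (h : ∀ ψ ∈ V, MemLp ψ 2 μ) (ψ φ : V) :
    inner ℝ (centering h ψ) (centering h φ) = ∫ p, (ψ.1 p - ⨍ q, ψ.1 q ∂μ) * φ.1 p ∂μ := by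
  rw [← integral_sub_average_mul_sub_average (h ψ.1 ψ.2) (h φ.1 φ.2)]
  exact inner_toLp (memLp_sub_average (h ψ.1 ψ.2)) (memLp_sub_average (h φ.1 φ.2))

namespace CompleteProblem

variable (P : CompleteProblem I α β κ μ lam S)

include P

theorem memLp_of_mem (ψ : ℝ × ℝ → ℝ) (hψ : ψ ∈ energySubmodule P.weights P.continuous) :
    MemLp ψ 2 μ := P.memLp ψ hψ

theorem energyBilin_eq_iff [IsFiniteMeasure μ] {l : ℝ}
    {ψ φ : energySubmodule P.weights P.continuous} :
    energyBilin P.weights P.continuous ψ φ =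
      l * inner ℝ (centering P.memLp_of_mem ψ) (centering P.memLp_of_mem φ) ↔
    energyForm I α β ψ.1 φ.1 = l * ∫ p, (ψ.1 p - ⨍ q, ψ.1 q ∂μ) * φ.1 p ∂μ := by
  rw [inner_centering]
  rfl

theorem completeEigensystem [IsFiniteMeasure μ] :
    CompleteEigensystem (energyBilin P.weights P.continuous)
      (centering P.memLp_of_mem)
      (fun n => Submodule.span ℝ ((energySubmodule P.weights P.continuous).subtype ⁻¹' S n)) lam
      ((memLp_const (1 : ℝ)).toLp _ : Lp ℝ 2 μ) where
  symm ψ φ := energyForm_comm _ _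
  nonneg ψ := energyForm_self_nonneg P.weights _
  finite n := FiniteDimensional.span_of_finite ℝ
    ((P.finite n).preimage (Subtype.val_injective.injOn))
  eigen n e he φ := by
    induction he using Submodule.span_induction with
    | mem e he => exact P.energyBilin_eq_iff.2 ((P.solution n e.1 he).eq φ.1 φ.2)
    | zero => simp
    | add x y _ _ hx hy =>
      rw [map_add, LinearMap.add_apply, hx, hy, map_add, inner_add_left, mul_add]
    | smul c x _ hx =>
      rw [map_smul, LinearMap.smul_apply, hx, map_smul, real_inner_smul_left, smul_eq_mul]
      ring
  injective := P.injective
  orthogonal ψ := by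
    refine (inner_toLp (memLp_sub_average (P.memLp_of_mem ψ.1 ψ.2)) (memLp_const 1)).trans ?_
    simp only [mul_one]
    exact integral_sub_average μ ψ.1
  complete v hv hE := by
    have hvL : (Lp.memLp v).toLp v = v := Lp.toLp_coeFn v _
    have h0 : ∫ p, v p ∂μ = 0 := by
      rw [← hvL, inner_toLp] at hv
      simpa using hv
    have := P.complete v (Lp.memLp v) h0 fun n e he => ?_
    · rw [← hvL, ← MemLp.toLp_zero (MemLp.zero' (ε := ℝ) (p := 2) (μ := μ))]
      exact MemLp.toLp_congr _ _ this
    · have hV := (P.solution n e he).mem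
      have h1 := hE n ⟨e, hV⟩ (Submodule.subset_span he)
      rw [← hvL] at h1
      have h2 := (inner_toLp (Lp.memLp v) (memLp_sub_average (P.memLp e hV))).symm.trans h1
      simp_rw [mul_sub] at h2
      have i1 : Integrable (fun p => v p * e p) μ := (Lp.memLp v).integrable_mul (P.memLp e hV)
      have i2 := ((Lp.memLp v).integrable one_le_two).mul_const (⨍ q, e q ∂μ)
      rwa [integral_sub i1 i2, integral_mul_const, h0, zero_mul, sub_zero] at h2

/-- Functions in the energy space that agree up to a constant coincide. -/
theorem ae_eq_of_centering_eq [IsFiniteMeasure μ]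
    {ψ φ : energySubmodule P.weights P.continuous}
    (h : centering P.memLp_of_mem ψ = centering P.memLp_of_mem φ) :
    ψ.1 =ᵐ[volume.restrict (strip I)] φ.1 := by
  have h1 := (MemLp.toLp_eq_toLp_iff (memLp_sub_average (P.memLp ψ.1 ψ.2))
    (memLp_sub_average (P.memLp φ.1 φ.2))).1 h
  set c := (⨍ q, ψ.1 q ∂μ) - ⨍ q, φ.1 q ∂μ with hc
  have h2 : (ψ - φ).1 =ᵐ[volume.restrict (strip I)] fun _ => c := by
    have hp : PeriodicOn I ((ψ - φ).1 + fun _ => -c) :=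
      (ψ - φ).2.1.periodic.add (.of_forall fun _ => rfl)
    have h3 := hp.ae_eq_zero P.weights.isOpen (by
      filter_upwards [P.ac'.ae_eq h1] with p hp
      simp only [Submodule.coe_sub, Pi.add_apply, Pi.sub_apply, Pi.zero_apply]
      linarith)
    filter_upwards [h3] with p hp
    simp only [Pi.add_apply, Pi.zero_apply] at hp
    linarith
  have h4 : c = 0 := MemEnergy.const_eq_zero P.integral_ne ((ψ - φ).2.congr_ae P.weights h2)
  filter_upwards [h2] with p hp
  rw [h4, Submodule.coe_sub, Pi.sub_apply] at hp
  linarith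

theorem isWeakSolution_congr {l : ℝ} {ψ φ : ℝ × ℝ → ℝ} (hψ : IsWeakSolution I α β κ μ l ψ)
    (h : ψ =ᵐ[volume.restrict (strip I)] φ) : IsWeakSolution I α β κ μ l φ := by
  have hμ : ψ =ᵐ[μ] φ := P.ac.ae_eq (ae_restrict_cell h)
  refine ⟨hψ.mem.congr_ae P.weights h, fun χ hχ => ?_⟩
  rw [hψ.mem.1.energyForm_congr P.weights h, hψ.eq χ hχ, average_congr hμ]
  congr 1
  refine integral_congr_ae ?_
  filter_upwards [hμ] with p hp
  rw [hp]

theorem map_span (n : σ) :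
    (Submodule.span ℝ ((energySubmodule P.weights P.continuous).subtype ⁻¹' S n)).map
      (energySubmodule P.weights P.continuous).subtype = Submodule.span ℝ (S n) := by
  rw [Submodule.map_span, image_preimage_eq_of_subset]
  intro e he
  exact ⟨⟨e, (P.solution n e he).mem⟩, rfl⟩

/-- The eigenspace of `lam n` is spanned by `S n`. -/
theorem isWeakSolution_iff (n : σ) (ψ : ℝ × ℝ → ℝ) :
    IsWeakSolution I α β κ μ (lam n) ψ ↔
      ∃ φ ∈ Submodule.span ℝ (S n), ψ =ᵐ[volume.restrict (strip I)] φ := by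
  have := P.isFinite
  constructor
  · intro h
    obtain ⟨e, he, hψe⟩ := P.completeEigensystem.exists_mem_of_eigen (n := n) (ψ := ⟨ψ, h.mem⟩)
      fun φ => P.energyBilin_eq_iff.2 (h.eq φ.1 φ.2)
    refine ⟨e.1, ?_, P.ae_eq_of_centering_eq hψe⟩
    rw [← P.map_span]
    exact Submodule.mem_map_of_mem he
  · rintro ⟨φ, hφ, hψφ⟩
    rw [← P.map_span] at hφ
    obtain ⟨e, he, rfl⟩ := hφ
    refine P.isWeakSolution_congr (ψ := e.1) ⟨e.2, fun χ hχ => ?_⟩ hψφ.symm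
    exact P.energyBilin_eq_iff.1 (P.completeEigensystem.eigen n e he ⟨χ, hχ⟩)

/-- There are no eigenvalues other than the numbers `lam n`. -/
theorem exists_isWeakSolution_iff (l : ℝ) :
    (∃ ψ, IsWeakSolution I α β κ μ l ψ ∧ ¬ ψ =ᵐ[volume.restrict (strip I)] 0) ↔
      ∃ n, l = lam n := by
  have := P.isFinite
  constructor
  · rintro ⟨ψ, h, hψ⟩
    by_contra! hl
    refine hψ (P.ae_eq_of_centering_eq (ψ := ⟨ψ, h.mem⟩) (φ := 0) ?_)
    rw [map_zero]
    exact P.completeEigensystem.eq_zero_of_forall_ne (l := l)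
      (fun φ => P.energyBilin_eq_iff.2 (h.eq φ.1 φ.2)) hl
  · rintro ⟨n, rfl⟩
    obtain ⟨e, he, hne⟩ := P.nonzero n
    exact ⟨e, P.solution n e he, hne⟩

/-- Coercivity on the orthogonal complement of one eigenspace. -/
theorem le_energyForm {Λ : ℝ} (hΛ : 0 ≤ Λ) {n₀ : σ} (hn₀ : lam n₀ ≠ 0)
    (hlam : ∀ n, n ≠ n₀ → Λ ≤ lam n) {ψ : ℝ × ℝ → ℝ} (hψ : MemEnergy I α β κ ψ)
    (horth : ∀ e, IsWeakSolution I α β κ μ (lam n₀) e → energyForm I α β ψ e = 0) :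
    Λ * ∫ p, (ψ p - ⨍ q, ψ q ∂μ) * ψ p ∂μ ≤ energyForm I α β ψ ψ := by
  have := P.isFinite
  have h := P.completeEigensystem.le_form hΛ hlam (ψ := ⟨ψ, hψ⟩) fun e he => ?_
  · exact (congrArg (Λ * ·) (inner_centering P.memLp_of_mem ⟨ψ, hψ⟩ ⟨ψ, hψ⟩)).symm.trans_le h
  · have h1 := P.completeEigensystem.eigen n₀ e he ⟨ψ, hψ⟩
    rw [P.completeEigensystem.symm] at h1
    have h2 : energyForm I α β ψ e.1 = 0 := horth e.1 <|
      (P.isWeakSolution_iff n₀ e.1).2 ⟨e.1, by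
        rw [← P.map_span]; exact Submodule.mem_map_of_mem he, ae_eq_refl _⟩
    rw [real_inner_comm] at h1
    exact (mul_eq_zero.1 (h1.symm.trans h2)).resolve_left hn₀

end CompleteProblem

end WeightedProblem

/-! ### Spherical harmonics pulled back to the cylinder -/

section LegendreSystem

open Polynomial

/-- The spherical harmonics of degree `n`, without their value on the equator for the zonal one,
pulled back along a map `G` into the unit sphere. The factor `-i` turns `Re(c zᵏ)` into the
imaginary part of `zᵏ`. -/
def legendreSystem (G : ℝ × ℝ → ℂ × ℝ) (n : ℕ) : Set (ℝ × ℝ → ℝ) :=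
  {fun p => (legendre n).eval (G p).2 - (legendre n).eval 0} ∪
    {F | ∃ k : ℕ, 1 ≤ k ∧ k ≤ n ∧
      (F = (fun p => sphericalFun (derivative^[k] (legendre n)) k 1 (G p)) ∨
        F = (fun p => sphericalFun (derivative^[k] (legendre n)) k (-Complex.I) (G p)))}

theorem finite_legendreSystem (G : ℝ × ℝ → ℂ × ℝ) (n : ℕ) : (legendreSystem G n).Finite := by
  refine (finite_singleton _).union (Set.Finite.subset ((Finset.range (n + 1)).finite_toSet.biUnion
    (t := fun k => {fun p => sphericalFun (derivative^[k] (legendre n)) k 1 (G p),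
      fun p => sphericalFun (derivative^[k] (legendre n)) k (-Complex.I) (G p)})
    fun k _ => toFinite _) ?_)
  rintro F ⟨k, -, hk, hF⟩
  exact mem_biUnion (Finset.mem_coe.2 (Finset.mem_range.2 (by omega))) hF

theorem image_legendreSystem (G : ℝ × ℝ → ℂ × ℝ) (f : ℝ × ℝ → ℝ × ℝ) (n : ℕ) :
    (fun F p => F (f p)) '' legendreSystem G n = legendreSystem (fun p => G (f p)) n := by
  ext F
  constructor
  · rintro ⟨F, rfl | ⟨k, h1, hk, rfl | rfl⟩, rfl⟩
    · exact Or.inl rfl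
    · exact Or.inr ⟨k, h1, hk, Or.inl rfl⟩
    · exact Or.inr ⟨k, h1, hk, Or.inr rfl⟩
  · rintro (rfl | ⟨k, h1, hk, rfl | rfl⟩)
    · exact ⟨_, Or.inl rfl, rfl⟩
    · exact ⟨_, Or.inr ⟨k, h1, hk, Or.inl rfl⟩, rfl⟩
    · exact ⟨_, Or.inr ⟨k, h1, hk, Or.inr rfl⟩, rfl⟩

theorem sphericalFun_zero_one (q : ℝ[X]) (w : ℂ × ℝ) : sphericalFun q 0 1 w = q.eval w.2 := by
  simp [sphericalFun]

theorem sphericalFun_eq_re_im (q : ℝ[X]) (k : ℕ) (c : ℂ) (w : ℂ × ℝ) :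
    sphericalFun q k c w =
      c.re * sphericalFun q k 1 w + c.im * -(sphericalFun q k (-Complex.I) w) := by
  simp [sphericalFun]
  ring

theorem iterate_derivative_legendre_self_eval_ne_zero (n : ℕ) (s : ℝ) :
    (derivative^[n] (legendre n)).eval s ≠ 0 := by
  have hn : (legendre n).natDegree = n := natDegree_eq_of_degree_eq_some (degree_legendre n)
  have h := degree_iterate_derivative_real (legendre_ne_zero n) (k := n) hn.ge
  rw [hn, Nat.sub_self, Nat.cast_zero] at h
  rw [eq_C_of_degree_eq_zero h, eval_C]
  intro h0
  rw [eq_C_of_degree_eq_zero h, h0, map_zero, degree_zero] at h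
  exact absurd h (by simp)

theorem energyForm_const {I : Set ℝ} {α β : ℝ → ℝ} (w : AdmissibleWeights I α β) (c : ℝ)
    (φ : ℝ × ℝ → ℝ) : energyForm I α β (fun _ => c) φ = 0 := by
  have hs : ContDiffOn ℝ ∞ (fun _ : ℝ × ℝ => c) (strip I) := contDiffOn_const
  have h1 := (hasWeakDeriv_of_contDiffOn (isOpen_strip w.isOpen) hs (1, 0)).weakDeriv_ae_eq
    (isOpen_strip w.isOpen)
  have h2 := (hasWeakDeriv_of_contDiffOn (isOpen_strip w.isOpen) hs (0, 1)).weakDeriv_ae_eq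
    (isOpen_strip w.isOpen)
  rw [energyForm, integral_congr_ae (g := fun _ => (0 : ℝ)), integral_zero]
  filter_upwards [ae_restrict_cell h1, ae_restrict_cell h2] with p hp1 hp2
  rw [D₁, D₂, hp1, hp2]
  simp

section Problem

variable {I : Set ℝ} {α β κ : ℝ → ℝ} {μ : Measure (ℝ × ℝ)}

/-- Subtracting a constant from a solution of `-∂₁(α ∂₁s) - ∂₂(β ∂₂s) = l s μ`, so that it satisfies
the normalisation on `y = 0`, gives a weak solution of the eigenvalue problem. -/
theorem isWeakSolution_sub_const (w : AdmissibleWeights I α β) [IsFiniteMeasure μ]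
    (hμ : NeZero μ) {s : ℝ × ℝ → ℝ} {l d : ℝ} (hl : l ≠ 0) (hs : FiniteEnergy I α β s)
    (hsi : Integrable s μ)
    (hgreen : ∀ φ, FiniteEnergy I α β φ → energyForm I α β s φ = l * ∫ p, s p * φ p ∂μ)
    (hm : MemEnergy I α β κ fun p => s p - d) :
    IsWeakSolution I α β κ μ l fun p => s p - d := by
  have h0 : ∫ p, s p ∂μ = 0 := by
    have h := hgreen _ (FiniteEnergy.const w 1)
    rw [energyForm_comm, energyForm_const w] at h
    simpa using (mul_eq_zero.1 h.symm).resolve_left hl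
  have ha : ⨍ p, (s p - d) ∂μ = -d := by
    rw [average_eq, integral_sub hsi (integrable_const d), h0, integral_const, zero_sub, smul_neg,
      smul_smul, inv_mul_cancel₀ measureReal_univ_ne_zero, one_smul]
  refine ⟨hm, fun φ hφ => ?_⟩
  have hsd : (fun p => s p - d) = s + fun _ => -d := by
    ext p
    simp [sub_eq_add_neg]
  rw [ha, hsd, hs.energyForm_add w (FiniteEnergy.const w _) hφ.1, energyForm_const w, add_zero,
    hgreen φ hφ.1]
  simp

/-- If `G` maps a period cell injectively into the unit sphere, in such a way that the spherical
harmonics become eigenfunctions, then they form a complete system. -/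
theorem completeProblem_of_sphere (w : AdmissibleWeights I α β) (hκ : Continuous κ)
    (hκ0 : ∫ x in (0)..(2 * π), κ x ≠ 0) (hμ : IsFiniteMeasure μ) (hμ0 : NeZero μ)
    (hac : μ ≪ volume.restrict (cell I)) (hac' : volume.restrict (cell I) ≪ μ)
    (hL2 : ∀ ψ, MemEnergy I α β κ ψ → MemLp ψ 2 μ)
    {G : ℝ × ℝ → ℂ × ℝ} (hG : Measurable G) (hGc : ContinuousOn G (strip I))
    (hinj : InjOn G (cell I)) (hGs : ∀ p ∈ cell I, G p ∈ unitSphere)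
    (hG0 : ∀ x, (G (x, 0)).2 = 0) (hG00 : (G (0, 0)).1 = 1)
    {lam : ℕ → ℝ} (hlam0 : ∀ n, 1 ≤ n → lam n ≠ 0)
    (hlam : ∀ n m, lam n = lam m → n = m)
    (hs : ∀ n k c, FiniteEnergy I α β
      fun p => sphericalFun (derivative^[k] (legendre n)) k c (G p))
    (hgreen : ∀ n k c φ, FiniteEnergy I α β φ →
      energyForm I α β (fun p => sphericalFun (derivative^[k] (legendre n)) k c (G p)) φ =
        lam n * ∫ p, sphericalFun (derivative^[k] (legendre n)) k c (G p) * φ p ∂μ)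
    (htr : ∀ q k c, 1 ≤ k → ∫ x in (0)..(2 * π), sphericalFun q k c (G (x, 0)) * κ x = 0) :
    CompleteProblem I α β κ μ (fun n : {n : ℕ // 1 ≤ n} => lam n)
      (fun n => legendreSystem G n) := by
  have hcell := measurableSet_cell w.isOpen
  have hμS : ∀ᵐ p ∂μ, p ∈ cell I := hac.ae_le (ae_restrict_mem hcell)
  have hint : ∀ q k c, Integrable (fun p => sphericalFun q k c (G p)) μ := fun q k c => by
    have := integrable_mul_comp_sphere hG (hμS.mono hGs) (integrable_const (1 : ℝ))
      (continuous_sphericalFun q k c)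
    simpa using this
  have hcont : ∀ q k c, ContinuousOn (fun p => sphericalFun q k c (G p)) (strip I) :=
    fun q k c => (continuous_sphericalFun q k c).comp_continuousOn hGc
  have htrace : ∀ q k c d, IsTrace (fun p => sphericalFun q k c (G p) - d)
      fun x => sphericalFun q k c (G (x, 0)) - d := fun q k c d =>
    isTrace_of_continuousOn w.isOpen w.zero_mem ((hcont q k c).sub continuousOn_const)
  have hmem : ∀ n k c d, (∫ x in (0)..(2 * π),
      (sphericalFun (derivative^[k] (legendre n)) k c (G (x, 0)) - d) * κ x = 0) →
      MemEnergy I α β κ fun p => sphericalFun (derivative^[k] (legendre n)) k c (G p) - d :=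
    fun n k c d h => ⟨by
      simp only [sub_eq_add_neg]
      exact (hs n k c).add w (FiniteEnergy.const w (-d)),
      _, htrace _ k c d, h⟩
  have hsol : ∀ n k c, 1 ≤ n → 1 ≤ k → IsWeakSolution I α β κ μ (lam n)
      fun p => sphericalFun (derivative^[k] (legendre n)) k c (G p) := fun n k c hn hk => by
    have := isWeakSolution_sub_const w hμ0 (hlam0 n hn) (hs n k c) (hint _ k c) (hgreen n k c)
      (hmem n k c 0 (by simpa using htr _ k c hk))
    simpa using this
  have hsol0 : ∀ n, 1 ≤ n → IsWeakSolution I α β κ μ (lam n)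
      fun p => (legendre n).eval (G p).2 - (legendre n).eval 0 := fun n hn => by
    have := isWeakSolution_sub_const w hμ0 (hlam0 n hn) (hs n 0 1) (hint _ 0 1) (hgreen n 0 1)
      (hmem n 0 1 ((legendre n).eval 0) (by simp [sphericalFun_zero_one, hG0]))
    simpa [sphericalFun_zero_one] using this
  refine ⟨w, hκ, hκ0, hμ, hac, hac', hL2, fun n => finite_legendreSystem G n, ?_, ?_, ?_, ?_⟩
  · rintro ⟨n, hn⟩ e (rfl | ⟨k, h1, hk, rfl | rfl⟩)
    · exact hsol0 n hn
    · exact hsol n k _ hn h1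
    · exact hsol n k _ hn h1
  · -- the sectorial harmonic of degree `n` does not vanish at `(0, 0)`
    rintro ⟨n, hn⟩
    refine ⟨_, Or.inr ⟨n, hn, le_rfl, Or.inl rfl⟩, fun h => ?_⟩
    have h1 := Measure.eqOn_open_of_ae_eq h (isOpen_strip w.isOpen) (hcont _ n 1)
      continuousOn_const (x := ((0 : ℝ), (0 : ℝ))) ⟨mem_univ _, w.zero_mem⟩
    simp only [sphericalFun, hG00, one_pow, mul_one, Complex.one_re, Pi.zero_apply] at h1
    exact iterate_derivative_legendre_self_eval_ne_zero n _ h1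
  · rintro ⟨n, hn⟩ ⟨m, hm⟩ h
    exact Subtype.ext (hlam n m h)
  · intro v hv hv0 hE
    have hvi := hv.integrable one_le_two
    have hvs : ∀ q k c, Integrable (fun p => v p * sphericalFun q k c (G p)) μ := fun q k c =>
      integrable_mul_comp_sphere hG (hμS.mono hGs) hvi (continuous_sphericalFun q k c)
    refine ae_eq_zero_of_integral_legendre hcell hμS hG hinj hGs hvi fun n k c hk => ?_
    have key : ∫ p, v p * sphericalFun (derivative^[k] (legendre n)) k 1 (G p) ∂μ = 0 ∧
        (1 ≤ k → ∫ p, v p * sphericalFun (derivative^[k] (legendre n)) k (-Complex.I) (G p) ∂μ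
          = 0) := by
      rcases Nat.eq_zero_or_pos k with rfl | hk0
      · refine ⟨?_, by simp⟩
        simp only [Function.iterate_zero, id_eq, sphericalFun_zero_one]
        rcases Nat.eq_zero_or_pos n with rfl | hn
        · have : legendre 0 = 1 := by simp [legendre]
          simpa [this] using hv0
        · have h1 := hE ⟨n, hn⟩ _ (Or.inl rfl)
          simp only [mul_sub] at h1
          have h2 := hvs (legendre n) 0 1
          simp only [sphericalFun_zero_one] at h2
          rwa [integral_sub h2 (hvi.mul_const _), integral_mul_const, hv0, zero_mul, sub_zero]
            at h1
      · have hn : 1 ≤ n := hk0.trans_le hk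
        exact ⟨hE ⟨n, hn⟩ _ (Or.inr ⟨k, hk0, hk, Or.inl rfl⟩),
          fun _ => hE ⟨n, hn⟩ _ (Or.inr ⟨k, hk0, hk, Or.inr rfl⟩)⟩
    have key2 : c.im * ∫ p, v p * sphericalFun (derivative^[k] (legendre n)) k (-Complex.I) (G p) ∂μ
        = 0 ∨ k = 0 := by
      rcases Nat.eq_zero_or_pos k with rfl | hk0
      · exact Or.inr rfl
      · exact Or.inl (by rw [key.2 hk0, mul_zero])
    have hsplit : ∫ p, v p * sphericalFun (derivative^[k] (legendre n)) k c (G p) ∂μ =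
        c.re * ∫ p, v p * sphericalFun (derivative^[k] (legendre n)) k 1 (G p) ∂μ -
        c.im * ∫ p, v p * sphericalFun (derivative^[k] (legendre n)) k (-Complex.I) (G p) ∂μ := by
      rw [← integral_const_mul, ← integral_const_mul,
        ← integral_sub ((hvs _ k 1).const_mul _) ((hvs _ k _).const_mul _)]
      refine integral_congr_ae (.of_forall fun p => ?_)
      simp only []
      rw [sphericalFun_eq_re_im _ _ c]
      ring
    rw [hsplit, key.1, mul_zero, zero_sub, neg_eq_zero]
    rcases key2 with h | rfl
    · exact h
    · simp [sphericalFun]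

end Problem

end LegendreSystem

/-! ### Decay, injectivity and normalisation on the cylinder -/

section Cylinder

open Polynomial

theorem norm_fst_le_one {w : ℂ × ℝ} (hw : w ∈ unitSphere) : ‖w.1‖ ≤ 1 := by
  have h : Complex.normSq w.1 + w.2 ^ 2 = 1 := hw
  rw [Complex.normSq_eq_norm_sq] at h
  nlinarith [norm_nonneg w.1, sq_nonneg w.2]

theorem snd_mem_Icc {w : ℂ × ℝ} (hw : w ∈ unitSphere) : w.2 ∈ Icc (-1 : ℝ) 1 := by
  have h : Complex.normSq w.1 + w.2 ^ 2 = 1 := hw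
  exact abs_le.1 ((sq_le_one_iff_abs_le_one _).1 (by linarith [Complex.normSq_nonneg w.1]))

/-- The derivative of a spherical function along a curve in the sphere is bounded by the speed. -/
theorem exists_abs_line_deriv_le (q : ℝ[X]) (k : ℕ) (c : ℂ) :
    ∃ M, 0 ≤ M ∧ ∀ w ∈ unitSphere, ∀ (d : ℝ) (e : ℂ) (r : ℝ), 0 ≤ r →
      Complex.normSq e + d ^ 2 ≤ r ^ 2 →
      |(c * ((((derivative q).eval w.2 * d : ℝ) : ℂ) * w.1 ^ k +
        ((q.eval w.2 : ℝ) : ℂ) * (k * w.1 ^ (k - 1) * e))).re| ≤ M * r := by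
  obtain ⟨M₀, h₀⟩ := (isCompact_Icc (a := (-1 : ℝ)) (b := 1)).exists_bound_of_continuousOn
    q.continuous.continuousOn
  obtain ⟨M₁, h₁⟩ := (isCompact_Icc (a := (-1 : ℝ)) (b := 1)).exists_bound_of_continuousOn
    (derivative q).continuous.continuousOn
  have hm0 : 0 ≤ M₀ := (norm_nonneg _).trans (h₀ 0 (by simp))
  have hm1 : 0 ≤ M₁ := (norm_nonneg _).trans (h₁ 0 (by simp))
  refine ⟨‖c‖ * (M₁ + M₀ * k), by positivity, fun w hw d e r hr h => ?_⟩
  have hz := norm_fst_le_one hw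
  have hd : |d| ≤ r := abs_le_of_sq_le_sq (by linarith [Complex.normSq_nonneg e]) hr
  have he : ‖e‖ ≤ r := by
    rw [Complex.normSq_eq_norm_sq] at h
    exact le_of_sq_le_sq (by nlinarith [sq_nonneg d]) hr
  have hA : ‖(((derivative q).eval w.2 * d : ℝ) : ℂ) * w.1 ^ k‖ ≤ M₁ * r := by
    rw [norm_mul, norm_pow, Complex.norm_real, norm_mul]
    calc ‖(derivative q).eval w.2‖ * ‖d‖ * ‖w.1‖ ^ k ≤ M₁ * r * 1 := by
          gcongr
          · exact h₁ _ (snd_mem_Icc hw)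
          · exact hd
          · exact pow_le_one₀ (norm_nonneg _) hz
      _ = M₁ * r := mul_one _
  have hB : ‖((q.eval w.2 : ℝ) : ℂ) * (k * w.1 ^ (k - 1) * e)‖ ≤ M₀ * k * r := by
    rw [norm_mul, norm_mul, norm_mul, norm_pow, Complex.norm_real, Complex.norm_natCast]
    calc ‖q.eval w.2‖ * (k * ‖w.1‖ ^ (k - 1) * ‖e‖) ≤ M₀ * (k * 1 * r) := by
          gcongr
          · exact h₀ _ (snd_mem_Icc hw)
          · exact pow_le_one₀ (norm_nonneg _) hz
      _ = M₀ * k * r := by ring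
  calc _ ≤ ‖c‖ * (M₁ * r + M₀ * k * r) := by
        refine (Complex.abs_re_le_norm _).trans ?_
        rw [norm_mul]
        gcongr
        exact (norm_add_le _ _).trans (add_le_add hA hB)
    _ = ‖c‖ * (M₁ + M₀ * k) * r := by ring

theorem sphereMap_periodic (ε : ℝ) (p : ℝ × ℝ) :
    sphereMap ε (p.1 + 2 * π, p.2) = sphereMap ε p := by
  simp [sphereMap, xiFun, etaFun, gammaFun]

theorem conformalFactor_periodic (ε : ℝ) (p : ℝ × ℝ) :
    conformalFactor ε (p.1 + 2 * π, p.2) = conformalFactor ε p := by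
  simp [conformalFactor]

variable {ε : ℝ} (hε0 : 0 ≤ ε) (hε1 : ε < 1)

include hε0 hε1

/-- The curves `y = const` on the sphere have speed `√ρ`. -/
theorem normSq_zDerivFst_add (p : ℝ × ℝ) :
    Complex.normSq (zDerivFst ε (sphereMap ε p)) + gammaDerivFst ε (sphereMap ε p) ^ 2 =
      conformalFactor ε p := by
  have hb0 := (sqrt_one_sub_sq_pos hε0 hε1).ne'
  have hb2 := sq_sqrt_one_sub_sq hε0 hε1
  have hρ := conformalFactor_eq hε0 hε1 p
  have hsph := xi_sq_add hε0 hε1 p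
  rw [zDerivFst, gammaDerivFst, map_div₀, Complex.normSq_ofReal, Complex.normSq_apply]
  simp only [sphereMap, Complex.add_re, Complex.sub_re, Complex.mul_re, Complex.I_re, Complex.I_im,
    Complex.ofReal_re, Complex.ofReal_im, Complex.add_im, Complex.sub_im, Complex.mul_im]
  rw [← hb2] at hρ
  field_simp
  linear_combination (ε ^ 2 * etaFun ε p ^ 2 + √(1 - ε ^ 2) ^ 2) * hsph - hρ +
    (1 - xiFun ε p ^ 2 - etaFun ε p ^ 2) * hb2

/-- The curves `x = const` on the sphere have speed `√ρ`. -/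
theorem normSq_zDerivSnd_add (p : ℝ × ℝ) :
    Complex.normSq (zDerivSnd ε (sphereMap ε p)) + gammaDerivSnd ε (sphereMap ε p) ^ 2 =
      conformalFactor ε p := by
  have hb0 := (sqrt_one_sub_sq_pos hε0 hε1).ne'
  have hb2 := sq_sqrt_one_sub_sq hε0 hε1
  have hρ := conformalFactor_eq hε0 hε1 p
  have hsph := xi_sq_add hε0 hε1 p
  rw [zDerivSnd, gammaDerivSnd, map_div₀, Complex.normSq_ofReal, Complex.normSq_apply]
  simp only [sphereMap, Complex.neg_re, Complex.neg_im, Complex.sub_re, Complex.mul_re,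
    Complex.ofReal_re, Complex.ofReal_im, Complex.sub_im, Complex.mul_im]
  rw [← hb2] at hρ
  field_simp
  linear_combination gammaFun ε p ^ 2 * hsph - hρ + gammaFun ε p ^ 2 * hb2

/-- The gradient of a spherical function on the cylinder decays exponentially. -/
theorem exists_gradient_decay (q : ℝ[X]) (k : ℕ) (c : ℂ) : ∃ C, 0 ≤ C ∧ ∀ p,
    |fderiv ℝ (fun p => sphericalFun q k c (sphereMap ε p)) p (1, 0)| ≤ C * exp (-|p.2|) ∧
    |fderiv ℝ (fun p => sphericalFun q k c (sphereMap ε p)) p (0, 1)| ≤ C * exp (-|p.2|) := by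
  obtain ⟨M, hM, h⟩ := exists_abs_line_deriv_le q k c
  have h1 : 0 < 1 - ε := sub_pos.2 hε1
  refine ⟨M * (2 / (1 - ε)), by positivity, fun p => ?_⟩
  have hρ := conformalFactor_le hε0 hε1 p
  have hr : 0 ≤ 2 / (1 - ε) * exp (-|p.2|) := by positivity
  have hw := sphereMap_mem hε0 hε1 p
  have hx := h _ hw _ _ _ hr ((normSq_zDerivFst_add hε0 hε1 p).trans_le hρ)
  have hy := h _ hw _ _ _ hr ((normSq_zDerivSnd_add hε0 hε1 p).trans_le hρ)
  rw [← mul_assoc M] at hx hy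
  rw [fderiv_sphericalFun_fst hε0 hε1, fderiv_sphericalFun_snd hε0 hε1]
  exact ⟨hx, hy⟩

omit hε0 hε1 in
theorem finiteEnergy_of_gradient_decay {e : ℝ × ℝ → ℝ} {C : ℝ} (he : ContDiff ℝ ∞ e)
    (hper : ∀ p : ℝ × ℝ, e (p.1 + 2 * π, p.2) = e p)
    (h : ∀ p, |fderiv ℝ e p (1, 0)| ≤ C * exp (-|p.2|) ∧
      |fderiv ℝ e p (0, 1)| ≤ C * exp (-|p.2|)) :
    FiniteEnergy univ (fun _ => 1) (fun _ => 1) e := by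
  have key : ∀ f : ℝ × ℝ → ℝ, Continuous f → (∀ p, |f p| ≤ C * exp (-|p.2|)) →
      IntegrableOn (fun p => f p ^ 2) (cell univ) := fun f hf hb => by
    refine (integrableOn_exp_neg_abs.const_mul (C ^ 2)).mono'
      (hf.pow 2).aestronglyMeasurable (.of_forall fun p => ?_)
    have h2 : exp (-|p.2|) ≤ 1 := exp_le_one_iff.2 (by simp)
    have h3 := exp_pos (-|p.2|)
    rw [norm_of_nonneg (sq_nonneg _), ← sq_abs]
    calc |f p| ^ 2 ≤ (C * exp (-|p.2|)) ^ 2 := by gcongr; exact hb p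
      _ = C ^ 2 * (exp (-|p.2|) * exp (-|p.2|)) := by ring
      _ ≤ C ^ 2 * (exp (-|p.2|) * 1) := by gcongr
      _ = _ := by rw [mul_one]
  have hU := isOpen_strip isOpen_univ
  have h1 := (hasWeakDeriv_of_contDiffOn hU he.contDiffOn (1, 0)).weakDeriv_ae_eq hU
  have h2 := (hasWeakDeriv_of_contDiffOn hU he.contDiffOn (0, 1)).weakDeriv_ae_eq hU
  refine ⟨.of_forall hper, weaklyDifferentiable_of_contDiffOn isOpen_univ he.contDiffOn, ?_, ?_⟩
  · refine (key _ (contDiff_fderiv_apply he (1, 0)).continuous fun p => (h p).1).congr ?_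
    filter_upwards [ae_restrict_cell h1] with p hp
    rw [D₁, hp, one_mul]
  · refine (key _ (contDiff_fderiv_apply he (0, 1)).continuous fun p => (h p).2).congr ?_
    filter_upwards [ae_restrict_cell h2] with p hp
    rw [D₂, hp, one_mul]

theorem finiteEnergy_sphericalFun (q : ℝ[X]) (k : ℕ) (c : ℂ) :
    FiniteEnergy univ (fun _ => 1) (fun _ => 1) fun p => sphericalFun q k c (sphereMap ε p) := by
  obtain ⟨C, -, hC⟩ := exists_gradient_decay hε0 hε1 q k c
  exact finiteEnergy_of_gradient_decay (contDiff_sphericalFun_comp hε0 hε1 q k c)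
    (fun p => by rw [sphereMap_periodic]) hC

theorem conformalFactor_decay (p : ℝ × ℝ) :
    conformalFactor ε p ≤ (2 / (1 - ε)) ^ 2 * exp (-|p.2|) := by
  have h2 : exp (-|p.2|) ≤ 1 := exp_le_one_iff.2 (by simp)
  have h3 := exp_pos (-|p.2|)
  calc _ ≤ _ := conformalFactor_le hε0 hε1 p
    _ = (2 / (1 - ε)) ^ 2 * (exp (-|p.2|) * exp (-|p.2|)) := by ring
    _ ≤ (2 / (1 - ε)) ^ 2 * (exp (-|p.2|) * 1) := by gcongr
    _ = _ := by rw [mul_one]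

/-- The spherical harmonics of degree `n` are eigenfunctions of the Dirichlet form with respect to
`g'(ψ_ε) dx dy`. -/
theorem energyForm_sphericalFun (n k : ℕ) (c : ℂ) {φ : ℝ × ℝ → ℝ}
    (hφ : FiniteEnergy univ (fun _ => 1) (fun _ => 1) φ) :
    energyForm univ (fun _ => 1) (fun _ => 1)
      (fun p => sphericalFun (derivative^[k] (legendre n)) k c (sphereMap ε p)) φ =
    n * (n + 1) / 2 * ∫ p in cell univ,
      gPrime ε p * (sphericalFun (derivative^[k] (legendre n)) k c (sphereMap ε p) * φ p) := by
  set q := derivative^[k] (legendre n)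
  obtain ⟨C, hC0, hC⟩ := exists_gradient_decay hε0 hε1 q k c
  obtain ⟨M, hM⟩ := isCompact_unitSphere.exists_bound_of_continuousOn
    (continuous_sphericalFun q k c).continuousOn
  have hs := contDiff_sphericalFun_comp hε0 hε1 q k c
  set e := fun p => sphericalFun q k c (sphereMap ε p)
  set B := n * (n + 1) * ((2 / (1 - ε)) ^ 2 * M) with hB
  have hM0 : 0 ≤ M := (norm_nonneg _).trans (hM _ (sphereMap_mem hε0 hε1 (0, 0)))
  have hmax : ∀ p : ℝ × ℝ, C * exp (-|p.2|) ≤ max C B * exp (-|p.2|) := fun p => by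
    gcongr
    exact le_max_left _ _
  rw [FiniteEnergy.energyForm_eq_integral (L := fun p => n * (n + 1) * conformalFactor ε p * e p)
    (C := max C B) hs (fun p => by simp only [e, sphereMap_periodic])
    (fun p => (hC p).1.trans (hmax p)) (fun p => (hC p).2.trans (hmax p)) _ _ _ _ hφ]
  · rw [← integral_const_mul]
    refine integral_congr_ae (.of_forall fun p => ?_)
    simp only [gPrime_eq hε0 hε1]
    ring
  · exact (continuous_const.mul (contDiff_conformalFactor hε0 hε1).continuous).mul hs.continuous
  · intro p
    have h1 : |e p| ≤ M := hM _ (sphereMap_mem hε0 hε1 p)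
    rw [abs_mul, abs_of_nonneg (mul_nonneg (by positivity) (conformalFactor_pos hε0 hε1 p).le)]
    calc n * (n + 1) * conformalFactor ε p * |e p|
        ≤ n * (n + 1) * ((2 / (1 - ε)) ^ 2 * exp (-|p.2|)) * M := by
          gcongr
          exact conformalFactor_decay hε0 hε1 p
      _ = B * exp (-|p.2|) := by rw [hB]; ring
      _ ≤ _ := by gcongr; exact le_max_right _ _
  · exact .of_forall fun p => by simp only [e, sphereMap_periodic, conformalFactor_periodic]
  · exact laplacian_legendre hε0 hε1 n k c

omit hε0 hε1 in
theorem eq_of_cos_eq_of_sin_eq {x x' : ℝ} (hx : x ∈ Ioc 0 (2 * π)) (hx' : x' ∈ Ioc 0 (2 * π))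
    (hc : cos x = cos x') (hs : sin x = sin x') : x = x' := by
  obtain ⟨k, hk⟩ := Real.Angle.angle_eq_iff_two_pi_dvd_sub.1 (Real.Angle.cos_sin_inj hc hs)
  have hπ := Real.two_pi_pos
  have h1 : (k : ℝ) < 1 := by
    by_contra! h
    nlinarith [hx.2, hx'.1]
  have h2 : (-1 : ℝ) < k := by
    by_contra! h
    nlinarith [hx'.2, hx.1]
  have h3 : k = 0 := by
    have h1' : k < 1 := by exact_mod_cast h1
    have h2' : -1 < k := by exact_mod_cast h2
    omega
  rw [h3, Int.cast_zero, mul_zero, sub_eq_zero] at hk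
  exact hk

theorem injOn_sphereMap : InjOn (sphereMap ε) (cell univ) := by
  rintro ⟨x, y⟩ ⟨hx, -⟩ ⟨x', y'⟩ ⟨hx', -⟩ h
  have hξ : xiFun ε (x, y) = xiFun ε (x', y') := congrArg (fun w : ℂ × ℝ => w.1.re) h
  have hη : etaFun ε (x, y) = etaFun ε (x', y') := congrArg (fun w : ℂ × ℝ => w.1.im) h
  have hγ : gammaFun ε (x, y) = gammaFun ε (x', y') := congrArg (fun w : ℂ × ℝ => w.2) h
  have hb := sqrt_one_sub_sq_pos hε0 hε1
  have hb2 := one_sub_sq_pos hε0 hε1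
  have hD := denom_pos hε0 hε1 (x, y)
  have hD' := denom_pos hε0 hε1 (x', y')
  simp only at hD hD'
  rw [gammaFun, gammaFun, div_eq_div_iff hD.ne' hD'.ne'] at hγ
  rw [etaFun, etaFun, div_eq_div_iff hD.ne' hD'.ne'] at hη
  rw [xiFun, xiFun, div_eq_div_iff hD.ne' hD'.ne'] at hξ
  simp only at hγ hη hξ
  set D := cosh y + ε * cos x with hDdef
  set D' := cosh y' + ε * cos x' with hDdef'
  have hγ' : sinh y * D' = sinh y' * D := mul_left_cancel₀ hb.ne' (by linarith)
  have hη' : sin x * D' = sin x' * D := mul_left_cancel₀ hb.ne' (by linarith)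
  -- `1 - ε ξ` is the ratio of `cosh y` to the denominator, up to a constant
  have hc : cosh y * D' = cosh y' * D := by
    refine mul_left_cancel₀ hb2.ne' ?_
    rw [hDdef, hDdef'] at hξ ⊢
    linear_combination -ε * hξ
  have hyy : y = y' := by
    have h1 : sinh (y - y') * D' = 0 := by
      rw [sinh_sub]
      linear_combination cosh y' * hγ' - sinh y' * hc
    have h2 := sinh_eq_zero.1 ((mul_eq_zero.1 h1).resolve_right hD'.ne')
    linarith
  have hDD : D' = D := mul_left_cancel₀ (cosh_pos y).ne' (by rw [hc, hyy])
  have hxx : x = x' := by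
    refine eq_of_cos_eq_of_sin_eq hx hx' ?_ ?_
    · rw [hDD] at hξ
      have := mul_right_cancel₀ hD.ne' hξ
      rw [hyy] at this
      linarith
    · rw [hDD] at hη'
      exact mul_right_cancel₀ hD.ne' hη'
  rw [hxx, hyy]

theorem weight_pos (x : ℝ) : 0 < 1 + ε * cos x := by
  simpa using denom_pos hε0 hε1 (x, 0)

theorem continuous_weight : Continuous fun x : ℝ => 1 / (1 + ε * cos x) :=
  continuous_const.div (by fun_prop) fun x => (weight_pos hε0 hε1 x).ne'

/-- On the circle `y = 0` the map `ξ + iη` has speed `√(1-ε²) / (1 + ε cos x)`, so that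
`1 / (1 + ε cos x)` times a spherical function of nonzero order is a derivative. -/
theorem hasDerivAt_sphericalFun_trace (q : ℝ[X]) {k : ℕ} (hk : 1 ≤ k) (c : ℂ) (x : ℝ) :
    HasDerivAt (fun x => sphericalFun q k (-Complex.I * c / (k * (√(1 - ε ^ 2) : ℝ)))
        (sphereMap ε (x, 0)))
      (sphericalFun q k c (sphereMap ε (x, 0)) * (1 / (1 + ε * cos x))) x := by
  have hb0 := (sqrt_one_sub_sq_pos hε0 hε1).ne'
  have hb2 := sq_sqrt_one_sub_sq hε0 hε1
  have hk0 : (k : ℂ) ≠ 0 := by exact_mod_cast (by omega : k ≠ 0)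
  have hw := (weight_pos hε0 hε1 x).ne'
  have hsph := xi_sq_add hε0 hε1 (x, 0)
  have hγ : gammaFun ε (x, 0) = 0 := by simp [gammaFun]
  have hξ : 1 - ε * xiFun ε (x, 0) = √(1 - ε ^ 2) ^ 2 * (1 / (1 + ε * cos x)) := by
    rw [xiFun, hb2]
    simp only [cosh_zero]
    field_simp
    ring
  set b := √(1 - ε ^ 2) with hb
  set κ := 1 / (1 + ε * cos x)
  refine (hasDerivAt_sphericalFun_line q k _ (hasDerivAt_g_fst hε0 hε1 x 0)
    (hasDerivAt_z_fst hε0 hε1 x 0)).congr_deriv ?_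
  set w := sphereMap ε (x, 0) with hwdef
  have hz : zDerivFst ε w = Complex.I * b * κ * w.1 := by
    have hbC : (b : ℂ) ≠ 0 := by exact_mod_cast hb0
    rw [zDerivFst, ← hb, div_eq_iff hbC]
    rw [hγ] at hsph
    apply Complex.ext
    · simp [hwdef, sphereMap]
      linear_combination -etaFun ε (x, 0) * hξ
    · simp [hwdef, sphereMap]
      linear_combination ε * hsph + xiFun ε (x, 0) * hξ
  have hg : gammaDerivFst ε w = 0 := by
    have : w.2 = 0 := hγ
    rw [gammaDerivFst, this, mul_zero, zero_mul, zero_div]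
  have hR : sphericalFun q k c w * κ = (((q.eval w.2 * κ : ℝ) : ℂ) * (c * w.1 ^ k)).re := by
    rw [Complex.re_ofReal_mul, sphericalFun]
    ring
  rw [hg, hz, hR]
  congr 1
  have hbC : (b : ℂ) ≠ 0 := by exact_mod_cast hb0
  have hzk : w.1 ^ k = w.1 ^ (k - 1) * w.1 := by rw [← pow_succ, Nat.sub_add_cancel hk]
  rw [hzk]
  push_cast
  field_simp
  linear_combination (-(c * κ * w.1 * q.eval w.2 * w.1 ^ (k - 1) * k * b) : ℂ) * Complex.I_sq

theorem integral_sphericalFun_trace (q : ℝ[X]) (k : ℕ) (c : ℂ) (hk : 1 ≤ k) :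
    ∫ x in (0)..(2 * π), sphericalFun q k c (sphereMap ε (x, 0)) * (1 / (1 + ε * cos x)) = 0 := by
  have hc : Continuous fun x : ℝ => sphericalFun q k c (sphereMap ε (x, 0)) :=
    (contDiff_sphericalFun_comp hε0 hε1 q k c).continuous.comp (by fun_prop)
  rw [intervalIntegral.integral_eq_sub_of_hasDerivAt
    (fun x _ => hasDerivAt_sphericalFun_trace hε0 hε1 q hk c x)
    ((hc.mul (continuous_weight hε0 hε1)).intervalIntegrable _ _)]
  have := sphereMap_periodic ε (0, 0)
  rw [zero_add] at this
  simp only [this, sub_self]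

theorem continuous_sphereMap : Continuous (sphereMap ε) := by
  have hz : Continuous fun p => (sphereMap ε p).1 := by
    have : (fun p => (sphereMap ε p).1) =
        fun p => (xiFun ε p : ℂ) + etaFun ε p * Complex.I := by
      ext p
      exact (Complex.re_add_im (sphereMap ε p).1).symm
    rw [this]
    exact (Complex.continuous_ofReal.comp (contDiff_xiFun hε0 hε1).continuous).add
      ((Complex.continuous_ofReal.comp (contDiff_etaFun hε0 hε1).continuous).mul continuous_const)
  exact hz.prodMk (contDiff_gammaFun hε0 hε1).continuous

end Cylinder

/-! ### Longitude and height -/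

section Identification

open Polynomial

/-- The point of the unit sphere with longitude `θ` and height `γ`, as an element of `ℂ × ℝ`. -/
def sphereCoords (p : ℝ × ℝ) : ℂ × ℝ := ((√(1 - p.2 ^ 2) : ℝ) * Complex.exp (p.1 * Complex.I), p.2)

theorem sphereCoords_fst_pow (p : ℝ × ℝ) (k : ℕ) : (sphereCoords p).1 ^ k =
    ((√(1 - p.2 ^ 2) ^ k : ℝ) : ℂ) * (cos (k * p.1) + sin (k * p.1) * Complex.I) := by
  rw [sphereCoords, mul_pow, ← Complex.exp_nat_mul]
  congr 1
  · push_cast; rfl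
  · rw [← mul_assoc, Complex.exp_mul_I]
    push_cast
    rfl

theorem sphericalFun_sphereCoords_one (n k : ℕ) (p : ℝ × ℝ) :
    sphericalFun (derivative^[k] (legendre n)) k 1 (sphereCoords p) =
      assocLegendre n k p.2 * cos (k * p.1) := by
  rw [sphericalFun, sphereCoords_fst_pow, one_mul, Complex.re_ofReal_mul, assocLegendre]
  simp [sphereCoords, -Complex.ofReal_cos, -Complex.ofReal_sin]
  ring

theorem sphericalFun_sphereCoords_neg_I (n k : ℕ) (p : ℝ × ℝ) :
    sphericalFun (derivative^[k] (legendre n)) k (-Complex.I) (sphereCoords p) =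
      assocLegendre n k p.2 * sin (k * p.1) := by
  rw [sphericalFun, sphereCoords_fst_pow, mul_left_comm, Complex.re_ofReal_mul, assocLegendre]
  simp [sphereCoords, -Complex.ofReal_cos, -Complex.ofReal_sin]
  ring

theorem eigenfunctionsY_eq (n : ℕ) : eigenfunctionsY n = legendreSystem sphereCoords n := by
  simp only [eigenfunctionsY, legendreSystem, sphericalFun_sphereCoords_one,
    sphericalFun_sphereCoords_neg_I]
  rfl

variable {ε : ℝ} (hε0 : 0 ≤ ε) (hε1 : ε < 1)

include hε0 hε1

/-- `(θ_ε, γ_ε)` are the longitude and the height of the point `(ξ_ε, η_ε, γ_ε)` of the sphere. -/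
theorem sphereCoords_theta_gamma (p : ℝ × ℝ) :
    sphereCoords (thetaFun ε p, gammaFun ε p) = sphereMap ε p := by
  have hsph := xi_sq_add hε0 hε1 p
  have h1 : 1 - gammaFun ε p ^ 2 = xiFun ε p ^ 2 + etaFun ε p ^ 2 := by linarith
  have h2 : 0 ≤ 1 - gammaFun ε p ^ 2 := by rw [h1]; positivity
  set r := √(1 - gammaFun ε p ^ 2) with hr
  have hr2 : r ^ 2 = xiFun ε p ^ 2 + etaFun ε p ^ 2 := by rw [hr, sq_sqrt h2, h1]
  have hr0 : 0 ≤ r := sqrt_nonneg _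
  have hmain : r * cos (thetaFun ε p) = xiFun ε p ∧ r * sin (thetaFun ε p) = etaFun ε p := by
    rcases hr0.eq_or_lt with h0 | h0
    · rw [← h0] at hr2 ⊢
      have hξ : xiFun ε p = 0 := by nlinarith [sq_nonneg (xiFun ε p), sq_nonneg (etaFun ε p)]
      have hη : etaFun ε p = 0 := by nlinarith [sq_nonneg (xiFun ε p), sq_nonneg (etaFun ε p)]
      simp [hξ, hη]
    · have hab : |xiFun ε p / r| ≤ 1 := by
        rw [abs_div, abs_of_pos h0, div_le_one h0]
        exact abs_le_of_sq_le_sq (by nlinarith [sq_nonneg (etaFun ε p)]) hr0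
      have hc : cos (arccos (xiFun ε p / r)) = xiFun ε p / r :=
        cos_arccos (abs_le.1 hab).1 (abs_le.1 hab).2
      have hs : sin (arccos (xiFun ε p / r)) = |etaFun ε p| / r := by
        have h3 : (1 - (xiFun ε p / r) ^ 2) * r ^ 2 = etaFun ε p ^ 2 := by
          rw [div_pow, sub_mul, div_mul_cancel₀ _ (pow_pos h0 2).ne', hr2]
          ring
        have h4 : 0 ≤ 1 - (xiFun ε p / r) ^ 2 :=
          sub_nonneg.2 ((sq_le_one_iff_abs_le_one _).2 hab)
        rw [sin_arccos, ← sqrt_sq_eq_abs, eq_div_iff h0.ne', ← h3, sqrt_mul h4, sqrt_sq hr0]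
      have hsgn : ∀ {x : ℝ}, etaFun ε p = √(1 - ε ^ 2) * x / (cosh p.2 + ε * cos p.1) →
          (0 ≤ x → 0 ≤ etaFun ε p) ∧ (x ≤ 0 → etaFun ε p ≤ 0) := fun {x} hx => by
        have hD := denom_pos hε0 hε1 p
        have hb := sqrt_one_sub_sq_pos hε0 hε1
        rw [hx]
        exact ⟨fun h => by positivity, fun h =>
          div_nonpos_of_nonpos_of_nonneg (mul_nonpos_of_nonneg_of_nonpos hb.le h) hD.le⟩
      rw [thetaFun, ← hr]
      split_ifs with hx
      · rw [hc, hs, abs_of_nonneg ((hsgn rfl).1 hx)]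
        constructor <;> field_simp
      · rw [cos_two_pi_sub, sin_two_pi_sub, hc, hs, abs_of_nonpos ((hsgn rfl).2 (not_le.1 hx).le)]
        constructor <;> field_simp
  refine Prod.ext ?_ rfl
  simp only [sphereCoords, sphereMap, ← hr]
  rw [Complex.exp_mul_I, ← Complex.ofReal_cos, ← Complex.ofReal_sin]
  apply Complex.ext
  · simpa [-Complex.ofReal_cos, -Complex.ofReal_sin] using hmain.1
  · simpa [-Complex.ofReal_cos, -Complex.ofReal_sin] using hmain.2

theorem eigenfunctionsX_eq (n : ℕ) : eigenfunctionsX ε n = legendreSystem (sphereMap ε) n := by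
  rw [eigenfunctionsX, eigenfunctionsY_eq]
  refine (image_legendreSystem sphereCoords (fun p => (thetaFun ε p, gammaFun ε p)) n).trans ?_
  simp only [sphereCoords_theta_gamma hε0 hε1]

end Identification

/-! ### The eigenvalue problem on the cylinder -/

section VortexMeasure

variable {ε : ℝ}

/-- The measure `g'(ψ_ε) dx dy` on a period cell. -/
def vortexMeasure (ε : ℝ) : Measure (ℝ × ℝ) :=
  (volume.restrict (cell univ)).withDensity fun p => ENNReal.ofReal (gPrime ε p)

theorem gPrime_pos (ε : ℝ) (p : ℝ × ℝ) : 0 < gPrime ε p := by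
  rw [gPrime]
  positivity

theorem measurable_gPrime (ε : ℝ) : Measurable (gPrime ε) := by
  unfold gPrime streamFunction
  fun_prop

theorem integral_vortexMeasure (f : ℝ × ℝ → ℝ) :
    ∫ p, f p ∂vortexMeasure ε = ∫ p in cell univ, gPrime ε p * f p := by
  rw [vortexMeasure, integral_withDensity_eq_integral_toReal_smul
    (measurable_gPrime ε).ennreal_ofReal (.of_forall fun _ => ENNReal.ofReal_lt_top)]
  simp only [ENNReal.toReal_ofReal (gPrime_pos ε _).le, smul_eq_mul]

theorem integrable_vortexMeasure {f : ℝ × ℝ → ℝ} :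
    Integrable f (vortexMeasure ε) ↔ IntegrableOn (fun p => gPrime ε p * f p) (cell univ) := by
  rw [vortexMeasure, integrable_withDensity_iff_integrable_smul'
    (measurable_gPrime ε).ennreal_ofReal (.of_forall fun _ => ENNReal.ofReal_lt_top)]
  simp only [ENNReal.toReal_ofReal (gPrime_pos ε _).le, smul_eq_mul]
  rfl

theorem vortexMeasure_ac : vortexMeasure ε ≪ volume.restrict (cell univ) :=
  withDensity_absolutelyContinuous _ _

theorem ac_vortexMeasure : volume.restrict (cell univ) ≪ vortexMeasure ε :=
  withDensity_absolutelyContinuous' (measurable_gPrime ε).ennreal_ofReal.aemeasurable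
    (.of_forall fun p => (ENNReal.ofReal_pos.2 (gPrime_pos ε p)).ne')

theorem projX_eq (ψ : ℝ × ℝ → ℝ) : projX ε ψ = ⨍ p, ψ p ∂vortexMeasure ε := by
  have h : (vortexMeasure ε).real univ = ∫ p in cell univ, gPrime ε p := by
    have := integral_vortexMeasure (ε := ε) fun _ => 1
    simpa using this
  rw [projX, average_eq, integral_vortexMeasure, h, smul_eq_mul, div_eq_inv_mul]

theorem memX_iff (ψ : ℝ × ℝ → ℝ) : MemX ε ψ ↔
    MemEnergy univ (fun _ => 1) (fun _ => 1) (fun x => 1 / (1 + ε * cos x)) ψ := by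
  constructor
  · rintro ⟨h1, h2, h3, h4, h5⟩
    exact ⟨⟨h1, h2, by simpa using h3, by simpa using h4⟩, h5⟩
  · rintro ⟨⟨h1, h2, h3, h4⟩, h5⟩
    exact ⟨h1, h2, by simpa using h3, by simpa using h4, h5⟩

theorem dirichletX_eq (ψ φ : ℝ × ℝ → ℝ) :
    dirichletX ψ φ = energyForm univ (fun _ => 1) (fun _ => 1) ψ φ := by
  simp [dirichletX, energyForm]

theorem integral_gPrime_mul_sub_projX (ψ φ : ℝ × ℝ → ℝ) :
    ∫ p in cell univ, gPrime ε p * (ψ p - projX ε ψ) * φ p =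
      ∫ p, (ψ p - ⨍ q, ψ q ∂vortexMeasure ε) * φ p ∂vortexMeasure ε := by
  rw [integral_vortexMeasure, projX_eq]
  simp only [mul_assoc]

theorem solvesX_iff (l : ℝ) (ψ : ℝ × ℝ → ℝ) : SolvesX ε l ψ ↔
    IsWeakSolution univ (fun _ => 1) (fun _ => 1) (fun x => 1 / (1 + ε * cos x))
      (vortexMeasure ε) l ψ := by
  have h : ∀ φ, dirichletX ψ φ =
      l * ∫ p in cell univ, gPrime ε p * (ψ p - projX ε ψ) * φ p ↔
      energyForm univ (fun _ => 1) (fun _ => 1) ψ φ =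
        l * ∫ p, (ψ p - ⨍ q, ψ q ∂vortexMeasure ε) * φ p ∂vortexMeasure ε := fun φ => by
    rw [integral_gPrime_mul_sub_projX, dirichletX_eq]
  constructor
  · rintro ⟨h1, h2⟩
    exact ⟨(memX_iff ψ).1 h1, fun φ hφ => (h φ).1 (h2 φ ((memX_iff φ).2 hφ))⟩
  · rintro ⟨h1, h2⟩
    exact ⟨(memX_iff ψ).2 h1, fun φ hφ => (h φ).2 (h2 φ ((memX_iff φ).1 hφ))⟩

theorem admissibleWeights_one : AdmissibleWeights univ (fun _ => 1) (fun _ => 1) :=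
  ⟨isOpen_univ, mem_univ _, measurable_const, measurable_const, fun _ _ => zero_le_one,
    fun _ _ => zero_le_one⟩

variable (hε0 : 0 ≤ ε) (hε1 : ε < 1)

include hε0 hε1

theorem exists_gPrime_le : ∃ C, ∀ p, gPrime ε p ≤ C * exp (-|p.2|) :=
  ⟨2 * (2 / (1 - ε)) ^ 2, fun p => by
    rw [gPrime_eq hε0 hε1, mul_assoc]
    exact mul_le_mul_of_nonneg_left (conformalFactor_decay hε0 hε1 p) zero_le_two⟩

theorem integrableOn_gPrime : IntegrableOn (gPrime ε) (cell univ) := by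
  obtain ⟨C, hC⟩ := exists_gPrime_le hε0 hε1
  refine (integrableOn_exp_neg_abs.const_mul C).mono'
    (measurable_gPrime ε).aestronglyMeasurable (.of_forall fun p => ?_)
  rw [norm_of_nonneg (gPrime_pos ε p).le]
  exact hC p

theorem integrableOn_gPrime_mul_sq {ψ : ℝ × ℝ → ℝ}
    (hψ : FiniteEnergy univ (fun _ => 1) (fun _ => 1) ψ) :
    IntegrableOn (fun p => gPrime ε p * ψ p ^ 2) (cell univ) := by
  obtain ⟨C, hC⟩ := exists_gPrime_le hε0 hε1
  refine (hψ.integrableOn_exp_mul_sq.const_mul C).mono'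
    ((measurable_gPrime ε).aestronglyMeasurable.mul
      ((aestronglyMeasurable_cell hψ.weaklyDifferentiable.hasD₁.1).pow 2))
    (.of_forall fun p => ?_)
  rw [norm_of_nonneg (mul_nonneg (gPrime_pos ε p).le (sq_nonneg _)), ← mul_assoc]
  exact mul_le_mul_of_nonneg_right (hC p) (sq_nonneg _)

theorem isFiniteMeasure_vortexMeasure : IsFiniteMeasure (vortexMeasure ε) :=
  isFiniteMeasure_withDensity_ofReal (integrableOn_gPrime hε0 hε1).2

omit hε0 hε1 in
theorem volume_cell_ne_zero {I : Set ℝ} (hI : IsOpen I) (h0 : (0 : ℝ) ∈ I) :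
    NeZero ((volume : Measure (ℝ × ℝ)).restrict (cell I)) := by
  refine ⟨fun h => ?_⟩
  rw [Measure.restrict_eq_zero] at h
  have h1 : (volume : Measure (ℝ × ℝ)) (Ioo 0 (2 * π) ×ˢ I) = 0 :=
    measure_mono_null (prod_mono Ioo_subset_Ioc_self subset_rfl) h
  exact ((isOpen_Ioo.prod hI).measure_pos volume
    ⟨(π, 0), ⟨Real.pi_pos, by linarith [Real.pi_pos]⟩, h0⟩).ne' h1

theorem memLp_vortexMeasure {ψ : ℝ × ℝ → ℝ}
    (hψ : FiniteEnergy univ (fun _ => 1) (fun _ => 1) ψ) : MemLp ψ 2 (vortexMeasure ε) := by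
  rw [memLp_two_iff_integrable_sq
    ((aestronglyMeasurable_cell hψ.weaklyDifferentiable.hasD₁.1).mono_ac vortexMeasure_ac),
    integrable_vortexMeasure]
  exact integrableOn_gPrime_mul_sq hε0 hε1 hψ

omit hε0 hε1 in
theorem eigenvalue_injective {n m : ℕ} (h : (n : ℝ) * (n + 1) / 2 = m * (m + 1) / 2) : n = m := by
  have hn : (0 : ℝ) ≤ n := n.cast_nonneg
  have hm : (0 : ℝ) ≤ m := m.cast_nonneg
  have h1 : ((n : ℝ) - m) * (n + m + 1) = 0 := by linarith
  have h2 := (mul_eq_zero.1 h1).resolve_right (by positivity)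
  exact_mod_cast sub_eq_zero.1 h2

theorem integral_weight_ne_zero : ∫ x in (0)..(2 * π), 1 / (1 + ε * cos x) ≠ 0 := by
  refine (intervalIntegral.intervalIntegral_pos_of_pos
    ((continuous_weight hε0 hε1).intervalIntegrable _ _) (fun x => ?_) Real.two_pi_pos).ne'
  exact one_div_pos.2 (weight_pos hε0 hε1 x)

/-- The spherical harmonics solve the eigenvalue problem on the cylinder. -/
theorem completeProblemX : CompleteProblem univ (fun _ => 1) (fun _ => 1)
    (fun x => 1 / (1 + ε * cos x)) (vortexMeasure ε)
    (fun n : {n : ℕ // 1 ≤ n} => ((n : ℕ) : ℝ) * ((n : ℕ) + 1) / 2)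
    (fun n => eigenfunctionsX ε n) := by
  simp only [eigenfunctionsX_eq hε0 hε1]
  have hne := volume_cell_ne_zero isOpen_univ (mem_univ 0)
  refine completeProblem_of_sphere (lam := fun n => (n : ℝ) * (n + 1) / 2) admissibleWeights_one
    (continuous_weight hε0 hε1) (integral_weight_ne_zero hε0 hε1)
    (isFiniteMeasure_vortexMeasure hε0 hε1) ⟨fun h => hne.out ?_⟩ vortexMeasure_ac ac_vortexMeasure
    (fun ψ hψ => memLp_vortexMeasure hε0 hε1 hψ.1) (continuous_sphereMap hε0 hε1).measurable
    (continuous_sphereMap hε0 hε1).continuousOn (injOn_sphereMap hε0 hε1)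
    (fun p _ => sphereMap_mem hε0 hε1 p) (fun x => by simp [sphereMap, gammaFun]) ?_
    (fun n hn => by positivity) (fun n m => eigenvalue_injective)
    (fun n k c => finiteEnergy_sphericalFun hε0 hε1 _ k c) (fun n k c φ hφ => ?_)
    (fun q k c hk => integral_sphericalFun_trace hε0 hε1 q k c hk)
  · exact Measure.measure_univ_eq_zero.1 (ac_vortexMeasure (by rw [h]; rfl))
  · have h1 : (1 : ℝ) + ε ≠ 0 := by positivity
    apply Complex.ext
    · simp [sphereMap, xiFun, add_comm ε, div_self h1]
    · simp [sphereMap, etaFun]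
  · rw [energyForm_sphericalFun hε0 hε1 n k c hφ, integral_vortexMeasure]

end VortexMeasure

/-! ### The change of variables `γ = tanh y` -/

section Mercator

theorem one_sub_tanh_sq (y : ℝ) : 1 - tanh y ^ 2 = 1 / cosh y ^ 2 := by
  rw [tanh_eq_sinh_div_cosh, div_pow, one_sub_div (pow_pos (cosh_pos y) 2).ne', cosh_sq']
  ring_nf

theorem one_sub_tanh_sq_pos (y : ℝ) : 0 < 1 - tanh y ^ 2 := by
  rw [one_sub_tanh_sq]
  have := cosh_pos y
  positivity

theorem tanh_mem_J (y : ℝ) : tanh y ∈ J := tanh_bijOn.mapsTo (mem_univ y)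

theorem contDiff_real_tanh : ContDiff ℝ ∞ tanh := by
  have : tanh = fun y => sinh y / cosh y := funext tanh_eq_sinh_div_cosh
  rw [this]
  exact contDiff_sinh.div contDiff_cosh fun y => (cosh_pos y).ne'

theorem hasDerivAt_real_tanh (y : ℝ) : HasDerivAt tanh (1 - tanh y ^ 2) y := by
  have h := (hasDerivAt_sinh y).div (hasDerivAt_cosh y) (cosh_pos y).ne'
  have h2 : tanh = sinh / cosh := funext tanh_eq_sinh_div_cosh
  rw [← h2] at h
  refine h.congr_deriv ?_
  rw [one_sub_tanh_sq, ← sq, ← sq, cosh_sq']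
  ring_nf

theorem contDiffOn_artanh : ContDiffOn ℝ ∞ artanh J := by
  intro s hs
  have h1 : 0 < 1 + s := by linarith [hs.1]
  have h2 : 0 < 1 - s := by linarith [hs.2]
  have h3 : 0 < (1 + s) / (1 - s) := div_pos h1 h2
  have h4 : ContDiffAt ℝ ∞ (fun s : ℝ => (1 + s) / (1 - s)) s :=
    (by fun_prop : ContDiffAt ℝ ∞ (fun s : ℝ => 1 + s) s).div (by fun_prop) h2.ne'
  exact ((h4.sqrt h3.ne').log (sqrt_pos.2 h3).ne').contDiffWithinAt

/-- The map `(x, y) ↦ (x, tanh y)` from the plane onto the strip `ℝ × (-1, 1)`. -/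
def mercator (p : ℝ × ℝ) : ℝ × ℝ := (p.1, tanh p.2)

theorem contDiff_mercator : ContDiff ℝ ∞ mercator :=
  contDiff_fst.prodMk (contDiff_real_tanh.comp contDiff_snd)

theorem mercator_mem (p : ℝ × ℝ) : mercator p ∈ strip J := ⟨mem_univ _, tanh_mem_J _⟩

theorem mercator_injective : Function.Injective mercator := fun _ _ h =>
  Prod.ext (congrArg Prod.fst h :) (tanh_injective (congrArg Prod.snd h :))

theorem measurableEmbedding_mercator : MeasurableEmbedding mercator :=
  contDiff_mercator.continuous.measurableEmbedding mercator_injective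

theorem measurePreserving_tanh : MeasurePreserving tanh
    (volume.withDensity fun y => ENNReal.ofReal (1 - tanh y ^ 2)) (volume.restrict J) := by
  refine ⟨contDiff_real_tanh.continuous.measurable, Measure.ext fun s hs => ?_⟩
  have hm : MeasurableSet (tanh ⁻¹' s) := contDiff_real_tanh.continuous.measurable hs
  rw [Measure.map_apply contDiff_real_tanh.continuous.measurable hs, withDensity_apply _ hm,
    lintegral_deriv_eq_volume_image_of_monotoneOn hm
      (fun y _ => (hasDerivAt_real_tanh y).hasDerivWithinAt), Measure.restrict_apply hs]
  · rw [image_preimage_eq_inter_range, ← image_univ, tanh_bijOn.image_eq]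
    rfl
  · exact (strictMono_of_deriv_pos fun y => by
      rw [(hasDerivAt_real_tanh y).deriv]; exact one_sub_tanh_sq_pos y).monotone.monotoneOn _

/-- Lebesgue measure on `s × (-1, 1)` is the image of `(1 - tanh² y) dx dy` on `s × ℝ`. -/
theorem measurePreserving_mercator (s : Set ℝ) : MeasurePreserving mercator
    (((volume : Measure (ℝ × ℝ)).restrict (s ×ˢ univ)).withDensity
      fun p => ENNReal.ofReal (1 - tanh p.2 ^ 2)) (volume.restrict (s ×ˢ J)) := by
  have hmeas : Measurable fun y : ℝ => ENNReal.ofReal (1 - tanh y ^ 2) :=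
    (measurable_const.sub (contDiff_real_tanh.continuous.measurable.pow_const 2)).ennreal_ofReal
  have h := (MeasurePreserving.id (volume.restrict s)).prod measurePreserving_tanh
  rw [prod_withDensity_right hmeas, Measure.prod_restrict] at h
  have h2 : (volume.restrict s).prod (volume : Measure ℝ) =
      (volume : Measure (ℝ × ℝ)).restrict (s ×ˢ univ) := by
    rw [Measure.volume_eq_prod, ← Measure.prod_restrict, Measure.restrict_univ]
  rw [h2] at h
  exact h

theorem measurable_jacobian : Measurable fun p : ℝ × ℝ => ENNReal.ofReal (1 - tanh p.2 ^ 2) :=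
  (measurable_const.sub
    ((contDiff_real_tanh.continuous.measurable.comp measurable_snd).pow_const 2)).ennreal_ofReal

theorem integral_mercator (s : Set ℝ) (f : ℝ × ℝ → ℝ) :
    ∫ p in s ×ˢ J, f p = ∫ p in s ×ˢ univ, (1 - tanh p.2 ^ 2) * f (mercator p) := by
  rw [← (measurePreserving_mercator s).integral_comp measurableEmbedding_mercator,
    integral_withDensity_eq_integral_toReal_smul measurable_jacobian
      (.of_forall fun _ => ENNReal.ofReal_lt_top)]
  simp only [ENNReal.toReal_ofReal (one_sub_tanh_sq_pos _).le, smul_eq_mul]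

theorem integrableOn_mercator (s : Set ℝ) (f : ℝ × ℝ → ℝ) : IntegrableOn f (s ×ˢ J) ↔
    IntegrableOn (fun p => (1 - tanh p.2 ^ 2) * f (mercator p)) (s ×ˢ univ) := by
  rw [IntegrableOn, ← (measurePreserving_mercator s).integrable_comp_emb
    measurableEmbedding_mercator, integrable_withDensity_iff_integrable_smul' measurable_jacobian
      (.of_forall fun _ => ENNReal.ofReal_lt_top)]
  simp only [ENNReal.toReal_ofReal (one_sub_tanh_sq_pos _).le, smul_eq_mul]
  rfl

theorem ae_mercator {P : ℝ × ℝ → Prop} (h : ∀ᵐ p ∂(volume.restrict (strip J)), P p) :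
    ∀ᵐ p ∂(volume.restrict (strip univ)), P (mercator p) := by
  have h1 := (measurePreserving_mercator univ).quasiMeasurePreserving.ae h
  exact (withDensity_absolutelyContinuous' measurable_jacobian.aemeasurable
    (.of_forall fun p => (ENNReal.ofReal_pos.2 (one_sub_tanh_sq_pos p.2)).ne')).ae_le h1

theorem continuous_cosh_sq : Continuous fun p : ℝ × ℝ => cosh p.2 ^ 2 := by fun_prop

theorem locallyIntegrableOn_comp_mercator {f : ℝ × ℝ → ℝ}
    (hf : LocallyIntegrableOn f (strip J)) :
    LocallyIntegrableOn (fun p => f (mercator p)) (strip univ) := by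
  rw [locallyIntegrableOn_iff (isOpen_strip isOpen_univ).isLocallyClosed]
  intro K _ hK
  have hK' := hK.image contDiff_mercator.continuous
  have hi := (locallyIntegrableOn_iff (isOpen_strip isOpen_J).isLocallyClosed).1 hf _
    (by rintro _ ⟨p, -, rfl⟩; exact mercator_mem p) hK'
  rw [← integrable_indicator_iff hK'.measurableSet, ← integrableOn_univ] at hi
  have h1 := (integrableOn_mercator univ _).1 (hi.mono_set (subset_univ _))
  have h2 : IntegrableOn (fun p => (1 - tanh p.2 ^ 2) * f (mercator p)) K := by
    rw [← integrable_indicator_iff hK.measurableSet]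
    rw [univ_prod_univ, integrableOn_univ] at h1
    refine h1.congr (.of_forall fun p => ?_)
    by_cases hp : p ∈ K
    · simp only [indicator_of_mem hp, indicator_of_mem (mem_image_of_mem mercator hp)]
    · have hp' : mercator p ∉ mercator '' K := by rwa [mercator_injective.mem_set_image]
      simp only [indicator_of_notMem hp, indicator_of_notMem hp', mul_zero]
  refine (h2.continuousOn_mul continuous_cosh_sq.continuousOn hK).congr_fun (fun p _ => ?_)
    hK.measurableSet
  have := (cosh_pos p.2).ne'
  simp only [one_sub_tanh_sq]
  field_simp

/-- Test functions on the plane are test functions on the strip in the variable `γ = tanh y`. -/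
theorem exists_testFunction {χ : ℝ × ℝ → ℝ} (hχ : ContDiff ℝ ∞ χ) (hc : HasCompactSupport χ) :
    ∃ χ' : ℝ × ℝ → ℝ, ContDiff ℝ ∞ χ' ∧ HasCompactSupport χ' ∧ tsupport χ' ⊆ strip J ∧
      ∀ p, χ' (mercator p) = χ p := by
  classical
  set K := mercator '' tsupport χ with hKdef
  have hK : IsCompact K := hc.image contDiff_mercator.continuous
  have hKJ : K ⊆ strip J := by rintro _ ⟨p, -, rfl⟩; exact mercator_mem p
  set χ' : ℝ × ℝ → ℝ := (strip J).indicator fun q => χ (q.1, artanh q.2) with hχ'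
  have hzero : ∀ q ∉ K, χ' q = 0 := fun q hq => by
    by_cases hqJ : q ∈ strip J
    · rw [hχ', indicator_of_mem hqJ]
      refine image_eq_zero_of_notMem_tsupport fun h => hq ⟨_, h, ?_⟩
      rw [mercator, tanh_artanh hqJ.2]
    · rw [hχ', indicator_of_notMem hqJ]
  refine ⟨χ', contDiff_iff_contDiffAt.2 fun q => ?_, HasCompactSupport.intro hK hzero,
    (closure_minimal (fun q hq => ?_) hK.isClosed).trans hKJ, fun p => ?_⟩
  · by_cases hq : q ∈ K
    · have hU := (isOpen_strip isOpen_J).mem_nhds (hKJ hq)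
      have h1 : ContDiffAt ℝ ∞ (fun q : ℝ × ℝ => artanh q.2) q :=
        (contDiffOn_artanh.contDiffAt (isOpen_J.mem_nhds (hKJ hq).2)).comp q contDiffAt_snd
      have h2 : ContDiffAt ℝ ∞ (fun q : ℝ × ℝ => χ (q.1, artanh q.2)) q :=
        hχ.contDiffAt.comp q (contDiffAt_fst.prodMk h1)
      refine h2.congr_of_eventuallyEq ?_
      filter_upwards [hU] with p hp
      rw [hχ', indicator_of_mem hp]
    · refine (contDiffAt_const (c := (0 : ℝ))).congr_of_eventuallyEq ?_
      filter_upwards [hK.isClosed.isOpen_compl.mem_nhds hq] with p hp using hzero p hp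
  · by_contra h
    exact hq (hzero q h)
  · rw [hχ', indicator_of_mem (mercator_mem p)]
    simp only [mercator, artanh_tanh]

theorem fderiv_comp_mercator_fst {f : ℝ × ℝ → ℝ} {p : ℝ × ℝ}
    (hf : DifferentiableAt ℝ f (mercator p)) :
    fderiv ℝ (fun p => f (mercator p)) p (1, 0) = fderiv ℝ f (mercator p) (1, 0) := by
  refine fderiv_fst_eq (hf.comp p (contDiff_mercator.differentiable (by simp) p)) ?_
  exact hf.hasFDerivAt.comp_hasDerivAt (f := fun x : ℝ => (x, tanh p.2)) p.1
    ((hasDerivAt_id p.1).prodMk (hasDerivAt_const p.1 _))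

theorem fderiv_comp_mercator_snd {f : ℝ × ℝ → ℝ} {p : ℝ × ℝ}
    (hf : DifferentiableAt ℝ f (mercator p)) :
    fderiv ℝ (fun p => f (mercator p)) p (0, 1) =
      (1 - tanh p.2 ^ 2) * fderiv ℝ f (mercator p) (0, 1) := by
  refine fderiv_snd_eq (hf.comp p (contDiff_mercator.differentiable (by simp) p)) ?_
  have h := hf.hasFDerivAt.comp_hasDerivAt (f := fun y : ℝ => (p.1, tanh y)) p.2
    ((hasDerivAt_const p.2 p.1).prodMk (hasDerivAt_real_tanh p.2))
  refine h.congr_deriv ?_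
  rw [← smul_eq_mul, ← map_smul]
  simp

theorem HasWeakDeriv.comp_mercator_fst {f g : ℝ × ℝ → ℝ}
    (h : HasWeakDeriv (strip J) (1, 0) f g) :
    HasWeakDeriv (strip univ) (1, 0) (fun p => f (mercator p)) fun p => g (mercator p) := by
  refine ⟨locallyIntegrableOn_comp_mercator h.1, locallyIntegrableOn_comp_mercator h.2.1,
    fun χ hχ hc _ => ?_⟩
  -- test with `χ` divided by the Jacobian `1 / cosh² y`
  have hχc : ContDiff ℝ ∞ fun p : ℝ × ℝ => cosh p.2 ^ 2 * χ p :=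
    ((contDiff_cosh.comp contDiff_snd).pow 2).mul hχ
  obtain ⟨χ', h1, h2, h3, h4⟩ := exists_testFunction hχc hc.mul_left
  have key := h.2.2 χ' h1 h2 h3
  rw [strip, integral_mercator, integral_mercator] at key
  have hJ : ∀ p : ℝ × ℝ, (1 - tanh p.2 ^ 2) * cosh p.2 ^ 2 = 1 := fun p => by
    rw [one_sub_tanh_sq]
    exact one_div_mul_cancel (pow_pos (cosh_pos _) 2).ne'
  have hd : ∀ p, fderiv ℝ χ' (mercator p) (1, 0) = cosh p.2 ^ 2 * fderiv ℝ χ p (1, 0) := by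
    intro p
    rw [← fderiv_comp_mercator_fst (h1.differentiable (by simp) _), funext h4]
    refine fderiv_fst_eq (hχc.differentiable (by simp) p) ?_
    refine HasDerivAt.const_mul (cosh p.2 ^ 2) ?_
    exact (hχ.differentiable (by simp) p).hasFDerivAt.comp_hasDerivAt
      (f := fun x : ℝ => (x, p.2)) p.1 ((hasDerivAt_id p.1).prodMk (hasDerivAt_const p.1 _))
  refine (integral_congr_ae (.of_forall fun p => ?_)).trans (key.trans
    (congrArg _ (integral_congr_ae (.of_forall fun p => ?_))))
  · simp only [hd]
    linear_combination -(f (mercator p) * fderiv ℝ χ p (1, 0)) * hJ p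
  · simp only [h4]
    linear_combination (g (mercator p) * χ p) * hJ p

theorem HasWeakDeriv.comp_mercator_snd {f g : ℝ × ℝ → ℝ}
    (h : HasWeakDeriv (strip J) (0, 1) f g) :
    HasWeakDeriv (strip univ) (0, 1) (fun p => f (mercator p))
      fun p => (1 - tanh p.2 ^ 2) * g (mercator p) := by
  have hcont : Continuous fun p : ℝ × ℝ => 1 - tanh p.2 ^ 2 :=
    continuous_const.sub ((contDiff_real_tanh.continuous.comp continuous_snd).pow 2)
  refine ⟨locallyIntegrableOn_comp_mercator h.1,
    (locallyIntegrableOn_comp_mercator h.2.1).continuousOn_mul hcont.continuousOn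
      (isOpen_strip isOpen_univ).isLocallyClosed,
    fun χ hχ hc _ => ?_⟩
  obtain ⟨χ', h1, h2, h3, h4⟩ := exists_testFunction hχ hc
  have key := h.2.2 χ' h1 h2 h3
  rw [strip, integral_mercator, integral_mercator] at key
  have hd : ∀ p, fderiv ℝ χ p (0, 1) = (1 - tanh p.2 ^ 2) * fderiv ℝ χ' (mercator p) (0, 1) := by
    intro p
    rw [← fderiv_comp_mercator_snd (h1.differentiable (by simp) _), funext h4]
  refine (integral_congr_ae (.of_forall fun p => ?_)).trans (key.trans
    (congrArg _ (integral_congr_ae (.of_forall fun p => ?_))))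
  · simp only [hd]
    ring
  · simp only [h4]
    ring

end Mercator

/-! ### The eigenvalue problem on the sphere -/

section Sphere

open Polynomial

theorem one_sub_sq_pos_of_mem_J {s : ℝ} (hs : s ∈ J) : 0 < 1 - s ^ 2 := by
  nlinarith [hs.1, hs.2]

theorem admissibleWeights_sphere :
    AdmissibleWeights J (fun s => 1 / (1 - s ^ 2)) (fun s => 1 - s ^ 2) where
  isOpen := isOpen_J
  zero_mem := by constructor <;> norm_num
  measurable₁ := by fun_prop
  measurable₂ := by fun_prop
  nonneg₁ s hs := (one_div_pos.2 (one_sub_sq_pos_of_mem_J hs)).le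
  nonneg₂ s hs := (one_sub_sq_pos_of_mem_J hs).le

theorem WeaklyDifferentiable.comp_mercator {Ψ : ℝ × ℝ → ℝ} (h : WeaklyDifferentiable J Ψ) :
    WeaklyDifferentiable univ fun p => Ψ (mercator p) :=
  ⟨⟨_, h.hasD₁.comp_mercator_fst⟩, ⟨_, h.hasD₂.comp_mercator_snd⟩⟩

theorem WeaklyDifferentiable.D₁_comp_mercator {Ψ : ℝ × ℝ → ℝ} (h : WeaklyDifferentiable J Ψ) :
    D₁ univ (fun p => Ψ (mercator p)) =ᵐ[volume.restrict (cell univ)]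
      fun p => D₁ J Ψ (mercator p) :=
  ae_restrict_cell (h.hasD₁.comp_mercator_fst.weakDeriv_ae_eq (isOpen_strip isOpen_univ))

theorem WeaklyDifferentiable.D₂_comp_mercator {Ψ : ℝ × ℝ → ℝ} (h : WeaklyDifferentiable J Ψ) :
    D₂ univ (fun p => Ψ (mercator p)) =ᵐ[volume.restrict (cell univ)]
      fun p => (1 - tanh p.2 ^ 2) * D₂ J Ψ (mercator p) :=
  ae_restrict_cell (h.hasD₂.comp_mercator_snd.weakDeriv_ae_eq (isOpen_strip isOpen_univ))

theorem finiteEnergy_comp_mercator_iff {Ψ : ℝ × ℝ → ℝ} (hper : PeriodicOn J Ψ)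
    (h : WeaklyDifferentiable J Ψ) :
    FiniteEnergy J (fun s => 1 / (1 - s ^ 2)) (fun s => 1 - s ^ 2) Ψ ↔
      FiniteEnergy univ (fun _ => 1) (fun _ => 1) fun p => Ψ (mercator p) := by
  have e₁ : IntegrableOn (fun p => 1 / (1 - p.2 ^ 2) * D₁ J Ψ p ^ 2) (cell J) ↔
      IntegrableOn (fun p => 1 * D₁ univ (fun p => Ψ (mercator p)) p ^ 2) (cell univ) := by
    rw [cell, integrableOn_mercator]
    refine integrable_congr ?_
    filter_upwards [h.D₁_comp_mercator] with p hp
    have := (one_sub_tanh_sq_pos p.2).ne'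
    rw [hp]
    simp only [mercator]
    field_simp
  have e₂ : IntegrableOn (fun p => (1 - p.2 ^ 2) * D₂ J Ψ p ^ 2) (cell J) ↔
      IntegrableOn (fun p => 1 * D₂ univ (fun p => Ψ (mercator p)) p ^ 2) (cell univ) := by
    rw [cell, integrableOn_mercator]
    refine integrable_congr ?_
    filter_upwards [h.D₂_comp_mercator] with p hp
    rw [hp]
    simp only [mercator]
    ring
  exact ⟨fun H => ⟨ae_mercator hper, h.comp_mercator, e₁.1 H.energy₁, e₂.1 H.energy₂⟩,
    fun H => ⟨hper, h, e₁.2 H.energy₁, e₂.2 H.energy₂⟩⟩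

/-- The Dirichlet integral is conformally invariant. -/
theorem energyForm_comp_mercator {Ψ Φ : ℝ × ℝ → ℝ} (hΨ : WeaklyDifferentiable J Ψ)
    (hΦ : WeaklyDifferentiable J Φ) :
    energyForm J (fun s => 1 / (1 - s ^ 2)) (fun s => 1 - s ^ 2) Ψ Φ =
      energyForm univ (fun _ => 1) (fun _ => 1) (fun p => Ψ (mercator p))
        fun p => Φ (mercator p) := by
  rw [energyForm, energyForm, cell, integral_mercator]
  refine integral_congr_ae ?_
  filter_upwards [hΨ.D₁_comp_mercator, hΨ.D₂_comp_mercator, hΦ.D₁_comp_mercator,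
    hΦ.D₂_comp_mercator] with p h1 h2 h3 h4
  have := (one_sub_tanh_sq_pos p.2).ne'
  rw [h1, h2, h3, h4]
  simp only [mercator]
  field_simp

theorem gPrime_zero (p : ℝ × ℝ) : gPrime 0 p = 2 * (1 - tanh p.2 ^ 2) := by
  rw [gPrime_eq le_rfl one_pos, conformalFactor, one_sub_tanh_sq]
  simp

theorem sphereCoords_mercator (p : ℝ × ℝ) : sphereCoords (mercator p) = sphereMap 0 p := by
  have hc := cosh_pos p.2
  have h : √(1 - tanh p.2 ^ 2) = 1 / cosh p.2 := by
    rw [one_sub_tanh_sq, ← one_div_pow, sqrt_sq (by positivity)]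
  refine Prod.ext ?_ ?_
  · simp only [sphereCoords, sphereMap, mercator, h]
    rw [Complex.exp_mul_I, ← Complex.ofReal_cos, ← Complex.ofReal_sin]
    apply Complex.ext
    · rw [Complex.re_ofReal_mul]
      simp [xiFun, -Complex.ofReal_cos, -Complex.ofReal_sin]
      field_simp
    · rw [Complex.im_ofReal_mul]
      simp [etaFun, -Complex.ofReal_cos, -Complex.ofReal_sin]
      field_simp
  · simp [sphereCoords, mercator, sphereMap, gammaFun, tanh_eq_sinh_div_cosh]

theorem continuous_sphereCoords : Continuous sphereCoords := by
  unfold sphereCoords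
  fun_prop

theorem sphereCoords_periodic (p : ℝ × ℝ) :
    sphereCoords (p.1 + 2 * π, p.2) = sphereCoords p := by
  have h : ((p.1 + 2 * π : ℝ) : ℂ) * Complex.I = p.1 * Complex.I + 2 * π * Complex.I := by
    push_cast
    ring
  simp only [sphereCoords]
  rw [h, Complex.exp_add, Complex.exp_two_pi_mul_I, mul_one]

theorem sphereCoords_mem {p : ℝ × ℝ} (hp : p.2 ∈ J) : sphereCoords p ∈ unitSphere := by
  have h := one_sub_sq_pos_of_mem_J hp
  change Complex.normSq (sphereCoords p).1 + p.2 ^ 2 = 1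
  rw [sphereCoords, map_mul, Complex.normSq_ofReal, Complex.normSq_eq_norm_sq,
    Complex.norm_exp_ofReal_mul_I, ← sq, sq_sqrt h.le]
  ring

theorem injOn_sphereCoords : InjOn sphereCoords (cell J) := by
  rintro ⟨x, s⟩ ⟨hx, hs⟩ ⟨x', s'⟩ ⟨hx', -⟩ h
  have hss : s = s' := congrArg Prod.snd h
  subst hss
  have h1 := congrArg Prod.fst h
  have h0 : ((√(1 - s ^ 2) : ℝ) : ℂ) ≠ 0 := by
    exact_mod_cast (sqrt_pos.2 (one_sub_sq_pos_of_mem_J hs)).ne'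
  have h2 := mul_left_cancel₀ h0 h1
  rw [Complex.exp_mul_I, Complex.exp_mul_I, ← Complex.ofReal_cos, ← Complex.ofReal_sin,
    ← Complex.ofReal_cos, ← Complex.ofReal_sin] at h2
  have hc := congrArg Complex.re h2
  have hs' := congrArg Complex.im h2
  have hxx : x = x' := eq_of_cos_eq_of_sin_eq hx hx'
    (by simpa [-Complex.ofReal_cos, -Complex.ofReal_sin] using hc)
    (by simpa [-Complex.ofReal_cos, -Complex.ofReal_sin] using hs')
  rw [hxx]

theorem contDiffOn_sphericalFun_sphereCoords (q : ℝ[X]) (k : ℕ) (c : ℂ) :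
    ContDiffOn ℝ ∞ (fun p => sphericalFun q k c (sphereCoords p)) (strip J) := by
  intro p hp
  have h0 : 1 - p.2 ^ 2 ≠ 0 := (one_sub_sq_pos_of_mem_J hp.2).ne'
  have h1 : ContDiffAt ℝ ∞ (fun p : ℝ × ℝ => √(1 - p.2 ^ 2)) p :=
    (by fun_prop : ContDiffAt ℝ ∞ (fun p : ℝ × ℝ => 1 - p.2 ^ 2) p).sqrt h0
  have h2 : ContDiff ℝ ∞ fun p : ℝ × ℝ => Complex.exp (p.1 * Complex.I) :=
    ((Complex.ofRealCLM.contDiff.comp contDiff_fst).mul contDiff_const).cexp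
  have h3 : ContDiffAt ℝ ∞ (fun p => (sphereCoords p).1) p :=
    (Complex.ofRealCLM.contDiff.contDiffAt.comp p h1).mul h2.contDiffAt
  have hq : ContDiff ℝ ∞ fun p : ℝ × ℝ => q.eval p.2 := by
    simp_rw [Polynomial.eval_eq_sum_range]
    fun_prop
  exact (hq.contDiffAt.mul (Complex.reCLM.contDiff.contDiffAt.comp p
    (contDiffAt_const.mul (h3.pow k)))).contDiffWithinAt

theorem integrableOn_sq_of_finiteEnergy {Ψ : ℝ × ℝ → ℝ}
    (h : FiniteEnergy J (fun s => 1 / (1 - s ^ 2)) (fun s => 1 - s ^ 2) Ψ) :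
    IntegrableOn (fun p => Ψ p ^ 2) (cell J) := by
  have h1 := integrableOn_gPrime_mul_sq le_rfl one_pos
    ((finiteEnergy_comp_mercator_iff h.periodic h.weaklyDifferentiable).1 h)
  rw [cell, integrableOn_mercator]
  refine (h1.div_const 2).congr (.of_forall fun p => ?_)
  simp only [gPrime_zero]
  ring

theorem finiteEnergy_sphericalFun_sphereCoords (q : ℝ[X]) (k : ℕ) (c : ℂ) :
    FiniteEnergy J (fun s => 1 / (1 - s ^ 2)) (fun s => 1 - s ^ 2)
      fun p => sphericalFun q k c (sphereCoords p) := by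
  rw [finiteEnergy_comp_mercator_iff (.of_forall fun p => by rw [sphereCoords_periodic])
    (weaklyDifferentiable_of_contDiffOn isOpen_J (contDiffOn_sphericalFun_sphereCoords q k c))]
  simp only [sphereCoords_mercator]
  exact finiteEnergy_sphericalFun le_rfl one_pos q k c

theorem energyForm_sphericalFun_sphereCoords (n k : ℕ) (c : ℂ) {Φ : ℝ × ℝ → ℝ}
    (hΦ : FiniteEnergy J (fun s => 1 / (1 - s ^ 2)) (fun s => 1 - s ^ 2) Φ) :
    energyForm J (fun s => 1 / (1 - s ^ 2)) (fun s => 1 - s ^ 2)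
      (fun p => sphericalFun (derivative^[k] (legendre n)) k c (sphereCoords p)) Φ =
    n * (n + 1) * ∫ p in cell J,
      sphericalFun (derivative^[k] (legendre n)) k c (sphereCoords p) * Φ p := by
  rw [energyForm_comp_mercator (weaklyDifferentiable_of_contDiffOn isOpen_J
    (contDiffOn_sphericalFun_sphereCoords _ k c)) hΦ.weaklyDifferentiable]
  simp only [sphereCoords_mercator]
  rw [energyForm_sphericalFun le_rfl one_pos n k c
    ((finiteEnergy_comp_mercator_iff hΦ.periodic hΦ.weaklyDifferentiable).1 hΦ), cell, cell,
    integral_mercator, ← integral_const_mul, ← integral_const_mul]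
  refine integral_congr_ae (.of_forall fun p => ?_)
  simp only [gPrime_zero, sphereCoords_mercator]
  ring

theorem isFiniteMeasure_cell_J :
    IsFiniteMeasure ((volume : Measure (ℝ × ℝ)).restrict (cell J)) := by
  rw [volume_restrict_cell]
  have h1 : IsFiniteMeasure ((volume : Measure ℝ).restrict (Ioc 0 (2 * π))) := inferInstance
  have h2 : IsFiniteMeasure ((volume : Measure ℝ).restrict J) := by unfold J; infer_instance
  infer_instance

theorem measureReal_cell_J : ((volume : Measure (ℝ × ℝ)).restrict (cell J)).real univ = 4 * π := by
  rw [measureReal_restrict_apply_univ, cell, Measure.volume_eq_prod, measureReal_prod_prod, J,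
    volume_real_Ioc_of_le Real.two_pi_pos.le, volume_real_Ioo_of_le (by norm_num)]
  ring

theorem projY_eq (Ψ : ℝ × ℝ → ℝ) : projY Ψ = ⨍ p, Ψ p ∂(volume.restrict (cell J)) := by
  rw [projY, average_eq, measureReal_cell_J, smul_eq_mul, div_eq_inv_mul]

theorem memY_iff (Ψ : ℝ × ℝ → ℝ) : MemY Ψ ↔
    MemEnergy J (fun s => 1 / (1 - s ^ 2)) (fun s => 1 - s ^ 2) (fun _ => 1) Ψ := by
  constructor
  · rintro ⟨h1, h2, h3, h4, h5⟩
    exact ⟨⟨h1, h2, h3, h4⟩, by simpa using h5⟩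
  · rintro ⟨⟨h1, h2, h3, h4⟩, h5⟩
    exact ⟨h1, h2, h3, h4, by simpa using h5⟩

theorem solvesY_iff (l : ℝ) (Ψ : ℝ × ℝ → ℝ) : SolvesY l Ψ ↔
    IsWeakSolution J (fun s => 1 / (1 - s ^ 2)) (fun s => 1 - s ^ 2) (fun _ => 1)
      (volume.restrict (cell J)) (2 * l) Ψ := by
  rw [SolvesY, projY_eq]
  constructor
  · rintro ⟨h1, h2⟩
    exact ⟨(memY_iff Ψ).1 h1, fun φ hφ => h2 φ ((memY_iff φ).2 hφ)⟩
  · rintro ⟨h1, h2⟩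
    exact ⟨(memY_iff Ψ).2 h1, fun φ hφ => h2 φ ((memY_iff φ).1 hφ)⟩

theorem memLp_of_finiteEnergy {Ψ : ℝ × ℝ → ℝ}
    (h : FiniteEnergy J (fun s => 1 / (1 - s ^ 2)) (fun s => 1 - s ^ 2) Ψ) :
    MemLp Ψ 2 (volume.restrict (cell J)) :=
  (memLp_two_iff_integrable_sq (aestronglyMeasurable_cell h.weaklyDifferentiable.hasD₁.1)).2
    (integrableOn_sq_of_finiteEnergy h)

/-- The spherical harmonics solve the eigenvalue problem on the sphere. The eigenvalues are doubled,
as the equation is normalised with the factor `2 lam`. -/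
theorem completeProblemY : CompleteProblem J (fun s => 1 / (1 - s ^ 2)) (fun s => 1 - s ^ 2)
    (fun _ => 1) (volume.restrict (cell J))
    (fun n : {n : ℕ // 1 ≤ n} => 2 * (((n : ℕ) : ℝ) * ((n : ℕ) + 1) / 2))
    (fun n => eigenfunctionsY n) := by
  simp only [eigenfunctionsY_eq]
  have h0 : ∀ x : ℝ, sphereCoords (x, 0) = sphereMap 0 (x, 0) := fun x => by
    rw [← sphereCoords_mercator, mercator, tanh_zero]
  refine completeProblem_of_sphere (lam := fun n => 2 * ((n : ℝ) * (n + 1) / 2))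
    admissibleWeights_sphere continuous_const ?_ isFiniteMeasure_cell_J
    (volume_cell_ne_zero isOpen_J (by constructor <;> norm_num)) Measure.AbsolutelyContinuous.rfl
    Measure.AbsolutelyContinuous.rfl (fun Ψ hΨ => memLp_of_finiteEnergy hΨ.1)
    continuous_sphereCoords.measurable continuous_sphereCoords.continuousOn injOn_sphereCoords
    (fun p hp => sphereCoords_mem hp.2) (fun x => rfl) ?_ (fun n hn => by positivity)
    (fun n m h => eigenvalue_injective (mul_left_cancel₀ two_ne_zero h))
    (fun n k c => finiteEnergy_sphericalFun_sphereCoords _ k c) (fun n k c Φ hΦ => ?_)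
    (fun q k c hk => ?_)
  · simp
  · simp [sphereCoords]
  · rw [energyForm_sphericalFun_sphereCoords n k c hΦ]
    ring
  · have := integral_sphericalFun_trace le_rfl one_pos q k c hk
    simp only [h0]
    simpa using this

end Sphere

/-! ### The linearised operator -/

section Kernel

variable {ε : ℝ}

theorem inKerA_iff (ψ : ℝ × ℝ → ℝ) : InKerA ε ψ ↔ SolvesX ε 1 ψ := by
  simp only [InKerA, SolvesX, formA, sub_eq_zero, one_mul]

theorem eigenfunctionsX_one (hε0 : 0 ≤ ε) (hε1 : ε < 1) :
    eigenfunctionsX ε 1 = {etaFun ε, gammaFun ε, xiFun ε} := by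
  have h0 : (fun p => (legendre 1).eval (sphereMap ε p).2 - (legendre 1).eval 0) = gammaFun ε := by
    ext p
    simp [legendre_one, sphereMap]
  have h1 : (fun p => sphericalFun (Polynomial.derivative^[1] (legendre 1)) 1 1 (sphereMap ε p)) =
      xiFun ε := by
    ext p
    simp [legendre_one, sphericalFun, sphereMap]
  have h2 : (fun p => sphericalFun (Polynomial.derivative^[1] (legendre 1)) 1 (-Complex.I)
      (sphereMap ε p)) = etaFun ε := by
    ext p
    simp [legendre_one, sphericalFun, sphereMap]
  rw [eigenfunctionsX_eq hε0 hε1, legendreSystem, h0]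
  ext F
  constructor
  · rintro (rfl | ⟨k, hk, hk', hF⟩)
    · exact Or.inr (Or.inl rfl)
    · obtain rfl : k = 1 := le_antisymm hk' hk
      rw [h1, h2] at hF
      rcases hF with rfl | rfl
      · exact Or.inr (Or.inr rfl)
      · exact Or.inl rfl
  · rintro (rfl | rfl | rfl)
    · exact Or.inr ⟨1, le_rfl, le_rfl, Or.inr h2.symm⟩
    · exact Or.inl rfl
    · exact Or.inr ⟨1, le_rfl, le_rfl, Or.inl h1.symm⟩

/-- All eigenvalues other than the first are at least `3`, so that
`∬ g'(ψ_ε) (ψ - P_ε ψ) ψ ≤ ‖ψ‖² / 3` on the orthogonal complement of the kernel. -/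
theorem coercive_formA (hε0 : 0 ≤ ε) (hε1 : ε < 1) {ψ : ℝ × ℝ → ℝ} (hψ : MemX ε ψ)
    (horth : ∀ φ, InKerA ε φ → dirichletX ψ φ = 0) :
    2 / 3 * dirichletX ψ ψ ≤ formA ε ψ ψ := by
  have h1 : ((1 : ℕ) : ℝ) * ((1 : ℕ) + 1) / 2 = 1 := by norm_num
  have h := (completeProblemX hε0 hε1).le_energyForm (Λ := 3) (n₀ := ⟨1, le_rfl⟩) zero_le_three
    (by norm_num) ?_ ((memX_iff ψ).1 hψ) ?_
  · rw [formA, integral_gPrime_mul_sub_projX, dirichletX_eq]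
    linarith
  · rintro ⟨n, hn⟩ hne
    have hn2 : (2 : ℝ) ≤ n := by
      exact_mod_cast lt_of_le_of_ne hn fun h => hne (Subtype.ext h.symm)
    simp only
    nlinarith
  · intro e he
    simp only [h1] at he
    rw [← dirichletX_eq]
    exact horth e ((inKerA_iff e).2 ((solvesX_iff 1 e).2 he))

end Kernel

end KelvinStuart

end

theorem theorem2 (ε : ℝ) (hε0 : 0 ≤ ε) (hε1 : ε < 1) :
    -- the integrals that enter the two eigenvalue problems converge
    (∀ Ψ, KelvinStuart.MemY Ψ →
      IntegrableOn (fun p => Ψ p ^ 2) (KelvinStuart.cell KelvinStuart.J)) ∧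
    IntegrableOn (KelvinStuart.gPrime ε) (KelvinStuart.cell univ) ∧
    (∀ ψ, KelvinStuart.MemX ε ψ →
      IntegrableOn (fun p => KelvinStuart.gPrime ε p * ψ p ^ 2) (KelvinStuart.cell univ)) ∧
    -- eigenvalues and eigenspaces in the variables `(θ, γ)`
    (∀ lam : ℝ, KelvinStuart.IsEigenvalueY lam ↔
      ∃ n : ℕ, 1 ≤ n ∧ lam = (n : ℝ) * ((n : ℝ) + 1) / 2) ∧
    (∀ n : ℕ, 1 ≤ n → ∀ Ψ : ℝ × ℝ → ℝ,
      KelvinStuart.SolvesY ((n : ℝ) * ((n : ℝ) + 1) / 2) Ψ ↔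
        ∃ Φ ∈ Submodule.span ℝ (KelvinStuart.eigenfunctionsY n),
          Ψ =ᵐ[volume.restrict (KelvinStuart.strip KelvinStuart.J)] Φ) ∧
    -- eigenvalues and eigenspaces in the variables `(x, y)`
    (∀ lam : ℝ, KelvinStuart.IsEigenvalueX ε lam ↔
      ∃ n : ℕ, 1 ≤ n ∧ lam = (n : ℝ) * ((n : ℝ) + 1) / 2) ∧
    (∀ n : ℕ, 1 ≤ n → ∀ ψ : ℝ × ℝ → ℝ,
      KelvinStuart.SolvesX ε ((n : ℝ) * ((n : ℝ) + 1) / 2) ψ ↔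
        ∃ φ ∈ Submodule.span ℝ (KelvinStuart.eigenfunctionsX ε n), ψ =ᵐ[volume] φ) ∧
    -- the kernel of `Ã_ε`
    (∀ ψ : ℝ × ℝ → ℝ, KelvinStuart.InKerA ε ψ ↔
      ∃ φ ∈ Submodule.span ℝ
        {KelvinStuart.etaFun ε, KelvinStuart.gammaFun ε, KelvinStuart.xiFun ε},
        ψ =ᵐ[volume] φ) ∧
    -- coercivity on the orthogonal complement of the kernel
    (∀ ψ : ℝ × ℝ → ℝ, KelvinStuart.MemX ε ψ →
      (∀ φ, KelvinStuart.InKerA ε φ → KelvinStuart.dirichletX ψ φ = 0) →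
      (2 / 3) * KelvinStuart.dirichletX ψ ψ ≤ KelvinStuart.formA ε ψ ψ) := by
  have PX := KelvinStuart.completeProblemX hε0 hε1
  have hX : ∀ n : ℕ, 1 ≤ n → ∀ ψ : ℝ × ℝ → ℝ,
      KelvinStuart.SolvesX ε ((n : ℝ) * ((n : ℝ) + 1) / 2) ψ ↔
        ∃ φ ∈ Submodule.span ℝ (KelvinStuart.eigenfunctionsX ε n), ψ =ᵐ[volume] φ := by
    intro n hn ψ
    have h := PX.isWeakSolution_iff ⟨n, hn⟩ ψ
    rw [KelvinStuart.strip_univ, Measure.restrict_univ] at h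
    exact (KelvinStuart.solvesX_iff _ ψ).trans h
  refine ⟨fun Ψ hΨ => KelvinStuart.integrableOn_sq_of_finiteEnergy
    ((KelvinStuart.memY_iff Ψ).1 hΨ).1, KelvinStuart.integrableOn_gPrime hε0 hε1,
    fun ψ hψ => KelvinStuart.integrableOn_gPrime_mul_sq hε0 hε1
    ((KelvinStuart.memX_iff ψ).1 hψ).1, fun lam => ?_, fun n hn Ψ => ?_, fun lam => ?_, hX,
    fun ψ => ?_, fun ψ hψ horth => KelvinStuart.coercive_formA hε0 hε1 hψ horth⟩
  · have h := KelvinStuart.completeProblemY.exists_isWeakSolution_iff (2 * lam)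
    simp only [KelvinStuart.IsEigenvalueY, KelvinStuart.solvesY_iff, h, Subtype.exists,
      mul_right_inj' (two_ne_zero' ℝ), exists_prop]
  · exact (KelvinStuart.solvesY_iff _ Ψ).trans
      (KelvinStuart.completeProblemY.isWeakSolution_iff ⟨n, hn⟩ Ψ)
  · have h := PX.exists_isWeakSolution_iff lam
    rw [KelvinStuart.strip_univ, Measure.restrict_univ] at h
    simp only [KelvinStuart.IsEigenvalueX, KelvinStuart.solvesX_iff, h, Subtype.exists,
      exists_prop]
  · have h := hX 1 le_rfl ψ
    rw [KelvinStuart.eigenfunctionsX_one hε0 hε1] at h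
    rw [KelvinStuart.inKerA_iff, ← h]
    norm_num
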